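/- Let $U=I\times J\subseteq\mathbb R^2$ be an open box with coordinates $(u^1,u^2)$ ($I,J$ intervals), and consider matrix differential operators $\sum_m A_m\,d_x^m$ ($d_x=\frac{d}{dx}$) whose entries are differential polynomials in $u^i_x,u^i_{xx},\dots$ with coefficients smooth on $U$, graded by $\deg u^i_{(s)}=s$. Let $$P^{(1)}_0=\begin{pmatrix} d_x&0\\0&0\end{pmatrix}.$$ A deformation of order $k$ of $P_0^{(1)}$ is a formal series $P_\epsilon=P^{(1)}_0+\epsilon P_1+\epsilon^2P_2+\cdots$ of skew-symmetric operators $P_m=\sum_{s=0}^{m+1}A_{m,s}\,d_x^{m+1-s}$, $\deg A_{m,s}=s$, with Schouten bracket $[P_\epsilon,P_\epsilon]=O(\epsilon^{k+1})$. An infinitesimal Miura transformation is a Lie series $P_\epsilon\mapsto P_\epsilon+\mathrm{Lie}_\Xi P_\epsilon+\frac12\mathrm{Lie}_\Xi^2P_\epsilon+\cdots$ along a formal evolutionary vector field $\Xi=\sum_{m\ge1}\epsilon^m\Xi_m$ with $\Xi_m$ homogeneous of degree $m$. In what follows, functions of $u^2$ are smooth and $'$ is the derivative with respect to $u^2$.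 (1) Every first-order deformation of $P^{(1)}_0$ can be reduced by an infinitesimal Miura transformation to $P^{(1)}_0+\epsilon P_1+O(\epsilon^2)$ with $$P_1=\begin{pmatrix}0&-p\,u^2_{xx}-q\,(u^2_x)^2\\ p\,u^2_{xx}+q\,(u^2_x)^2& r\,u^2_x\,d_x+\tfrac12(r\,u^2_x)_x\end{pmatrix},$$ where $p,q,r$ are functions of $u^2$; and for arbitrary functions $p,q,r$ of $u^2$ this is a first-order deformation. (2) Every second-order deformation of $P^{(1)}_0$ can be reduced by an infinitesimal Miura transformation to $P^{(1)}_0+\epsilon P_1+\epsilon^2P_2+O(\epsilon^3)$ with $$P_1=\begin{pmatrix}0&-p\,u^2_{xx}-q\,(u^2_x)^2\\ p\,u^2_{xx}+q\,(u^2_x)^2&0\end{pmatrix},\qquad P_2=\begin{pmatrix}0&\eta^{12}\\-\eta^{12}& e\,d_x^3+\tfrac32e'u^2_x\,d_x^2+\gamma^{22}\,d_x+\eta^{22}\end{pmatrix},$$ $$\gamma^{22}=g\,u^2_{xx}+h\,(u^2_x)^2,\qquad \eta^{22}=\tfrac12\big(g\,u^2_{xx}+h\,(u^2_x)^2\big)_x-\tfrac14(e'u^2_x)_{xx},$$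 $$\eta^{12}=(2p^2u^1-l)\,u^2_{xxx}+pq\,u^1_x(u^2_x)^2+p^2u^1_xu^2_{xx}+\big(2u^1(pq'+q^2)-n\big)(u^2_x)^3+\big(2pu^1(3q+p')-m\big)u^2_xu^2_{xx},$$ where $p,q,e,g,h,l,m,n$ are functions of $u^2$; and for arbitrary functions $p,q,e,g,h,l,m,n$ of $u^2$ this is a second-order deformation. Furthermore, by an infinitesimal Miura transformation which preserves this form and the functions $p,q,e,g,h,l$, one of the functions $m$, $n$ can be reduced to zero: if $p$ has no zeros on $U$, then $m$ can be reduced to zero, and alternatively $n$ can be reduced to zero (in each case the other function may change); if $p$ vanishes identically and $q$ has no zeros on $U$, then $n$ can be reduced to zero. -/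

import Mathlib

open scoped ContDiff
open TopologicalSpace

noncomputable section

namespace HydroDeform

/-! Smooth functions of the field variables. -/

open Classical in
/-- Extension by zero of a function on the open set `U`. -/
def extendZero {n : ℕ} (U : Opens (Fin n → ℝ)) (f : U → ℝ) : (Fin n → ℝ) → ℝ :=
  fun x => if h : x ∈ U then f ⟨x, h⟩ else 0

theorem extendZero_of_mem {n : ℕ} (U : Opens (Fin n → ℝ)) (f : U → ℝ) {x : Fin n → ℝ}
    (h : x ∈ U) : extendZero U f x = f ⟨x, h⟩ := by
  simp [extendZero, h]

/-- The algebra of smooth (`C^∞`) real functions on the open set `U` of `ℝⁿ`. -/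
def smoothSubalgebra {n : ℕ} (U : Opens (Fin n → ℝ)) : Subalgebra ℝ (U → ℝ) where
  carrier := {f | ContDiffOn ℝ ∞ (extendZero U f) U}
  mul_mem' := by
    intro f g hf hg
    refine (ContDiffOn.mul hf hg).congr ?_
    intro x hx
    have hx' : x ∈ U := hx
    simp [extendZero_of_mem U _ hx']
  add_mem' := by
    intro f g hf hg
    refine (ContDiffOn.add hf hg).congr ?_
    intro x hx
    have hx' : x ∈ U := hx
    simp [extendZero_of_mem U _ hx']
  algebraMap_mem' := by
    intro c
    refine (contDiffOn_const (c := c)).congr ?_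
    intro x hx
    have hx' : x ∈ U := hx
    simp [extendZero_of_mem U _ hx']

/-- The smooth real functions on `U`. -/
def SmoothFn {n : ℕ} (U : Opens (Fin n → ℝ)) : Type := smoothSubalgebra U

instance {n : ℕ} (U : Opens (Fin n → ℝ)) : CommRing (SmoothFn U) :=
  inferInstanceAs (CommRing (smoothSubalgebra U))

instance {n : ℕ} (U : Opens (Fin n → ℝ)) : Algebra ℝ (SmoothFn U) :=
  inferInstanceAs (Algebra ℝ (smoothSubalgebra U))

@[simp]
theorem SmoothFn.val_add {n : ℕ} {U : Opens (Fin n → ℝ)} (f g : SmoothFn U) :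
    (f + g).1 = f.1 + g.1 := rfl

@[simp]
theorem SmoothFn.val_mul {n : ℕ} {U : Opens (Fin n → ℝ)} (f g : SmoothFn U) :
    (f * g).1 = f.1 * g.1 := rfl

@[simp]
theorem SmoothFn.val_smul {n : ℕ} {U : Opens (Fin n → ℝ)} (c : ℝ) (f : SmoothFn U) :
    (c • f).1 = c • f.1 := rfl

theorem SmoothFn.contDiffOn {n : ℕ} {U : Opens (Fin n → ℝ)} (f : SmoothFn U) :
    ContDiffOn ℝ ∞ (extendZero U f.1) U := f.2

theorem SmoothFn.differentiableAt {n : ℕ} {U : Opens (Fin n → ℝ)} (f : SmoothFn U)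
    {x : Fin n → ℝ} (hx : x ∈ U) : DifferentiableAt ℝ (extendZero U f.1) x :=
  (f.contDiffOn.contDiffAt (U.isOpen.mem_nhds hx)).differentiableAt (by simp)

/-- The partial derivative `∂ f / ∂ u^k` of a smooth function on `U`. -/
def partialFun {n : ℕ} {U : Opens (Fin n → ℝ)} (k : Fin n) (f : SmoothFn U) : SmoothFn U :=
  ⟨fun x => fderiv ℝ (extendZero U f.1) x.1 (Pi.single k 1), by
    have h : ContDiffOn ℝ ∞ (fun x => fderiv ℝ (extendZero U f.1) x (Pi.single k 1)) U :=
      (f.contDiffOn.fderiv_of_isOpen U.isOpen (by simp)).clm_apply contDiffOn_const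
    refine h.congr ?_
    intro x hx
    have hx' : x ∈ U := hx
    simp [extendZero_of_mem U _ hx']⟩

theorem extendZero_eventuallyEq {n : ℕ} {U : Opens (Fin n → ℝ)} (f : U → ℝ)
    (g : (Fin n → ℝ) → ℝ) (h : ∀ x : U, f x = g x) {x : Fin n → ℝ} (hx : x ∈ U) :
    extendZero U f =ᶠ[nhds x] g := by
  filter_upwards [U.isOpen.mem_nhds hx] with y hy
  have hy' : y ∈ U := hy
  rw [extendZero_of_mem U f hy']
  exact h ⟨y, hy'⟩

/-- The partial derivative `∂ / ∂ u^k` as a derivation of the algebra of smooth functions. -/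
def partialD {n : ℕ} {U : Opens (Fin n → ℝ)} (k : Fin n) :
    Derivation ℝ (SmoothFn U) (SmoothFn U) :=
  Derivation.mk'
    { toFun := partialFun k
      map_add' := by
        intro f g
        refine Subtype.ext (funext fun x => ?_)
        have e := (extendZero_eventuallyEq (f + g).1
          (extendZero U f.1 + extendZero U g.1)
          (fun y => by simp [extendZero_of_mem U _ y.2]) x.2).fderiv_eq (𝕜 := ℝ)
        have e2 := fderiv_add (f.differentiableAt x.2) (g.differentiableAt x.2)
        simp only [partialFun]
        rw [e, e2]
        rfl
      map_smul' := by
        intro c f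
        refine Subtype.ext (funext fun x => ?_)
        have e := (extendZero_eventuallyEq (c • f).1 (c • extendZero U f.1)
          (fun y => by simp [extendZero_of_mem U _ y.2]) x.2).fderiv_eq (𝕜 := ℝ)
        have e2 := fderiv_const_smul (f.differentiableAt x.2) c
        simp only [partialFun]
        rw [e, e2]
        rfl }
    (by
      intro f g
      refine Subtype.ext (funext fun x => ?_)
      have e := (extendZero_eventuallyEq (f * g).1
        (extendZero U f.1 * extendZero U g.1)
        (fun y => by simp [extendZero_of_mem U _ y.2]) x.2).fderiv_eq (𝕜 := ℝ)
      have e2 := fderiv_mul (f.differentiableAt x.2) (g.differentiableAt x.2)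
      change fderiv ℝ (extendZero U (f * g).1) x.1 (Pi.single k 1)
        = f.1 x * fderiv ℝ (extendZero U g.1) x.1 (Pi.single k 1)
          + g.1 x * fderiv ℝ (extendZero U f.1) x.1 (Pi.single k 1)
      rw [e, e2]
      simp [extendZero_of_mem U _ x.2])

/-- The coordinate function `u^k` on `U`. -/
def coord {n : ℕ} (U : Opens (Fin n → ℝ)) (k : Fin n) : SmoothFn U :=
  ⟨fun x => x.1 k, by
    refine (contDiff_apply ℝ ℝ k).contDiffOn.congr ?_
    intro x hx
    have hx' : x ∈ U := hx
    simp [extendZero_of_mem U _ hx']⟩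

/-! Differential polynomials. -/

/-- Differential polynomials: polynomials in the jet variables `u^k_{(s)}`, `s ≥ 1`, whose
coefficients are smooth functions of `u`. The polynomial variable `(k, s)` stands for the jet
variable `u^k_{(s+1)}`. -/
abbrev DiffPoly {n : ℕ} (U : Opens (Fin n → ℝ)) : Type :=
  MvPolynomial (Fin n × ℕ) (SmoothFn U)

/-- A smooth function of `u`, seen as a differential polynomial. -/
def func {n : ℕ} {U : Opens (Fin n → ℝ)} (f : SmoothFn U) : DiffPoly U := MvPolynomial.C f

/-- The jet variable `u^k_{(s)}`, `s ≥ 0` (with `u^k_{(0)} = u^k`). -/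
def jet {n : ℕ} (U : Opens (Fin n → ℝ)) (k : Fin n) : ℕ → DiffPoly U
  | 0 => func (coord U k)
  | s + 1 => MvPolynomial.X (k, s)

/-- `∂ / ∂ u^k_{(s)}` on differential polynomials; for `s = 0` it differentiates the
coefficients. -/
def jetPartial {n : ℕ} {U : Opens (Fin n → ℝ)} (k : Fin n) : ℕ → DiffPoly U → DiffPoly U
  | 0, f => ∑ m ∈ f.support, MvPolynomial.monomial m (partialD k (f.coeff m))
  | s + 1, f => MvPolynomial.pderiv (k, s) f

/-- The total `x`-derivative `∂_x = ∑_{k, s} u^k_{(s+1)} ∂ / ∂ u^k_{(s)}`; the second summand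
collects the terms with `s ≥ 1`. -/
def totalD {n : ℕ} {U : Opens (Fin n → ℝ)} (f : DiffPoly U) : DiffPoly U :=
  ∑ k : Fin n, jet U k 1 * jetPartial k 0 f +
    MvPolynomial.mkDerivation (SmoothFn U)
      (fun v : Fin n × ℕ => (jet U v.1 (v.2 + 2) : DiffPoly U)) f

/-- `f` is homogeneous of degree `d` in the `x`-derivatives: `deg u^k_{(s)} = s`. -/
def HasDegree {n : ℕ} {U : Opens (Fin n → ℝ)} (f : DiffPoly U) (d : ℕ) : Prop :=
  MvPolynomial.IsWeightedHomogeneous (fun v : Fin n × ℕ => v.2 + 1) f d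

/-! Scalar differential operators `∑_m a_m d_x^m`, stored as polynomials `∑_m a_m λ^m`.
Equivalently `λ^m` stands for `δ^{(m)}(x - y)`. -/

/-- Scalar differential operators with differential polynomial coefficients. -/
abbrev DiffOp {n : ℕ} (U : Opens (Fin n → ℝ)) : Type := Polynomial (DiffPoly U)

/-- A differential polynomial as an operator of order zero. -/
def opFun {n : ℕ} {U : Opens (Fin n → ℝ)} (f : DiffPoly U) : DiffOp U := Polynomial.C f

/-- The operator `d_x`. -/
def dx {n : ℕ} {U : Opens (Fin n → ℝ)} : DiffOp U := Polynomial.X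

/-- The composition `d_x ∘ B`, i.e. `∑_m (∂_x b_m) d_x^m + b_m d_x^{m+1}`. -/
def dxComp {n : ℕ} {U : Opens (Fin n → ℝ)} (B : DiffOp U) : DiffOp U :=
  (B.sum fun m b => Polynomial.monomial m (totalD b)) + Polynomial.X * B

/-- The composition `A ∘ B` of operators. -/
def opComp {n : ℕ} {U : Opens (Fin n → ℝ)} (A B : DiffOp U) : DiffOp U :=
  A.sum fun m a => opFun a * dxComp^[m] B

/-- The formal adjoint `A^* = ∑_m (- d_x)^m ∘ a_m`. -/
def opAdj {n : ℕ} {U : Opens (Fin n → ℝ)} (A : DiffOp U) : DiffOp U :=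
  A.sum fun m a => (fun B => -dxComp B)^[m] (opFun a)

/-- The action `A f = ∑_m a_m ∂_x^m f` of an operator. -/
def opApply {n : ℕ} {U : Opens (Fin n → ℝ)} (A : DiffOp U) (f : DiffPoly U) : DiffPoly U :=
  A.sum fun m a => a * totalD^[m] f

/-- The linearization `∑_s (∂ f / ∂ u^k_{(s)}) d_x^s` of `f` in the direction of `u^k`. -/
def lin {n : ℕ} {U : Opens (Fin n → ℝ)} (f : DiffPoly U) (k : Fin n) : DiffOp U :=
  ∑ᶠ s : ℕ, Polynomial.monomial s (jetPartial k s f)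

/-- The sum in `lin` is finite. -/
theorem lin_support_finite {n : ℕ} {U : Opens (Fin n → ℝ)} (f : DiffPoly U) (k : Fin n) :
    (Function.support fun s : ℕ =>
      (Polynomial.monomial s (jetPartial k s f) : DiffOp U)).Finite := by
  refine ((f.vars.image (fun v => v.2 + 1)) ∪ {0}).finite_toSet.subset ?_
  intro s hs
  rcases s with _ | s
  · simp
  · by_contra hcon
    apply hs
    have hv : (k, s) ∉ f.vars := by
      intro hv
      apply hcon
      simp only [Finset.coe_union, Finset.coe_image, Set.mem_union]
      exact Or.inl ⟨(k, s), hv, rfl⟩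
    simp [jetPartial, MvPolynomial.pderiv_eq_zero_of_notMem_vars hv]

/-! Bivectors, vector fields, Lie derivative, Schouten bracket. -/

/-- Local bivectors and, more generally, matrix operators `P^{ij} = ∑_m A^{ij}_m d_x^m`, or
`P^{ij}_{x,y} = ∑_m A^{ij}_m(x) δ^{(m)}(x - y)`. -/
abbrev MatOp {n : ℕ} (U : Opens (Fin n → ℝ)) : Type := Matrix (Fin n) (Fin n) (DiffOp U)

/-- `P^* = - P`. -/
def IsSkew {n : ℕ} {U : Opens (Fin n → ℝ)} (P : MatOp U) : Prop :=
  ∀ i j, opAdj (P j i) = -P i j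

/-- `P = ∑_{s=0}^{d} A_s d_x^{d-s}` with `deg A_s = s`. -/
def HasOpDegree {n : ℕ} {U : Opens (Fin n → ℝ)} (P : MatOp U) (d : ℕ) : Prop :=
  ∀ i j, (∀ m, d < m → (P i j).coeff m = 0) ∧
    ∀ s ≤ d, HasDegree ((P i j).coeff (d - s)) s

/-- Evolutionary vector fields `ξ`, given by their components `ξ^i`. -/
abbrev VField {n : ℕ} (U : Opens (Fin n → ℝ)) : Type := Fin n → DiffPoly U

/-- The action `∑_{k, s} (∂_x^s ξ^k) ∂ f / ∂ u^k_{(s)}` of a vector field on `f`. -/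
def evol {n : ℕ} {U : Opens (Fin n → ℝ)} (ξ : VField U) (f : DiffPoly U) : DiffPoly U :=
  ∑ k, opApply (lin f k) (ξ k)

/-- The Lie derivative of a bivector along a vector field,
`(Lie_ξ P)^{ij} = ∑_{k,s} (∂_x^s ξ^k(x) ∂ P^{ij}_{x,y} / ∂ u^k_{(s)}(x)
  - ∂ ξ^i(x) / ∂ u^k_{(s)}(x) ∂_x^s P^{kj}_{x,y} - ∂ ξ^j(y) / ∂ u^k_{(s)}(y) ∂_y^s P^{ik}_{x,y})`.
In operator form the last term is the composition of `P` with the adjoint of the linearization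
of `ξ`. -/
def lieD {n : ℕ} {U : Opens (Fin n → ℝ)} (ξ : VField U) (P : MatOp U) : MatOp U :=
  Matrix.of fun i j =>
    ((P i j).sum fun m a => Polynomial.monomial m (evol ξ a))
      - ∑ k, opComp (lin (ξ i) k) (P k j)
      - ∑ k, opComp (P i k) (opAdj (lin (ξ j) k))

/-- Distributions `∑_{a,b} c_{ab}(x) δ^{(a)}(x - y) δ^{(b)}(x - z)`, stored as polynomials
`∑_{a,b} c_{ab} λ^a μ^b` where `λ` is the variable `0` and `μ` is the variable `1`. -/
abbrev TriSymbol {n : ℕ} (U : Opens (Fin n → ℝ)) : Type := MvPolynomial (Fin 2) (DiffPoly U)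

/-- The derivative with respect to `x` of a distribution
`∑_{a,b} c_{ab}(x) δ^{(a)}(x - y) δ^{(b)}(x - z)`: it acts as `∂_x + λ + μ`. -/
def triDx {n : ℕ} {U : Opens (Fin n → ℝ)} (T : TriSymbol U) : TriSymbol U :=
  (∑ m ∈ T.support, MvPolynomial.monomial m (totalD (T.coeff m)))
    + (MvPolynomial.X 0 + MvPolynomial.X 1) * T

/-- The distribution `∑_{l,s} ∂ P^{ij}_{x,y} / ∂ u^l_{(s)}(x) ∂_x^s Q^{lk}_{x,z}`. -/
def halfBracket {n : ℕ} {U : Opens (Fin n → ℝ)} (P Q : MatOp U) (i j k : Fin n) :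
    TriSymbol U :=
  (P i j).sum fun m a => MvPolynomial.X 0 ^ m *
    ∑ l, Polynomial.aeval (MvPolynomial.X 1 : TriSymbol U) (opComp (lin a l) (Q l k))

/-- Rewrites `∑_{a,b} c_{ab}(z) δ^{(a)}(z - x) δ^{(b)}(z - y)` in the form
`∑_{a,b} c'_{ab}(x) δ^{(a)}(x - y) δ^{(b)}(x - z)`. Paired with test functions
`h(x), f(y), g(z)`, the former is `∫ g c_{ab} (∂^a h) (∂^b f)`, which becomes
`∫ h (-∂)^a (c_{ab} (∂^b f) g)`. -/
def rebaseZXY {n : ℕ} {U : Opens (Fin n → ℝ)} (T : TriSymbol U) : TriSymbol U :=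
  ∑ m ∈ T.support, (fun B => -triDx B)^[m 0]
    (MvPolynomial.C (T.coeff m) * MvPolynomial.X 0 ^ m 1)

/-- Rewrites `∑_{a,b} c_{ab}(y) δ^{(a)}(y - z) δ^{(b)}(y - x)` in the form
`∑_{a,b} c'_{ab}(x) δ^{(a)}(x - y) δ^{(b)}(x - z)`. -/
def rebaseYZX {n : ℕ} {U : Opens (Fin n → ℝ)} (T : TriSymbol U) : TriSymbol U :=
  ∑ m ∈ T.support, (fun B => -triDx B)^[m 1]
    (MvPolynomial.C (T.coeff m) * MvPolynomial.X 1 ^ m 0)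

/-- The Schouten bracket `[P, Q]^{ijk}_{x,y,z}` of two bivectors. As the coefficients of
`P^{ij}_{x,y}` are taken at its first point, only derivatives at that point occur. -/
def schouten {n : ℕ} {U : Opens (Fin n → ℝ)} (P Q : MatOp U) (i j k : Fin n) : TriSymbol U :=
  (halfBracket P Q i j k + halfBracket Q P i j k)
    + rebaseZXY (halfBracket P Q k i j + halfBracket Q P k i j)
    + rebaseYZX (halfBracket P Q j k i + halfBracket Q P j k i)

/-! Deformations and infinitesimal Miura transformations. A sequence `P : ℕ → MatOp U` stands
for the formal series `∑_m ε^m P_m`. -/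

/-- `P` is a homogeneous deformation of order `k` of `P₀`: the bivector `P_m` has degree `m + 1`
and `[P_ε, P_ε] = O(ε^{k+1})`. -/
structure IsDeformation {n : ℕ} {U : Opens (Fin n → ℝ)} (k : ℕ) (P₀ : MatOp U)
    (P : ℕ → MatOp U) : Prop where
  zero : P 0 = P₀
  skew : ∀ m, IsSkew (P m)
  degree : ∀ m, HasOpDegree (P m) (m + 1)
  jacobi : ∀ m ≤ k, ∀ i j l,
    ∑ ab ∈ Finset.HasAntidiagonal.antidiagonal m, schouten (P ab.1) (P ab.2) i j l = 0

/-- A formal vector field `Ξ = ∑_{m ≥ 1} ε^m Ξ_m` with `Ξ_m` of degree `m`, the generator of an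
infinitesimal Miura transformation. -/
structure IsMiuraGenerator {n : ℕ} {U : Opens (Fin n → ℝ)} (Ξ : ℕ → VField U) : Prop where
  zero : Ξ 0 = 0
  degree : ∀ m i, HasDegree (Ξ m i) m

/-- The Lie derivative `Lie_Ξ P` of formal series. -/
def lieSeries {n : ℕ} {U : Opens (Fin n → ℝ)} (Ξ : ℕ → VField U) (P : ℕ → MatOp U) :
    ℕ → MatOp U :=
  fun m => ∑ ab ∈ Finset.HasAntidiagonal.antidiagonal m, lieD (Ξ ab.1) (P ab.2)

/-- The Lie series `P + Lie_Ξ P + (1/2) Lie_Ξ² P + ⋯`. When `Ξ_0 = 0`, only the terms `Lie_Ξ^j P`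
with `j ≤ m` contribute to the coefficient of `ε^m`. -/
def miura {n : ℕ} {U : Opens (Fin n → ℝ)} (Ξ : ℕ → VField U) (P : ℕ → MatOp U) :
    ℕ → MatOp U :=
  fun m => ∑ j ∈ Finset.range (m + 1), ((j.factorial : ℝ)⁻¹) • ((lieSeries Ξ)^[j] P) m

/-- `P` can be brought to `Q + O(ε^{k+1})` by an infinitesimal Miura transformation. -/
def ReducesTo {n : ℕ} {U : Opens (Fin n → ℝ)} (k : ℕ) (P Q : ℕ → MatOp U) : Prop :=
  ∃ Ξ : ℕ → VField U, IsMiuraGenerator Ξ ∧ ∀ m ≤ k, miura Ξ P m = Q m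

/-- The series `P₀ + ε P₁ + ε² P₂`. -/
def series {n : ℕ} {U : Opens (Fin n → ℝ)} (P₀ P₁ P₂ : MatOp U) : ℕ → MatOp U
  | 0 => P₀
  | 1 => P₁
  | 2 => P₂
  | _ => 0

/-! The two-component structure `P₀^{(1)}` and the normal forms. The component `u^1` has index
`0` and the component `u^2` has index `1`. -/

/-- The smooth function `f` on `U` is a function of `u^2` only. -/
def FnOfU2 {U : Opens (Fin 2 → ℝ)} (f : SmoothFn U) : Prop :=
  ∀ x y : U, x.1 1 = y.1 1 → f.1 x = f.1 y

/-- The derivative with respect to `u^2`. -/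
def prime {U : Opens (Fin 2 → ℝ)} (f : SmoothFn U) : SmoothFn U := partialD 1 f

/-- The Poisson structure with the single nonzero entry `d_x` in position `(1,1)`. -/
def P01 (U : Opens (Fin 2 → ℝ)) : MatOp U := !![dx, 0; 0, 0]

/-- The operator with rows `(0, -p u²_xx - q (u²_x)²)` and
`(p u²_xx + q (u²_x)², r u²_x d_x + (1/2) (r u²_x)_x)`. -/
def normalForm1 {U : Opens (Fin 2 → ℝ)} (p q r : SmoothFn U) : MatOp U :=
  !![0, opFun (-(func p * jet U 1 2) - func q * jet U 1 1 ^ 2);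
    opFun (func p * jet U 1 2 + func q * jet U 1 1 ^ 2),
    opFun (func r * jet U 1 1) * dx + opFun ((1 / 2 : ℝ) • totalD (func r * jet U 1 1))]

/-- The entry `η^{12}` of the second-order normal form. -/
def eta12 {U : Opens (Fin 2 → ℝ)} (p q l m n : SmoothFn U) : DiffPoly U :=
  func (2 * p ^ 2 * coord U 0 - l) * jet U 1 3
    + func (p * q) * jet U 0 1 * jet U 1 1 ^ 2
    + func (p ^ 2) * jet U 0 1 * jet U 1 2
    + func (2 * coord U 0 * (p * prime q + q ^ 2) - n) * jet U 1 1 ^ 3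
    + func (2 * p * coord U 0 * (3 * q + prime p) - m) * jet U 1 1 * jet U 1 2

/-- The coefficient `γ^{22} = g u²_xx + h (u²_x)²` of the second-order normal form. -/
def gamma22 {U : Opens (Fin 2 → ℝ)} (g h : SmoothFn U) : DiffPoly U :=
  func g * jet U 1 2 + func h * jet U 1 1 ^ 2

/-- The entry `η^{22} = (1/2) (g u²_xx + h (u²_x)²)_x - (1/4) (e' u²_x)_xx` of the second-order
normal form. -/
def eta22 {U : Opens (Fin 2 → ℝ)} (e g h : SmoothFn U) : DiffPoly U :=
  (1 / 2 : ℝ) • totalD (gamma22 g h)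
    - (1 / 4 : ℝ) • totalD (totalD (func (prime e) * jet U 1 1))

/-- The second-order coefficient of the second-order normal form. -/
def normalForm2 {U : Opens (Fin 2 → ℝ)} (p q e g h l m n : SmoothFn U) : MatOp U :=
  !![0, opFun (eta12 p q l m n);
    -opFun (eta12 p q l m n),
    opFun (func e) * dx ^ 3
      + opFun ((3 / 2 : ℝ) • (func (prime e) * jet U 1 1)) * dx ^ 2
      + opFun (gamma22 g h) * dx
      + opFun (eta22 e g h)]

end HydroDeform

end

/-!
Write `P₀ = P01 U` for the undeformed structure. Expanding `[P_ε, P_ε] = 0` in `ε`, every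
order asks for the bivectors `Q` with `[P₀, Q] = 0` modulo the trivial ones `Lie_ξ P₀`, and for the
obstruction `[P₁, P₁]` to be exact. Everything rests on two groups of facts.

**The Schouten calculus.** A trilinear density `c (∂^a h) (∂^b f) (∂^d g)` in three test functions is
written as a monomial in three frequencies (`FreqRing`), so that the total derivative becomes
`∂ + z` (`dFreq`) and evolutionary derivations become derivations (`evR`). Integration by parts
removes the first frequency (`elim`), and the bracket is the class of a cyclic sum of half brackets
modulo total derivatives (`schouten_eq`). The half brackets transform under a vector field by
commuting second derivatives and integrating by parts, which gives the Leibniz rule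
`[Lie_ξ P, Q] + [P, Lie_ξ Q] = Lie_ξ [P, Q]` in the form needed here: the left side vanishes if
`[P, Q] = 0` (`schouten_lieD_add`). The Lie derivative also preserves skewness and adds degrees.

**The cohomology of `P₀` in low degree.** For `P₀` only the derivatives with respect to `u^1` enter.
Closedness of a skew `Q` says: the entry `Q 1 1` does not depend on `u^1` (`indepU1_of_closed`), the
coefficients of `Q 1 0` satisfy a symmetry and the free term does not depend on `u^1`
(`coeff_symm_of_closed`), and if `L` is the linearization in `u^1` of the free term of `Q 0 0`, then
`L ∘ d_x` is self-adjoint (`opAdj_lin_of_closed`). The homogeneous differential polynomials of degree at most three are listed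
explicitly. Integrating in `u^1` on the box (`IsBox.exists_partialD_eq`) yields a vector field
that removes `Q 0 0` and all of `Q 1 0` except its free term; this gives the two normal forms
`exists_normalForm1` and `exists_normalForm2`.

The reduction to first order is then `exists_normalForm1`. At second order, the Leibniz rule shows
that the transformed series satisfies `[N₁, N₁] + 2 [P₀, R] = 0`, with `N₁` the first normal form
(`schouten_lieD_two`). Brackets with `P₀` have no component with all indices equal to `1`, and this
component of `[N₁, N₁]` vanishes only if `r^2 u²_x = 0`, so `r = 0`
(`eq_zero_of_schouten_normalForm1`). For `r = 0` the entry `η^{12}` is built so that its derivative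
in the direction of `u^1` cancels the quadratic term (`opComp_lin_eta21`, `schouten_normalForm2`).
Hence the difference of `R` and the explicit solution is closed, and `exists_normalForm2` applies
to it. The same computation shows that all the normal forms are deformations.

Finally, for a function `φ` of `u^2` the transformation with `Ξ₁ = φ u²_x ∂/∂u²` and
`Ξ₂ = -u¹ φ (p u²_xx + q (u²_x)²) ∂/∂u²` changes `(m, n)` into `(m + 2 p φ', n + p φ'' + q φ')` and
nothing else (`reducesTo_shift`); choosing `φ` by solving a linear differential equation in `u^2`
removes `m` or `n`.
-/

open scoped ContDiff
open TopologicalSpace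

noncomputable section

set_option linter.unusedSectionVars false

namespace HydroDeform

/-! ### Derivations of polynomial algebras over the smooth functions -/

section PolynomialDerivations

/-- The additive map on a polynomial ring that is given by `b m` on the multiples of the monomial
with exponent `m`. -/
def monomialSum {τ S M : Type*} [CommSemiring S] [AddCommMonoid M] (b : (τ →₀ ℕ) → S →+ M) :
    MvPolynomial τ S →+ M where
  toFun f := ∑ m ∈ f.support, b m (f.coeff m)
  map_zero' := by simp
  map_add' := by
    intro f g
    rw [← MvPolynomial.sum_def (b := fun m c => b m c), ← MvPolynomial.sum_def (b := fun m c => b m c),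
      ← MvPolynomial.sum_def (b := fun m c => b m c)]
    exact Finsupp.sum_add_index' (by simp) (by simp)

theorem monomialSum_monomial {τ S M : Type*} [CommSemiring S] [AddCommMonoid M]
    (b : (τ →₀ ℕ) → S →+ M) (m : τ →₀ ℕ) (c : S) :
    monomialSum b (MvPolynomial.monomial m c) = b m c := by
  change ∑ m' ∈ _, b m' _ = _
  rw [← MvPolynomial.sum_def (b := fun m c => b m c)]
  exact MvPolynomial.sum_monomial_eq (by simp)

variable {τ S B : Type*} [CommRing S] [Algebra ℝ S] [CommRing B] [Algebra S B]
  [Algebra (MvPolynomial τ S) B] [Algebra ℝ B]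

theorem derivation_ext [IsScalarTower S (MvPolynomial τ S) B] 
    {d₁ d₂ : Derivation ℝ (MvPolynomial τ S) B}
    (hC : ∀ c, d₁ (MvPolynomial.C c) = d₂ (MvPolynomial.C c))
    (hX : ∀ i, d₁ (MvPolynomial.X i) = d₂ (MvPolynomial.X i)) : d₁ = d₂ := by
  ext f
  induction f using MvPolynomial.induction_on with
  | C c => exact hC c
  | add f g hf hg => simp [hf, hg]
  | mul_X f i hf => simp [hf, hX]

variable [IsScalarTower S (MvPolynomial τ S) B] [IsScalarTower ℝ S B]

/-- The extension of a derivation of the coefficients to a derivation of the polynomial ring that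
kills the polynomial variables. -/
def coeffExt (d : Derivation ℝ S B) : Derivation ℝ (MvPolynomial τ S) B :=
  Derivation.mk'
    { toFun := monomialSum fun m =>
        (DistribSMul.toAddMonoidHom B (MvPolynomial.monomial m (1 : S))).comp
          (d : S →ₗ[ℝ] B).toAddMonoidHom
      map_add' := map_add _
      map_smul' := by
        intro c f
        induction f using MvPolynomial.induction_on' with
        | add f g hf hg => rw [smul_add, map_add, hf, hg, map_add, smul_add]
        | monomial m a =>
          rw [MvPolynomial.smul_monomial, monomialSum_monomial, monomialSum_monomial]
          simp only [AddMonoidHom.comp_apply, DistribSMul.toAddMonoidHom_apply,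
            LinearMap.toAddMonoidHom_coe, Derivation.coeFn_coe, Derivation.map_smul, RingHom.id_apply]
          simp only [Algebra.smul_def]
          ring }
    (by
      intro f g
      simp only [LinearMap.coe_mk, AddHom.coe_mk]
      induction f using MvPolynomial.induction_on' with
      | add f₁ f₂ h₁ h₂ => rw [add_mul, map_add, h₁, h₂, map_add, add_smul, smul_add]; abel
      | monomial m a =>
        induction g using MvPolynomial.induction_on' with
        | add f₁ f₂ h₁ h₂ => rw [mul_add, map_add, h₁, h₂, map_add, add_smul, smul_add]; abel
        | monomial m' b =>
          rw [MvPolynomial.monomial_mul, monomialSum_monomial, monomialSum_monomial,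
            monomialSum_monomial]
          have e : ∀ (m : τ →₀ ℕ) (x : S), MvPolynomial.monomial m x
              = x • (MvPolynomial.monomial m (1 : S)) := by
            intro m x; rw [MvPolynomial.smul_monomial]; simp
          have e2 : MvPolynomial.monomial (m + m') (1 : S)
              = MvPolynomial.monomial m (1 : S) * MvPolynomial.monomial m' (1 : S) := by
            simp [MvPolynomial.monomial_mul]
          simp only [AddMonoidHom.comp_apply, DistribSMul.toAddMonoidHom_apply,
            LinearMap.toAddMonoidHom_coe, Derivation.coeFn_coe, Derivation.leibniz]
          rw [e m a, e m' b, e2]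
          simp only [smul_add, smul_assoc, mul_smul]
          simp only [Algebra.smul_def]
          ring)

@[simp]
theorem coeffExt_C (d : Derivation ℝ S B) (c : S) :
    coeffExt (τ := τ) d (MvPolynomial.C c) = d c := by
  refine (monomialSum_monomial _ 0 c).trans ?_
  change (1 : MvPolynomial τ S) • d c = d c
  simp

@[simp]
theorem coeffExt_X (d : Derivation ℝ S B) (i : τ) :
    coeffExt d (MvPolynomial.X i : MvPolynomial τ S) = 0 := by
  refine (monomialSum_monomial _ _ 1).trans ?_
  simp

/-- The derivation of a polynomial ring with prescribed values on coefficients and variables. -/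
def polyDer (d : Derivation ℝ S B) (w : τ → B) :
    Derivation ℝ (MvPolynomial τ S) B :=
  coeffExt d + (MvPolynomial.mkDerivation S w).restrictScalars ℝ

@[simp]
theorem polyDer_C (d : Derivation ℝ S B) (w : τ → B) (c : S) :
    polyDer d w (MvPolynomial.C c) = d c := by
  simp [polyDer]

@[simp]
theorem polyDer_X (d : Derivation ℝ S B) (w : τ → B) (i : τ) :
    polyDer d w (MvPolynomial.X i) = w i := by
  simp [polyDer, MvPolynomial.mkDerivation_X]

end PolynomialDerivations

/-! ### Evolutionary derivations -/

section Evolution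

variable {n : ℕ} {U : Opens (Fin n → ℝ)} {B : Type*} [CommRing B] [Algebra (SmoothFn U) B]
  [Algebra (DiffPoly U) B] [Algebra ℝ B] [IsScalarTower (SmoothFn U) (DiffPoly U) B]
  [IsScalarTower ℝ (SmoothFn U) B]

/-- The derivation `∑ k, v k ∂ / ∂ u^k` of the smooth functions. -/
def fieldDer (v : Fin n → B) : Derivation ℝ (SmoothFn U) B :=
  Derivation.mk'
    { toFun := fun f => ∑ k, partialD k f • v k
      map_add' := by intro f g; simp [add_smul, Finset.sum_add_distrib]
      map_smul' := by intro c f; simp [Finset.smul_sum] }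
    (by
      intro f g
      simp only [LinearMap.coe_mk, AddHom.coe_mk, Derivation.leibniz, add_smul,
        Finset.sum_add_distrib, Finset.smul_sum, smul_smul, smul_eq_mul])

theorem fieldDer_apply (v : Fin n → B) (f : SmoothFn U) :
    fieldDer v f = ∑ k, partialD k f • v k := rfl

/-- The derivation `∑_{k, s} w k s ∂ / ∂ u^k_{(s)}` of the differential polynomials, with values in
any algebra over them. The total derivative, the partial derivatives, the action of evolutionary
vector fields and the linearization are all of this form. -/
def evo (w : Fin n → ℕ → B) : Derivation ℝ (DiffPoly U) B :=
  polyDer (fieldDer fun k => w k 0) fun v => w v.1 (v.2 + 1)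

theorem evo_C (w : Fin n → ℕ → B) (f : SmoothFn U) :
    evo w (MvPolynomial.C f) = ∑ k, partialD k f • w k 0 := by
  simp [evo, fieldDer_apply]

@[simp]
theorem evo_X (w : Fin n → ℕ → B) (v : Fin n × ℕ) :
    evo w (MvPolynomial.X v : DiffPoly U) = w v.1 (v.2 + 1) := by
  simp [evo]

theorem evo_eq {d : Derivation ℝ (DiffPoly U) B} {w : Fin n → ℕ → B}
    (hC : ∀ c, d (MvPolynomial.C c) = ∑ k, partialD k c • w k 0)
    (hX : ∀ v : Fin n × ℕ, d (MvPolynomial.X v) = w v.1 (v.2 + 1)) (f : DiffPoly U) : 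
    d f = evo w f := 
  DFunLike.congr_fun (derivation_ext (d₁ := d) (d₂ := evo w)
    (fun c => by rw [hC, evo_C]) (fun v => by rw [hX, evo_X])) f

theorem evo_add (w w' : Fin n → ℕ → B) (f : DiffPoly U) : evo (w + w') f = evo w f + evo w' f :=
  (evo_eq (d := evo w + evo w') (fun c => by simp [evo_C, Finset.sum_add_distrib]) (by simp) f).symm

theorem map_evo {B' : Type*} [CommRing B'] [Algebra (SmoothFn U) B']
    [Algebra (DiffPoly U) B'] [Algebra ℝ B'] [IsScalarTower (SmoothFn U) (DiffPoly U) B']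
    [IsScalarTower ℝ (SmoothFn U) B'] (φ : B →ₗ[DiffPoly U] B') (w : Fin n → ℕ → B)
    (f : DiffPoly U) : φ (evo w f) = evo (fun k s => φ (w k s)) f := by
  have hs : ∀ (c : SmoothFn U) (b : B), φ (c • b) = c • φ b := by
    intro c b
    rw [← algebraMap_smul (DiffPoly U) c b, map_smul, algebraMap_smul]
  induction f using MvPolynomial.induction_on with
  | C c => simp [evo_C, hs]
  | add f g hf hg => simp [hf, hg]
  | mul_X f i hf => simp [hf]

/-- Second partial derivatives of smooth functions commute. -/
theorem partialD_comm (k l : Fin n) (f : SmoothFn U) :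
    partialD k (partialD l f) = partialD l (partialD k f) := by
  have key : ∀ (k l : Fin n) (x : U), (partialD k (partialD l f)).1 x
      = fderiv ℝ (fderiv ℝ (extendZero U f.1)) x.1 (Pi.single k 1) (Pi.single l 1) := by
    intro k l x
    change fderiv ℝ (extendZero U (partialD l f).1) x.1 (Pi.single k 1) = _
    have e := (extendZero_eventuallyEq (partialD l f).1
      (fun y => fderiv ℝ (extendZero U f.1) y (Pi.single l 1)) (fun y => rfl) x.2).fderiv_eq (𝕜 := ℝ)
    have hd : DifferentiableAt ℝ (fderiv ℝ (extendZero U f.1)) x.1 :=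
      ((f.contDiffOn.fderiv_of_isOpen U.isOpen (m := ∞) (by simp)).contDiffAt
        (U.isOpen.mem_nhds x.2)).differentiableAt (by simp)
    rw [e, fderiv_clm_apply hd (by fun_prop)]
    simp
  refine Subtype.ext (funext fun x => ?_)
  rw [key, key]
  have hs : IsSymmSndFDerivAt ℝ (extendZero U f.1) x.1 :=
    (f.contDiffOn.contDiffAt (U.isOpen.mem_nhds x.2)).isSymmSndFDerivAt
      (by simpa using WithTop.coe_le_coe.2 (le_top : (2 : ℕ∞) ≤ ⊤))
  exact hs _ _

theorem algebraMap_func (B : Type*) [CommRing B] [Algebra (SmoothFn U) B]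
    [Algebra (DiffPoly U) B] [IsScalarTower (SmoothFn U) (DiffPoly U) B] (f : SmoothFn U) (b : B) :
    func f • b = f • b := algebraMap_smul (DiffPoly U) f b

/-- The total derivative as a derivation. -/
def totalDer : Derivation ℝ (DiffPoly U) (DiffPoly U) := evo fun k s => jet U k (s + 1)

/-- The partial derivative with respect to a jet variable as a derivation. -/
def jetDer (k : Fin n) (s : ℕ) : Derivation ℝ (DiffPoly U) (DiffPoly U) :=
  evo fun k' s' => if k' = k ∧ s' = s then 1 else 0

theorem jetDer_apply (k : Fin n) (s : ℕ) (f : DiffPoly U) : jetDer k s f = jetPartial k s f := by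
  cases s with
  | zero =>
    have h : coeffExt ((Algebra.linearMap (SmoothFn U) (DiffPoly U)).compDer (partialD k)) f
        = jetPartial k 0 f := by
      change monomialSum _ f = ∑ m ∈ f.support, _
      refine Finset.sum_congr rfl fun m _ => ?_
      simp [Algebra.linearMap_apply, MvPolynomial.algebraMap_eq, mul_comm, MvPolynomial.C_mul_monomial]
    rw [← h]
    refine (evo_eq ?_ ?_ f).symm
    · intro c
      simp [Algebra.smul_def, MvPolynomial.algebraMap_eq]
    · intro v; simp
  | succ s =>
    change _ = (MvPolynomial.pderiv (k, s)).restrictScalars ℝ f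
    refine (evo_eq ?_ ?_ f).symm
    · intro c; simp
    · intro v
      simp [MvPolynomial.pderiv_X, Pi.single_apply, Prod.ext_iff, and_comm, eq_comm]

theorem derivation_sum_apply {ι : Type*} (s : Finset ι)
    (d : ι → Derivation ℝ (DiffPoly U) (DiffPoly U)) (f : DiffPoly U) :
    (∑ i ∈ s, d i) f = ∑ i ∈ s, d i f := by
  induction s using Finset.cons_induction with
  | empty => simp
  | cons a s ha ih => simp [Finset.sum_cons, ih]

theorem totalDer_apply (f : DiffPoly U) : totalDer f = totalD f := by
  have h : totalD f = (∑ k : Fin n, (jet U k 1 : DiffPoly U) • jetDer k 0 +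
    (MvPolynomial.mkDerivation (SmoothFn U)
      (fun v : Fin n × ℕ => (jet U v.1 (v.2 + 2) : DiffPoly U))).restrictScalars ℝ :
        Derivation ℝ (DiffPoly U) (DiffPoly U)) f := by
    simp [totalD, jetDer_apply, derivation_sum_apply]
  rw [h]
  refine (evo_eq ?_ ?_ f).symm
  · intro c
    simp [jetDer, evo_C, derivation_sum_apply, Algebra.smul_def, MvPolynomial.algebraMap_eq, mul_comm]
  · intro v
    simp [jetDer, evo_X, derivation_sum_apply, MvPolynomial.mkDerivation_X]

theorem totalD_C (c : SmoothFn U) :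
    totalD (MvPolynomial.C c : DiffPoly U) = ∑ k, partialD k c • jet U k 1 := by
  rw [← totalDer_apply, totalDer, evo_C]

theorem totalD_X (v : Fin n × ℕ) :
    totalD (MvPolynomial.X v : DiffPoly U) = jet U v.1 (v.2 + 2) := by
  rw [← totalDer_apply, totalDer, evo_X]

theorem totalD_add (f g : DiffPoly U) : totalD (f + g) = totalD f + totalD g := by
  simp [← totalDer_apply]

theorem totalD_mul (f g : DiffPoly U) : totalD (f * g) = totalD f * g + f * totalD g := by
  simp [← totalDer_apply]; ring

/-- An evolutionary derivation intertwines the total derivative with any operator `δ` that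
satisfies the same Leibniz rule, provided that its jets are obtained by iterating `δ`. -/
theorem evo_totalD {w : Fin n → ℕ → B} (δ : B →+ B)
    (hδ : ∀ (a : DiffPoly U) b, δ (a • b) = totalD a • b + a • δ b)
    (hw : ∀ k s, w k (s + 1) = δ (w k s)) (f : DiffPoly U) :
    evo w (totalD f) = δ (evo w f) := by
  induction f using MvPolynomial.induction_on with
  | C c =>
    rw [totalD_C, evo_C, map_sum, map_sum]
    have h1 : ∀ k, evo w (partialD k c • jet U k 1)
        = partialD k c • w k 1 + ∑ l, (jet U k 1 : DiffPoly U) • (partialD l (partialD k c) • w l 0) := by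
      intro k
      have : (partialD k c • jet U k 1 : DiffPoly U)
          = MvPolynomial.C (partialD k c) * MvPolynomial.X (k, 0) := by
        rw [MvPolynomial.smul_eq_C_mul]; rfl
      rw [this, Derivation.leibniz, evo_X, evo_C, Finset.smul_sum]
      exact congrArg₂ _ (algebraMap_func B _ _) rfl
    have h2 : ∀ k, δ (partialD k c • w k 0)
        = partialD k c • w k 1 + ∑ l, (jet U l 1 : DiffPoly U) • (partialD l (partialD k c) • w k 0) := by
      intro k
      rw [← algebraMap_func B, hδ, algebraMap_func, ← hw, add_comm]
      congr 1
      change totalD (MvPolynomial.C _) • _ = _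
      rw [totalD_C, Finset.sum_smul]
      refine Finset.sum_congr rfl fun l _ => ?_
      rw [smul_comm, ← smul_assoc]
    rw [Finset.sum_congr rfl fun k _ => h1 k, Finset.sum_congr rfl fun k _ => h2 k,
      Finset.sum_add_distrib, Finset.sum_add_distrib]
    congr 1
    rw [Finset.sum_comm]
    exact Finset.sum_congr rfl fun k _ => Finset.sum_congr rfl fun l _ => by rw [partialD_comm]
  | add f g hf hg => simp [totalD_add, hf, hg]
  | mul_X f i hf =>
    rw [totalD_mul, map_add, Derivation.leibniz, Derivation.leibniz, Derivation.leibniz, hf,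
      totalD_X, map_add, hδ, hδ, totalD_X, evo_X, ← hw]
    have : evo w (jet U i.1 (i.2 + 2)) = w i.1 (i.2 + 1 + 1) := evo_X w (i.1, i.2 + 1)
    rw [this]
    abel

end Evolution

/-! ### Operators and their coefficient sequences -/

section Operators

variable {n : ℕ} {U : Opens (Fin n → ℝ)}

/-- The `DiffPoly`-linear map on operators that sends `d_x^m` to `b m`. -/
def seqMap {M : Type*} [AddCommGroup M] [Module (DiffPoly U) M] (b : ℕ → M) :
    DiffOp U →ₗ[DiffPoly U] M :=
  Polynomial.lsum fun m => LinearMap.toSpanSingleton (DiffPoly U) M (b m)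

theorem seqMap_apply {M : Type*} [AddCommGroup M] [Module (DiffPoly U) M] (b : ℕ → M)
    (P : DiffOp U) : seqMap b P = P.sum fun m a => a • b m := rfl

theorem seqMap_monomial {M : Type*} [AddCommGroup M] [Module (DiffPoly U) M] (b : ℕ → M)
    (m : ℕ) (a : DiffPoly U) : seqMap b (Polynomial.monomial m a) = a • b m := by
  rw [seqMap_apply]
  exact Polynomial.sum_monomial_index _ _ (by simp)

theorem map_seqMap {M M' : Type*} [AddCommGroup M] [Module (DiffPoly U) M] [AddCommGroup M']
    [Module (DiffPoly U) M'] (φ : M →ₗ[DiffPoly U] M') (b : ℕ → M) (P : DiffOp U) :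
    φ (seqMap b P) = seqMap (fun m => φ (b m)) P := by
  rw [seqMap_apply, seqMap_apply, Polynomial.sum, Polynomial.sum, map_sum]
  simp

theorem coeff_lin (f : DiffPoly U) (k : Fin n) (s : ℕ) :
    (lin f k).coeff s = jetPartial k s f := by
  rw [lin, finsum_eq_sum_of_support_subset (s := (lin_support_finite f k).toFinset) _ (by simp),
    Polynomial.finsetSum_coeff]
  simp only [Polynomial.coeff_monomial]
  rw [Finset.sum_ite_eq']
  split_ifs with h
  · rfl
  · simp only [Set.Finite.mem_toFinset, Function.mem_support, not_not] at h
    have := congrArg (fun P => Polynomial.coeff P s) h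
    simpa using this.symm

/-- The linearization is an evolutionary derivation with values in operators. -/
theorem lin_eq_evo (f : DiffPoly U) (k : Fin n) :
    lin f k = evo (B := DiffOp U) (fun k' s => if k' = k then Polynomial.X ^ s else 0) f := by
  ext1 s
  rw [coeff_lin, ← jetDer_apply]
  have h := map_evo (Polynomial.lcoeff (DiffPoly U) s)
    (fun k' s => if k' = k then Polynomial.X ^ s else 0) f
  rw [Polynomial.lcoeff_apply] at h
  rw [h, jetDer]
  congr 2
  ext k' s'
  by_cases h : k' = k <;> simp [h, Polynomial.coeff_X_pow, eq_comm]

theorem seqMap_lin {B : Type*} [CommRing B] [Algebra (SmoothFn U) B]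
    [Algebra (DiffPoly U) B] [Algebra ℝ B] [IsScalarTower (SmoothFn U) (DiffPoly U) B]
    [IsScalarTower ℝ (SmoothFn U) B] (b : ℕ → B) (f : DiffPoly U) (k : Fin n) :
    seqMap b (lin f k) = evo (fun k' s => if k' = k then b s else 0) f := by
  rw [lin_eq_evo, map_evo]
  congr 2
  ext k' s
  split_ifs
  · rw [← Polynomial.monomial_one_right_eq_X_pow, seqMap_monomial, one_smul]
  · simp

theorem evo_sum_single {B : Type*} [CommRing B] [Algebra (SmoothFn U) B]
    [Algebra (DiffPoly U) B] [Algebra ℝ B] [IsScalarTower (SmoothFn U) (DiffPoly U) B]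
    [IsScalarTower ℝ (SmoothFn U) B] (w : Fin n → ℕ → B) (f : DiffPoly U) :
    ∑ k, evo (fun k' s => if k' = k then w k s else 0) f = evo w f := by
  have h : ∀ S : Finset (Fin n), ∑ k ∈ S, evo (fun k' s => if k' = k then w k s else 0) f
      = evo (fun k' s => if k' ∈ S then w k' s else 0) f := by
    intro S
    induction S using Finset.cons_induction with
    | empty =>
      have := evo_add (0 : Fin n → ℕ → B) 0 f
      simp only [add_zero, left_eq_add] at this
      simp only [Finset.sum_empty, Finset.notMem_empty, if_false]
      exact this.symm
    | cons a S ha ih =>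
      rw [Finset.sum_cons, ih, ← evo_add]
      congr 2
      ext k s
      by_cases h : k = a <;> simp [h, ha]
  simpa using h Finset.univ

/-- Summing over all fields, the linearization acts as an evolutionary derivation. -/
theorem sum_seqMap_lin {B : Type*} [CommRing B] [Algebra (SmoothFn U) B]
    [Algebra (DiffPoly U) B] [Algebra ℝ B] [IsScalarTower (SmoothFn U) (DiffPoly U) B]
    [IsScalarTower ℝ (SmoothFn U) B] (w : Fin n → ℕ → B) (f : DiffPoly U) :
    ∑ k, seqMap (w k) (lin f k) = evo w f := by
  simp only [seqMap_lin, evo_sum_single]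

theorem evol_eq_evo (ξ : VField U) (f : DiffPoly U) :
    evol ξ f = evo (fun k s => totalD^[s] (ξ k)) f := by
  rw [← sum_seqMap_lin]; rfl

/-- The action of the total derivative on the coefficients of an operator. -/
def coeffTotalD : DiffOp U →+ DiffOp U where
  toFun P := P.sum fun m b => Polynomial.monomial m (totalD b)
  map_zero' := by simp
  map_add' P Q := Polynomial.sum_add_index P Q _ (by simp [← totalDer_apply])
    (by simp [← totalDer_apply])

/-- The composition with `d_x` as an additive map. -/
def dxCompHom : DiffOp U →+ DiffOp U :=
  coeffTotalD + AddMonoidHom.mulLeft Polynomial.X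

theorem dxCompHom_apply (P : DiffOp U) : dxCompHom P = dxComp P := rfl

theorem dxComp_add (P Q : DiffOp U) : dxComp (P + Q) = dxComp P + dxComp Q :=
  map_add dxCompHom P Q

theorem dxComp_monomial (m : ℕ) (a : DiffPoly U) : dxComp (Polynomial.monomial m a)
    = Polynomial.monomial m (totalD a) + Polynomial.monomial (m + 1) a := by
  rw [dxComp, Polynomial.sum_monomial_index a (fun m b => Polynomial.monomial m (totalD b))
    (by simp [← totalDer_apply])]
  simp [Polynomial.X_mul_monomial]

theorem dxComp_smul (a : DiffPoly U) (P : DiffOp U) :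
    dxComp (a • P) = totalD a • P + a • dxComp P := by
  induction P using Polynomial.induction_on' with
  | add P Q hP hQ => rw [smul_add, dxComp_add, hP, hQ, dxComp_add]; simp only [smul_add]; abel
  | monomial k b =>
    rw [Polynomial.smul_monomial, dxComp_monomial, dxComp_monomial]
    simp only [smul_add, Polynomial.smul_monomial, smul_eq_mul, totalD_mul, map_add]
    abel

theorem opComp_eq (P Q : DiffOp U) : opComp P Q = seqMap (fun m => dxComp^[m] Q) P := by
  rw [seqMap_apply, opComp]
  simp only [opFun, Polynomial.smul_eq_C_mul]

theorem opAdj_eq (P : DiffOp U) :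
    opAdj P = P.sum fun m a => (-dxCompHom : DiffOp U →+ DiffOp U)^[m] (opFun a) := rfl

/-- The formal adjoint as an additive map. -/
def opAdjHom : DiffOp U →+ DiffOp U where
  toFun := opAdj
  map_zero' := by simp [opAdj_eq]
  map_add' P Q := by
    rw [opAdj_eq, opAdj_eq, opAdj_eq]
    exact Polynomial.sum_add_index P Q _ (by simp [opFun, iterate_map_zero])
      (by simp [opFun, iterate_map_add])

theorem opAdj_add (P Q : DiffOp U) : opAdj (P + Q) = opAdj P + opAdj Q := map_add opAdjHom P Q

theorem opAdj_neg (P : DiffOp U) : opAdj (-P) = -opAdj P := map_neg opAdjHom P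

theorem opAdj_zero : opAdj (0 : DiffOp U) = 0 := map_zero opAdjHom

theorem opAdj_monomial (m : ℕ) (a : DiffPoly U) :
    opAdj (Polynomial.monomial m a) = (-dxCompHom : DiffOp U →+ DiffOp U)^[m] (opFun a) :=
  Polynomial.sum_monomial_index a (fun m a => (-dxCompHom : DiffOp U →+ DiffOp U)^[m] (opFun a))
    (by simp [opFun, iterate_map_zero])

end Operators

/-! ### Symbols of trilinear densities -/

section Symbols

variable {n : ℕ} {U : Opens (Fin n → ℝ)}

/-- Symbols of trilinear densities: `c x₀^a x₁^b x₂^d` stands for `c (∂^a h) (∂^b f) (∂^d g)`, where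
`h, f, g` are test functions. The total derivative of a density in which the test functions
with frequencies summing to `z` occur is `dFreq z`. -/
abbrev FreqRing (U : Opens (Fin n → ℝ)) : Type := MvPolynomial (Fin 3) (DiffPoly U)

/-- The frequency `x i` of a test function. -/
abbrev freq (U : Opens (Fin n → ℝ)) (i : Fin 3) : FreqRing U := MvPolynomial.X i

/-- The total derivative acting on the coefficients of a symbol. -/
def symD : Derivation ℝ (FreqRing U) (FreqRing U) :=
  coeffExt ((Algebra.linearMap (DiffPoly U) (FreqRing U)).compDer totalDer)

@[simp]
theorem symD_C (a : DiffPoly U) : symD (MvPolynomial.C a) = MvPolynomial.C (totalD a) := by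
  simp [symD, totalDer_apply, MvPolynomial.algebraMap_eq]

/-- Elements of the symbol ring that are killed by all derivations of the coefficients. -/
def IsFreq (z : FreqRing U) : Prop := ∀ d : Derivation ℝ (DiffPoly U) (FreqRing U), coeffExt d z = 0

theorem isFreq_X (i : Fin 3) : IsFreq (freq U i) := fun d => by simp

theorem isFreq_zero : IsFreq (0 : FreqRing U) := fun d => by simp

theorem IsFreq.add {z y : FreqRing U} (hz : IsFreq z) (hy : IsFreq y) : IsFreq (z + y) :=
  fun d => by simp [hz d, hy d]

theorem IsFreq.symD {z : FreqRing U} (hz : IsFreq z) : symD z = 0 := hz _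

/-- The total derivative `∂ + z` of a density whose test functions have total frequency `z`. -/
def dFreq (z : FreqRing U) : FreqRing U →+ FreqRing U :=
  (symD (U := U)).toLinearMap.toAddMonoidHom + AddMonoidHom.mulLeft z

theorem dFreq_apply (z b : FreqRing U) : dFreq z b = symD b + z * b := rfl

/-- The frequency of a product of densities is the sum of the frequencies. -/
theorem dFreq_mul (z y a b : FreqRing U) :
    dFreq (z + y) (a * b) = dFreq z a * b + a * dFreq y b := by
  simp only [dFreq_apply, Derivation.leibniz, smul_eq_mul]
  ring

theorem dFreq_smul (z : FreqRing U) (a : DiffPoly U) (b : FreqRing U) :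
    dFreq z (a • b) = totalD a • b + a • dFreq z b := by
  simp only [dFreq_apply, MvPolynomial.smul_eq_C_mul, Derivation.leibniz, smul_eq_mul, symD_C]
  ring

theorem dFreq_freq_mul (z : FreqRing U) {y : FreqRing U} (hy : IsFreq y) (b : FreqRing U) :
    dFreq z (y * b) = y * dFreq z b := by
  simp only [dFreq_apply, Derivation.leibniz, smul_eq_mul, hy.symD]
  ring

/-- The extension to symbols of the evolutionary derivation along the vector field `v`, whose
components are symbols of total frequency `z`. -/
def evR (z : FreqRing U) (v : Fin n → FreqRing U) : Derivation ℝ (FreqRing U) (FreqRing U) :=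
  coeffExt (evo fun k s => (dFreq z)^[s] (v k))

theorem evR_C (z : FreqRing U) (v : Fin n → FreqRing U) (a : DiffPoly U) :
    evR z v (MvPolynomial.C a) = evo (fun k s => (dFreq z)^[s] (v k)) a := by simp [evR]

theorem IsFreq.evR {y : FreqRing U} (hy : IsFreq y) (z : FreqRing U) (v : Fin n → FreqRing U) :
    evR z v y = 0 := hy _

@[simp]
theorem evR_X (z : FreqRing U) (v : Fin n → FreqRing U) (i : Fin 3) :
    evR z v (MvPolynomial.X i) = 0 := by simp [evR]

theorem evR_add (z : FreqRing U) (v v' : Fin n → FreqRing U) (b : FreqRing U) :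
    evR z (v + v') b = evR z v b + evR z v' b := by
  refine DFunLike.congr_fun (derivation_ext (d₁ := evR z (v + v')) (d₂ := evR z v + evR z v')
    (fun a => ?_) (fun i => by simp)) b
  rw [Derivation.add_apply, evR_C, evR_C, evR_C, ← evo_add]
  congr 2
  ext1 k
  ext1 s
  exact iterate_map_add _ _ _ _

theorem evR_neg (z : FreqRing U) (v : Fin n → FreqRing U) (b : FreqRing U) :
    evR z (-v) b = -evR z v b := by
  have h0 := evR_add z (0 : Fin n → FreqRing U) 0 b
  have h := evR_add z v (-v) b
  simp only [add_zero, left_eq_add] at h0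
  rw [add_neg_cancel, h0] at h
  exact (neg_eq_of_add_eq_zero_right h.symm).symm

theorem evR_zero (z b : FreqRing U) : evR z (0 : Fin n → FreqRing U) b = 0 := by
  have h0 := evR_add z (0 : Fin n → FreqRing U) 0 b
  simpa only [add_zero, left_eq_add] using h0

theorem evR_sub (z : FreqRing U) (v v' : Fin n → FreqRing U) (b : FreqRing U) :
    evR z (v - v') b = evR z v b - evR z v' b := by
  rw [sub_eq_add_neg, evR_add, evR_neg, sub_eq_add_neg]

theorem evR_sum {ι : Type*} (S : Finset ι) (z : FreqRing U) (v : ι → Fin n → FreqRing U)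
    (b : FreqRing U) : evR z (∑ i ∈ S, v i) b = ∑ i ∈ S, evR z (v i) b := by
  induction S using Finset.cons_induction with
  | empty => simp [evR_zero]
  | cons a S ha ih => rw [Finset.sum_cons, Finset.sum_cons, evR_add, ih]

/-- An evolutionary derivation along a field of total frequency `z` raises the frequency of the
total derivative by `z`. -/
theorem evR_dFreq {z y : FreqRing U} (hy : IsFreq y) (v : Fin n → FreqRing U)
    (b : FreqRing U) : evR z v (dFreq y b) = dFreq (y + z) (evR z v b) := by
  induction b using MvPolynomial.induction_on with
  | C a =>
    rw [dFreq_apply, map_add, symD_C, Derivation.leibniz, hy.evR, smul_zero, add_zero, evR_C,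
      evR_C, evo_totalD (dFreq z) (fun a b => dFreq_smul z a b)
        (fun k s => Function.iterate_succ_apply' _ _ _), dFreq_apply, dFreq_apply, smul_eq_mul]
    ring
  | add a b ha hb => simp only [map_add, ha, hb]
  | mul_X b i hb =>
    rw [mul_comm, dFreq_freq_mul _ (isFreq_X i), Derivation.leibniz, Derivation.leibniz, evR_X,
      smul_zero, smul_zero, add_zero, add_zero, hb, smul_eq_mul, smul_eq_mul,
      dFreq_freq_mul _ (isFreq_X i)]

theorem evR_dFreq_iterate {z y : FreqRing U} (hy : IsFreq y) (v : Fin n → FreqRing U)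
    (m : ℕ) (b : FreqRing U) :
    evR z v ((dFreq y)^[m] b) = (dFreq (y + z))^[m] (evR z v b) := by
  induction m with
  | zero => rfl
  | succ m ih => rw [Function.iterate_succ_apply', evR_dFreq hy, ih, Function.iterate_succ_apply']

/-- The commutator of two evolutionary derivations is again evolutionary. -/
theorem evR_commutator {z y : FreqRing U} (hz : IsFreq z) (hy : IsFreq y)
    (v u : Fin n → FreqRing U) (b : FreqRing U) :
    evR z v (evR y u b) - evR y u (evR z v b)
      = evR (z + y) (fun k => evR z v (u k) - evR y u (v k)) b := by
  have key : ⁅evR z v, evR y u⁆ = evR (z + y) (fun k => evR z v (u k) - evR y u (v k)) := by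
    refine derivation_ext (fun a => ?_) (fun i => by simp [Derivation.commutator_apply])
    rw [Derivation.commutator_apply]
    have hd : ∀ a : DiffPoly U, (⁅evR z v, evR y u⁆.compAlgebraMap (DiffPoly U)) a
        = evR z v (evR y u (MvPolynomial.C a)) - evR y u (evR z v (MvPolynomial.C a)) :=
      fun a => Derivation.commutator_apply (D1 := evR z v) (D2 := evR y u) (MvPolynomial.C a)
    rw [← hd]
    rw [evR_C]
    refine evo_eq (fun c => ?_) (fun k => ?_) a
    · rw [hd]
      have hs : ∀ (c : SmoothFn U) (b : FreqRing U),
          c • b = MvPolynomial.C (MvPolynomial.C c) * b := by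
        intro c b
        rw [← algebraMap_func, MvPolynomial.smul_eq_C_mul]; rfl
      have he : ∀ z v, evR z v (MvPolynomial.C (MvPolynomial.C c) : FreqRing U)
          = ∑ k, MvPolynomial.C (MvPolynomial.C (partialD k c)) * v k := by
        intro z v
        rw [evR_C, evo_C]
        simp only [Function.iterate_zero_apply, hs]
      have he2 : ∀ z (v : Fin n → FreqRing U) k,
          evR z v (MvPolynomial.C (MvPolynomial.C (partialD k c)) : FreqRing U)
          = ∑ l, MvPolynomial.C (MvPolynomial.C (partialD l (partialD k c))) * v l := by
        intro z v k
        rw [evR_C, evo_C]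
        simp only [Function.iterate_zero_apply, hs]
      rw [he, he, map_sum, map_sum]
      simp only [Derivation.leibniz, smul_eq_mul, he2, Function.iterate_zero_apply, hs, mul_sub,
        Finset.sum_sub_distrib, Finset.sum_add_distrib, Finset.mul_sum]
      rw [Finset.sum_comm (f := fun x i => u x * _)]
      have : ∀ k l, u l * (MvPolynomial.C (MvPolynomial.C (partialD k (partialD l c))) * v k)
          = v k * (MvPolynomial.C (MvPolynomial.C (partialD l (partialD k c))) * u l) := by
        intro k l; rw [partialD_comm]; ring
      simp only [this]
      ring
    · rw [hd, evR_C, evR_C, evo_X, evo_X, evR_dFreq_iterate hy, evR_dFreq_iterate hz, add_comm z y,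
        ← iterate_map_sub]
  rw [← key, Derivation.commutator_apply]

/-! ### Operators acting on symbols -/

/-- The operator `P` applied to a density `b` of total frequency `z`. -/
def act (z : FreqRing U) (P : DiffOp U) (b : FreqRing U) : FreqRing U :=
  seqMap (fun m => (dFreq z)^[m] b) P

theorem act_monomial (z : FreqRing U) (m : ℕ) (a : DiffPoly U) (b : FreqRing U) :
    act z (Polynomial.monomial m a) b = MvPolynomial.C a * (dFreq z)^[m] b := by
  rw [act, seqMap_monomial, MvPolynomial.smul_eq_C_mul]

theorem act_add (z : FreqRing U) (P Q : DiffOp U) (b : FreqRing U) :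
    act z (P + Q) b = act z P b + act z Q b := map_add _ _ _

theorem act_sub (z : FreqRing U) (P Q : DiffOp U) (b : FreqRing U) :
    act z (P - Q) b = act z P b - act z Q b := map_sub _ _ _

theorem act_neg (z : FreqRing U) (P : DiffOp U) (b : FreqRing U) :
    act z (-P) b = -act z P b := map_neg _ _

theorem act_zero (z : FreqRing U) (b : FreqRing U) : act z 0 b = 0 := map_zero _

theorem act_sum {ι : Type*} (S : Finset ι) (z : FreqRing U) (P : ι → DiffOp U) (b : FreqRing U) :
    act z (∑ i ∈ S, P i) b = ∑ i ∈ S, act z (P i) b := map_sum _ _ _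

theorem act_map_add (z : FreqRing U) (P : DiffOp U) (b c : FreqRing U) :
    act z P (b + c) = act z P b + act z P c := by
  induction P using Polynomial.induction_on' with
  | add P Q hP hQ => rw [act_add, hP, hQ, act_add, act_add]; abel
  | monomial m a => simp only [act_monomial, iterate_map_add, mul_add]

theorem act_dxComp (z : FreqRing U) (P : DiffOp U) (b : FreqRing U) :
    act z (dxComp P) b = dFreq z (act z P b) := by
  induction P using Polynomial.induction_on' with
  | add P Q hP hQ => rw [dxComp_add, act_add, hP, hQ, act_add, map_add]
  | monomial m a =>
    rw [dxComp_monomial, act_add, act_monomial, act_monomial, act_monomial,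
      ← MvPolynomial.smul_eq_C_mul, ← MvPolynomial.smul_eq_C_mul, ← MvPolynomial.smul_eq_C_mul,
      dFreq_smul, Function.iterate_succ_apply']

theorem act_opComp (z : FreqRing U) (P Q : DiffOp U) (b : FreqRing U) :
    act z (opComp P Q) b = act z P (act z Q b) := by
  rw [opComp_eq, act, map_seqMap, act]
  congr 2
  ext1 m
  induction m with
  | zero => rfl
  | succ m ih => rw [Function.iterate_succ_apply', Function.iterate_succ_apply', ← ih]
                 exact act_dxComp z _ b

theorem dFreq_iterate_one {z : FreqRing U} (hz : IsFreq z) (m : ℕ) :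
    (dFreq z)^[m] (1 : FreqRing U) = z ^ m := by
  have hm : ∀ m : ℕ, IsFreq (z ^ m) := fun m d => by simp [Derivation.leibniz_pow, hz d]
  induction m with
  | zero => simp
  | succ m ih =>
    rw [Function.iterate_succ_apply', ih, dFreq_apply, (hm m).symD, zero_add, pow_succ']

/-- On the test function itself, an operator acts as its symbol. -/
theorem act_one {z : FreqRing U} (hz : IsFreq z) (P : DiffOp U) :
    act z P 1 = Polynomial.aeval z P := by
  induction P using Polynomial.induction_on' with
  | add P Q hP hQ => rw [act_add, hP, hQ, map_add]
  | monomial m a =>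
    rw [act_monomial, dFreq_iterate_one hz, Polynomial.aeval_monomial, MvPolynomial.algebraMap_eq]

theorem act_opAdj_monomial (z : FreqRing U) (m : ℕ) (a : DiffPoly U) (b : FreqRing U) :
    act z (opAdj (Polynomial.monomial m a)) b = (-dFreq z)^[m] (MvPolynomial.C a * b) := by
  rw [opAdj_monomial]
  induction m with
  | zero =>
    have := act_monomial z 0 a b
    simpa [opFun] using this
  | succ m ih =>
    rw [Function.iterate_succ_apply', Function.iterate_succ_apply', ← ih]
    change act z (-dxComp _) b = _
    rw [act_neg, act_dxComp]
    rfl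

end Symbols

/-! ### Eliminating one frequency by integration by parts -/

section Elimination

variable {n : ℕ} {U : Opens (Fin n → ℝ)}

/-- The total derivative acting on the coefficients of a two-frequency symbol. -/
def triCoeffD : Derivation ℝ (TriSymbol U) (TriSymbol U) :=
  coeffExt ((Algebra.linearMap (DiffPoly U) (TriSymbol U)).compDer totalDer)

theorem triCoeffD_C (a : DiffPoly U) :
    triCoeffD (MvPolynomial.C a : TriSymbol U) = MvPolynomial.C (totalD a) := by
  simp [triCoeffD, totalDer_apply, MvPolynomial.algebraMap_eq]

theorem triDx_eq (T : TriSymbol U) :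
    triDx T = triCoeffD T + (MvPolynomial.X 0 + MvPolynomial.X 1) * T := by
  rw [triDx]
  congr 1
  change _ = monomialSum _ T
  refine Finset.sum_congr rfl fun m _ => ?_
  simp [totalDer_apply, Algebra.linearMap_apply, MvPolynomial.algebraMap_eq, mul_comm,
    MvPolynomial.C_mul_monomial]

/-- The `x`-derivative of symbols as an additive map. -/
def triDxHom : TriSymbol U →+ TriSymbol U :=
  (triCoeffD (U := U)).toLinearMap.toAddMonoidHom +
    AddMonoidHom.mulLeft (MvPolynomial.X 0 + MvPolynomial.X 1)

theorem triDxHom_apply (T : TriSymbol U) : triDxHom T = triDx T := (triDx_eq T).symm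

theorem triDx_X_mul (i : Fin 2) (T : TriSymbol U) :
    triDx (MvPolynomial.X i * T) = MvPolynomial.X i * triDx T := by
  have : triCoeffD (MvPolynomial.X i : TriSymbol U) = 0 := by simp [triCoeffD]
  simp only [triDx_eq, Derivation.leibniz, this, smul_eq_mul]
  ring

theorem iterate_X_mul (i : Fin 2) (k m : ℕ) (T : TriSymbol U) :
    (-triDxHom : TriSymbol U →+ TriSymbol U)^[m] (MvPolynomial.X i ^ k * T)
      = MvPolynomial.X i ^ k * (-triDxHom : TriSymbol U →+ TriSymbol U)^[m] T := by
  have h1 : ∀ T : TriSymbol U, triDx (MvPolynomial.X i ^ k * T) = MvPolynomial.X i ^ k * triDx T := by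
    intro T
    induction k with
    | zero => simp
    | succ k ih => rw [pow_succ', mul_assoc, triDx_X_mul, ih, mul_assoc]
  induction m with
  | zero => rfl
  | succ m ih =>
    rw [Function.iterate_succ_apply', Function.iterate_succ_apply', ih, AddMonoidHom.neg_apply,
      AddMonoidHom.neg_apply, triDxHom_apply, triDxHom_apply, h1]
    exact (mul_neg (α := TriSymbol U) _ _).symm

/-- The normal form of a density modulo total derivatives: the derivatives of the first test
function are moved away by integration by parts. -/
def elim : FreqRing U →+ TriSymbol U :=
  monomialSum fun m =>
    { toFun := fun c => (-triDxHom : TriSymbol U →+ TriSymbol U)^[m 0]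
        (MvPolynomial.X 0 ^ m 1 * (MvPolynomial.X 1 ^ m 2 * MvPolynomial.C c))
      map_zero' := by simp [iterate_map_zero]
      map_add' := by intro a b; simp only [map_add, mul_add, iterate_map_add] }

theorem elim_monomial (m : Fin 3 →₀ ℕ) (c : DiffPoly U) :
    elim (MvPolynomial.monomial m c) = (-triDxHom : TriSymbol U →+ TriSymbol U)^[m 0]
        (MvPolynomial.X 0 ^ m 1 * (MvPolynomial.X 1 ^ m 2 * MvPolynomial.C c)) :=
  monomialSum_monomial _ m c

theorem elim_C (c : DiffPoly U) : elim (MvPolynomial.C c) = MvPolynomial.C c := by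
  have := elim_monomial (0 : Fin 3 →₀ ℕ) c
  simpa using this

theorem elim_X0_mul (T : FreqRing U) : elim (freq U 0 * T) = -triDx (elim T) := by
  induction T using MvPolynomial.induction_on' with
  | add p q hp hq => rw [mul_add, map_add, hp, hq, map_add, ← triDxHom_apply, ← triDxHom_apply,
      ← triDxHom_apply, map_add]; abel
  | monomial m c =>
    rw [freq, MvPolynomial.X, MvPolynomial.monomial_mul, one_mul, elim_monomial, elim_monomial,
      ← triDxHom_apply, ← AddMonoidHom.neg_apply, ← Function.iterate_succ_apply' (f := ⇑(-triDxHom))]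
    simp [add_comm]

theorem elim_X1_mul (T : FreqRing U) : elim (freq U 1 * T) = MvPolynomial.X 0 * elim T := by
  induction T using MvPolynomial.induction_on' with
  | add p q hp hq => rw [mul_add, map_add, hp, hq, map_add, mul_add]
  | monomial m c =>
    rw [freq, MvPolynomial.X, MvPolynomial.monomial_mul, one_mul, elim_monomial, elim_monomial]
    simp [add_comm 1, pow_succ', mul_assoc]
    simpa using iterate_X_mul (U := U) 0 1 (m 0) _

theorem elim_X2_mul (T : FreqRing U) : elim (freq U 2 * T) = MvPolynomial.X 1 * elim T := by
  induction T using MvPolynomial.induction_on' with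
  | add p q hp hq => rw [mul_add, map_add, hp, hq, map_add, mul_add]
  | monomial m c =>
    rw [freq, MvPolynomial.X, MvPolynomial.monomial_mul, one_mul, elim_monomial, elim_monomial]
    simp [add_comm 1, pow_succ', mul_assoc]
    rw [mul_left_comm]
    simpa using iterate_X_mul (U := U) 1 1 (m 0) _

theorem elim_symD (T : FreqRing U) : elim (symD T) = triCoeffD (elim T) := by
  have hX : ∀ i, triCoeffD (MvPolynomial.X i : TriSymbol U) = 0 := by simp [triCoeffD]
  have hx : ∀ i, symD (MvPolynomial.X i : FreqRing U) = 0 := by simp [symD]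
  induction T using MvPolynomial.induction_on with
  | C c => rw [symD_C, elim_C, elim_C, triCoeffD_C]
  | add p q hp hq => simp only [map_add, hp, hq]
  | mul_X p i hp =>
    rw [Derivation.leibniz, hx, smul_zero, zero_add, smul_eq_mul, mul_comm p]
    fin_cases i
    · have h := elim_X0_mul p
      have h' := elim_X0_mul (symD p)
      simp only [freq] at h h'
      simp only [Fin.zero_eta]
      rw [h, h', hp, triDx_eq, triDx_eq, map_neg, map_add, Derivation.leibniz, map_add, hX, hX]
      simp
    · have h := elim_X1_mul p
      have h' := elim_X1_mul (symD p)
      simp only [freq] at h h'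
      simp only [Fin.mk_one]
      rw [h, h', hp, Derivation.leibniz, hX]
      simp
    · have h := elim_X2_mul p
      have h' := elim_X2_mul (symD p)
      simp only [freq] at h h'
      simp only [Fin.reduceFinMk]
      rw [h, h', hp, Derivation.leibniz, hX]
      simp

/-- The sum of the three frequencies: `dFreq (totalFreq U)` is the total derivative of densities. -/
abbrev totalFreq (U : Opens (Fin n → ℝ)) : FreqRing U := freq U 0 + freq U 1 + freq U 2

/-- Total derivatives vanish after elimination of the first frequency. -/
theorem elim_dFreq (T : FreqRing U) : elim (dFreq (totalFreq U) T) = 0 := by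
  rw [dFreq_apply, map_add, add_mul, add_mul, map_add, map_add, elim_X0_mul, elim_X1_mul,
    elim_X2_mul, elim_symD, triDx_eq]
  ring

/-- Substitution of two frequencies into a symbol. -/
def emb (z y : FreqRing U) : TriSymbol U →ₐ[DiffPoly U] FreqRing U := MvPolynomial.aeval ![z, y]

@[simp]
theorem emb_C (z y : FreqRing U) (c : DiffPoly U) :
    emb z y (MvPolynomial.C c) = MvPolynomial.C c := by
  simp [emb, MvPolynomial.algebraMap_eq]

@[simp]
theorem emb_X0 (z y : FreqRing U) : emb z y (MvPolynomial.X 0) = z := by simp [emb]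

@[simp]
theorem emb_X1 (z y : FreqRing U) : emb z y (MvPolynomial.X 1) = y := by simp [emb]

/-- Densities without the first frequency are their own normal form. -/
theorem elim_emb (T : TriSymbol U) : elim (emb (freq U 1) (freq U 2) T) = T := by
  induction T using MvPolynomial.induction_on with
  | C c => rw [emb_C, elim_C]
  | add p q hp hq => simp only [map_add, hp, hq]
  | mul_X p i hp =>
    rw [mul_comm p, map_mul]
    fin_cases i
    · simp only [Fin.zero_eta, emb_X0]; rw [elim_X1_mul, hp]
    · simp only [Fin.mk_one, emb_X1]; rw [elim_X2_mul, hp]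

theorem elim_X0_pow (k : ℕ) (T : FreqRing U) :
    elim (freq U 0 ^ k * T) = (-triDxHom : TriSymbol U →+ TriSymbol U)^[k] (elim T) := by
  induction k with
  | zero => simp
  | succ k ih =>
    rw [pow_succ', mul_assoc, elim_X0_mul, ih, Function.iterate_succ_apply', AddMonoidHom.neg_apply,
      triDxHom_apply]

theorem elim_X1_pow (k : ℕ) (T : FreqRing U) :
    elim (freq U 1 ^ k * T) = MvPolynomial.X 0 ^ k * elim T := by
  induction k with
  | zero => simp
  | succ k ih => rw [pow_succ', mul_assoc, elim_X1_mul, ih, pow_succ', mul_assoc]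

theorem elim_X2_pow (k : ℕ) (T : FreqRing U) :
    elim (freq U 2 ^ k * T) = MvPolynomial.X 1 ^ k * elim T := by
  induction k with
  | zero => simp
  | succ k ih => rw [pow_succ', mul_assoc, elim_X2_mul, ih, pow_succ', mul_assoc]

theorem emb_monomial (z y : FreqRing U) (m : Fin 2 →₀ ℕ) (c : DiffPoly U) :
    emb z y (MvPolynomial.monomial m c) = z ^ m 0 * (y ^ m 1 * MvPolynomial.C c) := by
  rw [emb, MvPolynomial.aeval_monomial, MvPolynomial.algebraMap_eq, Finsupp.prod_fintype _ _ (by simp)]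
  simp
  ring

theorem neg_triDxHom : (fun B : TriSymbol U => -triDx B) = ⇑(-triDxHom : TriSymbol U →+ TriSymbol U) := by
  ext1 B
  rw [AddMonoidHom.neg_apply, triDxHom_apply]

/-- Rewriting a distribution in terms of the base point `x` is integration by parts. -/
theorem rebaseZXY_eq (T : TriSymbol U) : rebaseZXY T = elim (emb (freq U 0) (freq U 1) T) := by
  have key : ∀ T : TriSymbol U, rebaseZXY T = monomialSum (fun m : Fin 2 →₀ ℕ =>
      { toFun := fun c => (-triDxHom : TriSymbol U →+ TriSymbol U)^[m 0]
          (MvPolynomial.C c * MvPolynomial.X 0 ^ m 1)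
        map_zero' := by simp [iterate_map_zero]
        map_add' := by intro a b; simp only [map_add, add_mul, iterate_map_add] }) T := by
    intro T
    rw [rebaseZXY, neg_triDxHom]
    rfl
  rw [key]
  induction T using MvPolynomial.induction_on' with
  | add p q hp hq => simp only [map_add, hp, hq]
  | monomial m c =>
    rw [monomialSum_monomial, emb_monomial, elim_X0_pow, elim_X1_pow, elim_C,
      mul_comm (MvPolynomial.X 0 ^ _)]
    rfl

theorem rebaseYZX_eq (T : TriSymbol U) : rebaseYZX T = elim (emb (freq U 2) (freq U 0) T) := by
  have key : ∀ T : TriSymbol U, rebaseYZX T = monomialSum (fun m : Fin 2 →₀ ℕ =>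
      { toFun := fun c => (-triDxHom : TriSymbol U →+ TriSymbol U)^[m 1]
          (MvPolynomial.C c * MvPolynomial.X 1 ^ m 0)
        map_zero' := by simp [iterate_map_zero]
        map_add' := by intro a b; simp only [map_add, add_mul, iterate_map_add] }) T := by
    intro T
    rw [rebaseYZX, neg_triDxHom]
    rfl
  rw [key]
  induction T using MvPolynomial.induction_on' with
  | add p q hp hq => simp only [map_add, hp, hq]
  | monomial m c =>
    rw [monomialSum_monomial, emb_monomial, mul_left_comm, elim_X0_pow, elim_X2_pow, elim_C,
      mul_comm (MvPolynomial.X 1 ^ _)]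
    rfl

theorem emb_triDx (T : TriSymbol U) : emb (freq U 1) (freq U 2) (triDx T)
    = dFreq (freq U 1 + freq U 2) (emb (freq U 1) (freq U 2) T) := by
  have h : emb (freq U 1) (freq U 2) (triCoeffD T) = symD (emb (freq U 1) (freq U 2) T) := by
    have hX : ∀ i, triCoeffD (MvPolynomial.X i : TriSymbol U) = 0 := by simp [triCoeffD]
    induction T using MvPolynomial.induction_on with
    | C c => rw [triCoeffD_C, emb_C, emb_C, symD_C]
    | add p q hp hq => simp only [map_add, hp, hq]
    | mul_X p i hp =>
      rw [Derivation.leibniz, hX, smul_zero, zero_add, smul_eq_mul, map_mul, map_mul, hp,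
        Derivation.leibniz]
      fin_cases i
      · simp [(isFreq_X (U := U) 1).symD]
      · simp [(isFreq_X (U := U) 2).symD]
  rw [triDx_eq, map_add, h, dFreq_apply, map_mul, map_add, emb_X0, emb_X1]

/-- A density differs from its normal form by a total derivative. -/
theorem exists_sub_emb_elim (T : FreqRing U) :
    ∃ V, T = emb (freq U 1) (freq U 2) (elim T) + dFreq (totalFreq U) V := by
  have step : ∀ i, dFreq (totalFreq U) (freq U i * T) = freq U i * dFreq (totalFreq U) T :=
    fun i => dFreq_freq_mul _ (isFreq_X i) _
  induction T using MvPolynomial.induction_on with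
  | C c => exact ⟨0, by simp [elim_C]⟩
  | add p q hp hq =>
    obtain ⟨V, hV⟩ := hp fun i => dFreq_freq_mul _ (isFreq_X i) _
    obtain ⟨W, hW⟩ := hq fun i => dFreq_freq_mul _ (isFreq_X i) _
    refine ⟨V + W, ?_⟩
    rw [map_add, map_add, map_add]
    nth_rewrite 1 [hV]
    nth_rewrite 1 [hW]
    abel
  | mul_X p i hp =>
    obtain ⟨V, hV⟩ := hp fun i => dFreq_freq_mul _ (isFreq_X i) _
    rw [mul_comm p]
    have e : ∀ i V, dFreq (totalFreq U) (freq U i * V) = freq U i * dFreq (totalFreq U) V :=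
      fun i V => dFreq_freq_mul _ (isFreq_X i) _
    fin_cases i
    · refine ⟨freq U 0 * V + emb (freq U 1) (freq U 2) (elim p), ?_⟩
      have h := elim_X0_mul p
      simp only [freq] at h
      simp only [Fin.zero_eta]
      rw [h, map_neg, emb_triDx, map_add, e]
      nth_rewrite 1 [hV]
      simp only [dFreq_apply, totalFreq, freq]
      ring
    · refine ⟨freq U 1 * V, ?_⟩
      have h := elim_X1_mul p
      simp only [freq] at h
      simp only [Fin.mk_one]
      rw [h, map_mul, emb_X0, e]
      nth_rewrite 1 [hV]
      simp only [freq]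
      ring
    · refine ⟨freq U 2 * V, ?_⟩
      have h := elim_X2_mul p
      simp only [freq] at h
      simp only [Fin.reduceFinMk]
      rw [h, map_mul, emb_X1, e]
      nth_rewrite 1 [hV]
      simp only [freq]
      ring

/-- The kernel of the elimination consists of the total derivatives. -/
theorem elim_eq_zero_iff (T : FreqRing U) : elim T = 0 ↔ ∃ V, T = dFreq (totalFreq U) V := by
  constructor
  · intro h
    obtain ⟨V, hV⟩ := exists_sub_emb_elim T
    exact ⟨V, by simpa [h] using hV⟩
  · rintro ⟨V, rfl⟩
    exact elim_dFreq V

theorem elim_mul_iterate {z y : FreqRing U} (hzy : z + y = totalFreq U) (m : ℕ) (a b : FreqRing U) :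
    elim (a * (dFreq y)^[m] b) = elim ((-dFreq z)^[m] a * b) := by
  induction m generalizing a with
  | zero => rfl
  | succ m ih =>
    rw [Function.iterate_succ_apply', Function.iterate_succ_apply, ← ih]
    have h := elim_dFreq (a * (dFreq y)^[m] b)
    rw [← hzy, dFreq_mul, map_add] at h
    have e : (-dFreq z) a * (dFreq y)^[m] b = -(dFreq z a * (dFreq y)^[m] b) :=
      neg_mul (dFreq z a) _
    rw [e, map_neg]
    exact eq_neg_of_add_eq_zero_right h

/-- Integration by parts: the formal adjoint is the adjoint modulo total derivatives. -/
theorem elim_mul_act {z y : FreqRing U} (hzy : z + y = totalFreq U) (P : DiffOp U)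
    (a b : FreqRing U) : elim (a * act y P b) = elim (act z (opAdj P) a * b) := by
  induction P using Polynomial.induction_on' with
  | add P Q hP hQ => rw [act_add, mul_add, map_add, hP, hQ, opAdj_add, act_add, add_mul, map_add]
  | monomial m c =>
    rw [act_monomial, act_opAdj_monomial, ← elim_mul_iterate hzy]
    congr 1
    ring

/-- The half bracket as an evolutionary derivation of the symbol of `P^{ij}` along the field with
components `Q^{lk}`. -/
theorem emb_halfBracket {z y : FreqRing U} (hz : IsFreq z) (hy : IsFreq y) (P Q : MatOp U)
    (i j k : Fin n) : emb z y (halfBracket P Q i j k)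
      = evR y (fun l => act y (Q l k) 1) (act z (P i j) 1) := by
  have h1 : ∀ a : DiffPoly U, emb z y (∑ l, Polynomial.aeval (MvPolynomial.X 1 : TriSymbol U)
      (opComp (lin a l) (Q l k))) = evR y (fun l => act y (Q l k) 1) (MvPolynomial.C a) := by
    intro a
    rw [map_sum, evR_C, ← sum_seqMap_lin]
    refine Finset.sum_congr rfl fun l _ => ?_
    rw [← Polynomial.aeval_algHom_apply, emb_X1, ← act_one hy, act_opComp]
    rfl
  have hzm : ∀ m : ℕ, IsFreq (z ^ m) := fun m d => by simp [Derivation.leibniz_pow, hz d]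
  rw [halfBracket, Polynomial.sum, map_sum, act_one hz, Polynomial.aeval_def,
    Polynomial.eval₂_eq_sum, Polynomial.sum, map_sum]
  refine Finset.sum_congr rfl fun m _ => ?_
  rw [map_mul, map_pow, emb_X0, h1, Derivation.leibniz, (hzm m).evR, smul_zero, zero_add,
    smul_eq_mul, MvPolynomial.algebraMap_eq]

/-- The bilinear expression `(∂ P^{ij} / ∂ u)(Q^{·k})` for test functions with frequencies `z` and
`y` in the second and third slots. -/
def half (P Q : MatOp U) (i j k : Fin n) (z y : FreqRing U) : FreqRing U :=
  evR y (fun l => act y (Q l k) 1) (act z (P i j) 1)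

/-- The symmetrization of `half` in the two bivectors. -/
def symHalf (P Q : MatOp U) (i j k : Fin n) (z y : FreqRing U) : FreqRing U :=
  half P Q i j k z y + half Q P i j k z y

/-- The density that represents the Schouten bracket: a cyclic sum over the three test functions. -/
def bracketDensity (P Q : MatOp U) (i j k : Fin n) : FreqRing U :=
  symHalf P Q i j k (freq U 1) (freq U 2) + symHalf P Q k i j (freq U 0) (freq U 1)
    + symHalf P Q j k i (freq U 2) (freq U 0)

/-- The Schouten bracket is the normal form of the cyclic density `bracketDensity`. -/
theorem schouten_eq (P Q : MatOp U) (i j k : Fin n) :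
    schouten P Q i j k = elim (bracketDensity P Q i j k) := by
  have h : ∀ (i j k : Fin n) {z y : FreqRing U}, IsFreq z → IsFreq y →
      emb z y (halfBracket P Q i j k + halfBracket Q P i j k) = symHalf P Q i j k z y := by
    intro i j k z y hz hy
    rw [map_add, emb_halfBracket hz hy, emb_halfBracket hz hy, symHalf, half, half]
  rw [schouten, rebaseZXY_eq, rebaseYZX_eq, h _ _ _ (isFreq_X _) (isFreq_X _),
    h _ _ _ (isFreq_X _) (isFreq_X _), bracketDensity, map_add, map_add,
    ← h i j k (isFreq_X 1) (isFreq_X 2), elim_emb]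

end Elimination

/-! ### Substituting a density for a test function -/

section Insertion

variable {n : ℕ} {U : Opens (Fin n → ℝ)}

theorem symD_monomial (m : Fin 3 →₀ ℕ) (c : DiffPoly U) :
    symD (MvPolynomial.monomial m c) = MvPolynomial.monomial m (totalD c) := by
  have hm : symD (MvPolynomial.monomial m (1 : DiffPoly U)) = 0 := by
    have : ∀ a : DiffPoly U, symD (MvPolynomial.monomial m a)
        = MvPolynomial.monomial m (totalD a) := by
      intro a
      refine (monomialSum_monomial _ m a).trans ?_
      simp [totalDer_apply, MvPolynomial.algebraMap_eq, mul_comm, MvPolynomial.C_mul_monomial]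
    rw [this]
    simp [← totalDer_apply]
  have : (MvPolynomial.monomial m c : FreqRing U) = MvPolynomial.C c * MvPolynomial.monomial m 1 := by
    simp [MvPolynomial.C_mul_monomial]
  rw [this, Derivation.leibniz, hm, smul_zero, zero_add, symD_C, smul_eq_mul, mul_comm,
    MvPolynomial.C_mul_monomial, mul_one]

/-- The substitution of the density `b` for the `i`-th test function. -/
def ins (i : Fin 3) (b : FreqRing U) : FreqRing U →+ FreqRing U :=
  monomialSum fun m => (AddMonoidHom.mulRight ((dFreq (freq U i))^[m i] b)).comp
    (MvPolynomial.monomial (m.erase i)).toAddMonoidHom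

theorem ins_monomial (i : Fin 3) (b : FreqRing U) (m : Fin 3 →₀ ℕ) (c : DiffPoly U) :
    ins i b (MvPolynomial.monomial m c)
      = MvPolynomial.monomial (m.erase i) c * (dFreq (freq U i))^[m i] b :=
  monomialSum_monomial _ m c

theorem ins_C_mul (i : Fin 3) (b : FreqRing U) (c : DiffPoly U) (T : FreqRing U) :
    ins i b (MvPolynomial.C c * T) = MvPolynomial.C c * ins i b T := by
  induction T using MvPolynomial.induction_on' with
  | add p q hp hq => simp only [mul_add, map_add, hp, hq]
  | monomial m a => simp only [MvPolynomial.C_mul_monomial, ins_monomial, ← mul_assoc]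

theorem ins_X_mul {i j : Fin 3} (h : j ≠ i) (b : FreqRing U) (T : FreqRing U) :
    ins i b (freq U j * T) = freq U j * ins i b T := by
  induction T using MvPolynomial.induction_on' with
  | add p q hp hq => simp only [mul_add, map_add, hp, hq]
  | monomial m a =>
    have h1 : (Finsupp.single j 1 + m).erase i = Finsupp.single j 1 + m.erase i := by
      rw [Finsupp.erase_add, Finsupp.erase_single_ne h.symm]
    rw [freq, MvPolynomial.X, MvPolynomial.monomial_mul, ins_monomial, ins_monomial, h1,
      ← mul_assoc, MvPolynomial.monomial_mul]
    simp [h]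

theorem ins_dFreq_self (i : Fin 3) (b : FreqRing U) (T : FreqRing U) :
    ins i b (dFreq (freq U i) T) = dFreq (freq U i) (ins i b T) := by
  induction T using MvPolynomial.induction_on' with
  | add p q hp hq => simp only [map_add, hp, hq]
  | monomial m a =>
    have h1 : (Finsupp.single i 1 + m).erase i = m.erase i := by
      rw [Finsupp.erase_add, Finsupp.erase_single, zero_add]
    rw [dFreq_apply, map_add, symD_monomial, freq, MvPolynomial.X, MvPolynomial.monomial_mul,
      ins_monomial, ins_monomial, ins_monomial, h1, ← MvPolynomial.X]
    have h2 := dFreq_mul 0 (freq U i) (MvPolynomial.monomial (m.erase i) a)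
      ((dFreq (freq U i))^[m i] b)
    rw [zero_add] at h2
    rw [h2, dFreq_apply 0, symD_monomial, zero_mul, add_zero, ← Function.iterate_succ_apply'
      (f := dFreq (freq U i))]
    simp [add_comm]

theorem dFreq_add (z y T : FreqRing U) : dFreq (z + y) T = dFreq z T + y * T := by
  simp only [dFreq_apply]; ring

/-- Substitution for a test function commutes with total derivatives of densities. -/
theorem ins_dFreq_total (i : Fin 3) (b : FreqRing U) (T : FreqRing U) :
    ins i b (dFreq (totalFreq U) T) = dFreq (totalFreq U) (ins i b T) := by
  fin_cases i
  · rw [show totalFreq U = freq U 0 + (freq U 1 + freq U 2) by rw [totalFreq]; ring]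
    simp only [dFreq_add, map_add, add_mul, Fin.zero_eta]
    rw [ins_dFreq_self, ins_X_mul (by decide), ins_X_mul (by decide)]
  · rw [show totalFreq U = freq U 1 + (freq U 0 + freq U 2) by rw [totalFreq]; ring]
    simp only [dFreq_add, map_add, add_mul, Fin.mk_one]
    rw [ins_dFreq_self, ins_X_mul (by decide), ins_X_mul (by decide)]
  · rw [show totalFreq U = freq U 2 + (freq U 0 + freq U 1) by rw [totalFreq]; ring]
    simp only [dFreq_add, map_add, add_mul, Fin.reduceFinMk]
    rw [ins_dFreq_self, ins_X_mul (by decide), ins_X_mul (by decide)]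

/-- Substitution for a test function is well defined modulo total derivatives. -/
theorem elim_ins (i : Fin 3) (b : FreqRing U) {T : FreqRing U} (hT : elim T = 0) :
    elim (ins i b T) = 0 := by
  obtain ⟨V, rfl⟩ := (elim_eq_zero_iff T).1 hT
  rw [ins_dFreq_total, elim_dFreq]

theorem ins_one (i : Fin 3) (b : FreqRing U) : ins i b 1 = b := by
  have := ins_monomial i b 0 (1 : DiffPoly U)
  simpa using this

theorem ins_act (i : Fin 3) (b : FreqRing U) (P : DiffOp U) (T : FreqRing U) :
    ins i b (act (freq U i) P T) = act (freq U i) P (ins i b T) := by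
  have h : ∀ m : ℕ, ins i b ((dFreq (freq U i))^[m] T) = (dFreq (freq U i))^[m] (ins i b T) := by
    intro m
    induction m with
    | zero => rfl
    | succ m ih =>
      rw [Function.iterate_succ_apply', Function.iterate_succ_apply', ins_dFreq_self, ih]
  induction P using Polynomial.induction_on' with
  | add P Q hP hQ => simp only [act_add, map_add, hP, hQ]
  | monomial m a => rw [act_monomial, act_monomial, ins_C_mul, h]

/-- The symbol `Y` does not involve the `i`-th frequency. -/
def FreeOf (i : Fin 3) (Y : FreqRing U) : Prop := ∀ b T, ins i b (Y * T) = Y * ins i b T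

theorem FreeOf.ins_eq {i : Fin 3} {Y : FreqRing U} (h : FreeOf i Y) (b : FreqRing U) :
    ins i b Y = Y * b := by
  have := h b 1
  rwa [mul_one, ins_one] at this

theorem freeOf_C (i : Fin 3) (c : DiffPoly U) : FreeOf i (MvPolynomial.C c : FreqRing U) :=
  fun b T => ins_C_mul i b c T

theorem freeOf_X {i j : Fin 3} (h : j ≠ i) : FreeOf i (freq U j) := fun b T => ins_X_mul h b T

theorem FreeOf.add {i : Fin 3} {Y Z : FreqRing U} (hY : FreeOf i Y) (hZ : FreeOf i Z) :
    FreeOf i (Y + Z) := fun b T => by rw [add_mul, map_add, hY, hZ, add_mul]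

theorem FreeOf.mul {i : Fin 3} {Y Z : FreqRing U} (hY : FreeOf i Y) (hZ : FreeOf i Z) :
    FreeOf i (Y * Z) := fun b T => by rw [mul_assoc, hY, hZ, mul_assoc]

theorem freeOf_one (i : Fin 3) : FreeOf i (1 : FreqRing U) := fun b T => by simp

theorem FreeOf.dFreq {i : Fin 3} {Y z : FreqRing U} (hY : FreeOf i Y) (hz : FreeOf i z) :
    FreeOf i (dFreq z Y) := by
  have h : FreeOf i (symD Y) := by
    intro b T
    have h1 := ins_dFreq_self i b (Y * T)
    have e : ∀ T, HydroDeform.dFreq (freq U i) (Y * T)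
        = symD Y * T + Y * HydroDeform.dFreq (freq U i) T := by
      intro T; simp only [dFreq_apply, Derivation.leibniz, smul_eq_mul]; ring
    rw [hY, e, e, map_add, hY, ins_dFreq_self] at h1
    exact add_right_cancel h1
  rw [dFreq_apply]
  exact h.add (hz.mul hY)

theorem FreeOf.iterate {i : Fin 3} {Y z : FreqRing U} (hY : FreeOf i Y) (hz : FreeOf i z) (m : ℕ) :
    FreeOf i ((HydroDeform.dFreq z)^[m] Y) := by
  induction m with
  | zero => exact hY
  | succ m ih => rw [Function.iterate_succ_apply']; exact ih.dFreq hz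

theorem FreeOf.act {i : Fin 3} {Y z : FreqRing U} (hY : FreeOf i Y) (hz : FreeOf i z)
    (P : DiffOp U) : FreeOf i (act z P Y) := by
  induction P using Polynomial.induction_on' with
  | add P Q hP hQ => rw [act_add]; exact hP.add hQ
  | monomial m a => rw [act_monomial]; exact (freeOf_C i a).mul (hY.iterate hz m)

theorem FreeOf.evo {i : Fin 3} {w : Fin n → ℕ → FreqRing U} (hw : ∀ k s, FreeOf i (w k s))
    (a : DiffPoly U) : FreeOf i (evo w a) := by
  induction a using MvPolynomial.induction_on with
  | C c =>
    rw [evo_C]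
    refine Finset.sum_induction _ (FreeOf i) (fun _ _ => FreeOf.add) (fun b T => by simp)
      fun k _ => ?_
    rw [← algebraMap_func, MvPolynomial.smul_eq_C_mul]
    exact (freeOf_C i _).mul (hw k 0)
  | add f g hf hg => rw [map_add]; exact hf.add hg
  | mul_X f v hf =>
    rw [Derivation.leibniz, MvPolynomial.smul_eq_C_mul, MvPolynomial.smul_eq_C_mul, evo_X]
    exact ((freeOf_C i _).mul (hw _ _)).add ((freeOf_C i _).mul hf)

theorem FreeOf.evR {i : Fin 3} {z : FreqRing U} {v : Fin n → FreqRing U} (hz : FreeOf i z)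
    (hv : ∀ k, FreeOf i (v k)) {Y : FreqRing U} (P : DiffOp U) {y : FreqRing U} (hy : IsFreq y)
    (hyi : FreeOf i y) (hY : Y = HydroDeform.act y P 1) : FreeOf i (evR z v Y) := by
  subst hY
  induction P using Polynomial.induction_on' with
  | add P Q hP hQ => rw [act_add, map_add]; exact hP.add hQ
  | monomial m a =>
    rw [act_monomial, Derivation.leibniz, evR_dFreq_iterate hy, Derivation.map_one_eq_zero,
      iterate_map_zero, smul_zero, zero_add, smul_eq_mul, evR_C]
    exact ((freeOf_one i).iterate hyi m).mul (FreeOf.evo (fun k s => (hv k).iterate hz s) a)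

/-- The operator `P` with its coefficients varied along the vector field `v`, applied to `b`. -/
def evAct (z : FreqRing U) (v : Fin n → FreqRing U) (y : FreqRing U) (P : DiffOp U)
    (b : FreqRing U) : FreqRing U :=
  evR z v (act y P b) - act (y + z) P (evR z v b)

theorem evAct_add (z : FreqRing U) (v : Fin n → FreqRing U) (y : FreqRing U) (P Q : DiffOp U)
    (b : FreqRing U) : evAct z v y (P + Q) b = evAct z v y P b + evAct z v y Q b := by
  simp only [evAct, act_add, map_add]; ring

theorem evAct_monomial (z : FreqRing U) (v : Fin n → FreqRing U) {y : FreqRing U} (hy : IsFreq y)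
    (m : ℕ) (a : DiffPoly U) (b : FreqRing U) : evAct z v y (Polynomial.monomial m a) b
      = evR z v (MvPolynomial.C a) * (dFreq y)^[m] b := by
  rw [evAct, act_monomial, act_monomial, Derivation.leibniz, evR_dFreq_iterate hy, smul_eq_mul,
    smul_eq_mul]
  ring

theorem evAct_one (z : FreqRing U) (v : Fin n → FreqRing U) (y : FreqRing U) (P : DiffOp U) :
    evAct z v y P 1 = evR z v (act y P 1) := by
  have h0 : act (y + z) P (0 : FreqRing U) = 0 := by
    have := act_map_add (y + z) P 0 0
    simpa using this
  rw [evAct, Derivation.map_one_eq_zero, h0, sub_zero]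

theorem ins_half_left {i : Fin 3} {y : FreqRing U} (hy : FreeOf i y) (b : FreqRing U)
    (P Q : MatOp U) (p q k : Fin n) : ins i b (half P Q p q k (freq U i) y)
      = evAct y (fun l => act y (Q l k) 1) (freq U i) (P p q) b := by
  rw [half, ← evAct_one]
  generalize P p q = A
  induction A using Polynomial.induction_on' with
  | add A B hA hB => rw [evAct_add, map_add, hA, hB, evAct_add]
  | monomial m a =>
    rw [evAct_monomial _ _ (isFreq_X i), evAct_monomial _ _ (isFreq_X i), evR_C,
      FreeOf.evo (fun k s => ((freeOf_one i).act hy _).iterate hy s) a]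
    congr 1
    have := ins_act i b (Polynomial.monomial m 1) (1 : FreqRing U)
    simpa only [act_monomial, map_one, one_mul, ins_one] using this

theorem ins_half_right {i : Fin 3} {z : FreqRing U} (hz : IsFreq z) (hzi : FreeOf i z)
    (b : FreqRing U) (P Q : MatOp U) (p q k : Fin n) : ins i b (half P Q p q k z (freq U i))
      = evR (freq U i) (fun l => act (freq U i) (Q l k) b) (act z (P p q) 1) := by
  let φ : FreqRing U →ₗ[DiffPoly U] FreqRing U :=
    { ins i b with
      map_smul' := by
        intro c T
        simp only [MvPolynomial.smul_eq_C_mul]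
        exact ins_C_mul i b c T }
  rw [half]
  generalize P p q = A
  induction A using Polynomial.induction_on' with
  | add A B hA hB => rw [act_add, map_add, map_add, hA, hB, map_add]
  | monomial m a =>
    rw [act_monomial, Derivation.leibniz, Derivation.leibniz, evR_dFreq_iterate hz,
      evR_dFreq_iterate hz, Derivation.map_one_eq_zero, Derivation.map_one_eq_zero,
      iterate_map_zero, smul_zero, zero_add, zero_add, smul_eq_mul, smul_eq_mul,
      ((freeOf_one i).iterate hzi m), evR_C, evR_C]
    congr 1
    change φ _ = _
    rw [map_evo]
    congr 2
    ext1 l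
    ext1 s
    change ins i b _ = _
    have := ins_act i b (Polynomial.monomial s 1) (act (freq U i) (Q l k) 1)
    simp only [act_monomial, map_one, one_mul] at this
    rw [this, ins_act, ins_one]

end Insertion

/-! ### The Lie derivative is a derivation of the Schouten bracket -/

section LieDerivative

variable {n : ℕ} {U : Opens (Fin n → ℝ)}

/-- A vector field as a density without test functions. -/
def fieldSym (ξ : VField U) (k : Fin n) : FreqRing U := MvPolynomial.C (ξ k)

theorem dFreq_zero_C (s : ℕ) (a : DiffPoly U) :
    (dFreq 0)^[s] (MvPolynomial.C a : FreqRing U) = MvPolynomial.C (totalD^[s] a) := by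
  induction s with
  | zero => rfl
  | succ s ih => rw [Function.iterate_succ_apply', ih, dFreq_apply, symD_C, zero_mul, add_zero,
      Function.iterate_succ_apply']

theorem evR_fieldSym_C (ξ : VField U) (a : DiffPoly U) :
    evR 0 (fieldSym ξ) (MvPolynomial.C a) = MvPolynomial.C (evol ξ a) := by
  rw [evR_C, evol_eq_evo]
  simp only [fieldSym, dFreq_zero_C]
  exact (map_evo (Algebra.linearMap (DiffPoly U) (FreqRing U)) _ _).symm

/-- The symbol of the adjoint of the linearization of `ξ^j` in the direction of `u^k`. -/
def adjLin (ξ : VField U) (j k : Fin n) (z : FreqRing U) : FreqRing U :=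
  act z (opAdj (lin (ξ j) k)) 1

theorem evR_eq_sum_act (z : FreqRing U) (v : Fin n → FreqRing U) (a : DiffPoly U) :
    evR z v (MvPolynomial.C a) = ∑ l, act z (lin a l) (v l) := by
  rw [evR_C, ← sum_seqMap_lin]
  rfl

/-- The action of a vector field on the coefficients of an operator. -/
def evolOp (ξ : VField U) (P : DiffOp U) : DiffOp U :=
  P.sum fun m a => Polynomial.monomial m (evol ξ a)

theorem act_evolOp {z : FreqRing U} (hz : IsFreq z) (ξ : VField U) (P : DiffOp U) :
    act z (evolOp ξ P) 1 = evR 0 (fieldSym ξ) (act z P 1) := by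
  have hz' : ∀ m : ℕ, IsFreq ((dFreq z)^[m] 1) := fun m d => by
    rw [dFreq_iterate_one hz]; simp [Derivation.leibniz_pow, hz d]
  simp only [act, evolOp, seqMap_apply, Polynomial.sum, map_sum]
  refine Finset.sum_congr rfl fun m _ => ?_
  have := act_monomial z m (evol ξ (P.coeff m)) 1
  rw [act, seqMap_apply] at this
  refine this.trans ?_
  rw [MvPolynomial.smul_eq_C_mul, Derivation.leibniz, (hz' m).evR, smul_zero, zero_add,
    smul_eq_mul, evR_fieldSym_C, mul_comm]

theorem lieD_apply (ξ : VField U) (P : MatOp U) (i j : Fin n) :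
    lieD ξ P i j = evolOp ξ (P i j) - ∑ k, opComp (lin (ξ i) k) (P k j)
      - ∑ k, opComp (P i k) (opAdj (lin (ξ j) k)) := rfl

theorem act_lieD {z : FreqRing U} (hz : IsFreq z) (ξ : VField U) (P : MatOp U) (i j : Fin n) :
    act z (lieD ξ P i j) 1 = evR 0 (fieldSym ξ) (act z (P i j) 1)
      - evR z (fun l => act z (P l j) 1) (fieldSym ξ i)
      - ∑ k, act z (P i k) (adjLin ξ j k z) := by
  rw [lieD_apply, act_sub, act_sub, act_evolOp hz, act_sum, act_sum, fieldSym, evR_eq_sum_act]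
  simp only [act_opComp, adjLin]

/-- The second-order part of the composition of two evolutionary derivations. -/
def hess (a : FreqRing U) (y : FreqRing U) (q : Fin n → FreqRing U) (z : FreqRing U)
    (p : Fin n → FreqRing U) : FreqRing U :=
  evR y q (evR z p a) - evR (z + y) (fun l => evR y q (p l)) a

/-- The Hessian is symmetric. -/
theorem hess_comm {y z : FreqRing U} (hy : IsFreq y) (hz : IsFreq z) (a : FreqRing U)
    (q p : Fin n → FreqRing U) : hess a y q z p = hess a z p y q := by
  have h := evR_commutator hy hz q p a
  have h2 := evR_sub (y + z) (fun l => evR y q (p l)) (fun l => evR z p (q l)) a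
  rw [hess, hess, add_comm z y]
  have e : ((fun l => evR y q (p l)) - fun l => evR z p (q l))
    = fun l => evR y q (p l) - evR z p (q l) := rfl
  rw [e, ← h] at h2
  linear_combination h2

theorem hess_eq_sum_evAct (a : DiffPoly U) (y : FreqRing U) (q : Fin n → FreqRing U)
    (z : FreqRing U) (p : Fin n → FreqRing U) :
    hess (MvPolynomial.C a) y q z p = ∑ l, evAct y q z (lin a l) (p l) := by
  simp only [hess, evR_eq_sum_act, evAct, map_sum, Finset.sum_sub_distrib]

/-- The Lie derivative of a half bracket, up to Hessian terms and terms in which the field acts on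
a test function. -/
theorem half_lieD {z y : FreqRing U} (hz : IsFreq z) (hy : IsFreq y) (ξ : VField U)
    (P Q : MatOp U) (i j k : Fin n) :
    half (lieD ξ P) Q i j k z y + half P (lieD ξ Q) i j k z y
      = evR 0 (fieldSym ξ) (half P Q i j k z y)
        - (hess (fieldSym ξ i) y (fun l => act y (Q l k) 1) z (fun l => act z (P l j) 1)
          + ∑ l, act (z + y) (P i l) (evR y (fun l => act y (Q l k) 1) (adjLin ξ j l z)))
        - ∑ l, act (z + y) (lin (ξ i) l) (half P Q l j k z y)
        - ∑ l, evAct y (fun l => act y (Q l k) 1) z (P i l) (adjLin ξ j l z)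
        - ∑ l, evR y (fun r => act y (Q r l) (adjLin ξ k l y)) (act z (P i j) 1) := by
  have hc := evR_commutator hy isFreq_zero (fun l => act y (Q l k) 1) (fieldSym ξ)
    (act z (P i j) 1)
  have e1 : (fun l => act y (lieD ξ Q l k) 1) = (fun l => evR 0 (fieldSym ξ) (act y (Q l k) 1))
      - (fun l => evR y (fun l => act y (Q l k) 1) (fieldSym ξ l))
      - ∑ l, fun r => act y (Q r l) (adjLin ξ k l y) := by
    ext1 l
    rw [act_lieD hy]
    simp
  have e2 : (fun l => evR y (fun l => act y (Q l k) 1) (fieldSym ξ l)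
        - evR 0 (fieldSym ξ) (act y (Q l k) 1))
      = (fun l => evR y (fun l => act y (Q l k) 1) (fieldSym ξ l))
        - fun l => evR 0 (fieldSym ξ) (act y (Q l k) 1) := rfl
  have e3 : evR (z + y) (fun l => evR y (fun l => act y (Q l k) 1) (act z (P l j) 1)) (fieldSym ξ i)
      = ∑ l, act (z + y) (lin (ξ i) l) (half P Q l j k z y) := by
    rw [fieldSym, evR_eq_sum_act]; rfl
  rw [e2, evR_sub, add_zero] at hc
  rw [half, half, act_lieD hz, e1, evR_sub, evR_sub, evR_sum, map_sub, map_sub, map_sum, hess, e3]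
  simp only [evAct, Finset.sum_sub_distrib]
  rw [half]
  linear_combination hc

/-- Integration by parts for an adjoint operator with varied coefficients. -/
theorem elim_mul_evR_adjLin {z₀ z y : FreqRing U} (hz : IsFreq z) (hz₀ : IsFreq z₀)
    (h : z₀ + z + y = totalFreq U) (q : Fin n → FreqRing U) (A : DiffOp U)
    (c : FreqRing U) :
    elim (c * evR y q (act z (opAdj A) 1)) = elim (evAct y q z₀ A c) := by
  induction A using Polynomial.induction_on' with
  | add A B hA hB =>
    rw [opAdj_add, act_add, map_add, mul_add, map_add, hA, hB, evAct_add, map_add]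
  | monomial m a =>
    have h1 : ∀ b : FreqRing U, evR y q ((-dFreq z)^[m] b) = (-dFreq (z + y))^[m] (evR y q b) := by
      intro b
      induction m with
      | zero => rfl
      | succ m ih =>
        rw [Function.iterate_succ_apply', Function.iterate_succ_apply', ← ih]
        change evR y q (-dFreq z _) = -dFreq (z + y) _
        rw [map_neg, evR_dFreq hz]
    rw [act_opAdj_monomial, evAct_monomial _ _ hz₀, mul_one, h1, elim_mul_iterate (z := z + y)
      (y := z₀) (by rw [← h]; ring), mul_comm]

/-- The terms of the Lie derivative of a half bracket that contain second derivatives of the vector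
field: modulo total derivatives, they are differences of Hessians. -/
theorem elim_hess_add {z₀ z y : FreqRing U} (hz : IsFreq z) (hz₀ : IsFreq z₀)
    (h : z₀ + z + y = totalFreq U) (ξ : VField U) (P : MatOp U) (hP : IsSkew P)
    (q : Fin n → FreqRing U) (i j : Fin n) :
    elim (hess (fieldSym ξ i) y q z (fun l => act z (P l j) 1)
        + ∑ l, act (z + y) (P i l) (evR y q (adjLin ξ j l z)))
      = elim (hess (fieldSym ξ i) y q z (fun l => act z (P l j) 1))
        - elim (hess (fieldSym ξ j) y q z₀ (fun l => act z₀ (P l i) 1)) := by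
  rw [map_add, map_sum, sub_eq_add_neg]
  congr 1
  have h1 : ∀ l, elim (act (z + y) (P i l) (evR y q (adjLin ξ j l z)))
      = -elim (evAct y q z₀ (lin (ξ j) l) (act z₀ (P l i) 1)) := by
    intro l
    have h2 := elim_mul_act (z := z₀) (y := z + y) (by rw [← h]; ring) (P i l) 1
      (evR y q (adjLin ξ j l z))
    have h3 := elim_mul_evR_adjLin hz hz₀ h q (lin (ξ j) l) (act z₀ (P l i) 1)
    rw [one_mul, hP l i, act_neg] at h2
    rw [h2, ← h3, ← map_neg]
    exact congrArg elim (neg_mul (α := FreqRing U) _ _)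
  simp only [h1, Finset.sum_neg_distrib]
  rw [← map_sum, fieldSym, hess_eq_sum_evAct]

/-- An operator acting on the other two test functions can be moved onto the `i`-th one. -/
theorem elim_slot {z : FreqRing U} {i : Fin 3} (hz : freq U i + z = totalFreq U)
    {T : FreqRing U} (hT : FreeOf i T) (ξ : VField U) (a l : Fin n) :
    elim (act z (lin (ξ a) l) T) = elim (ins i (adjLin ξ a l (freq U i)) T) := by
  have := elim_mul_act hz (lin (ξ a) l) 1 T
  rw [one_mul] at this
  rw [this, hT.ins_eq, mul_comm, adjLin]

theorem freeOf_half {i : Fin 3} {z y : FreqRing U} (hz : IsFreq z) (hzi : FreeOf i z)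
    (hyi : FreeOf i y) (P Q : MatOp U) (a b c : Fin n) : FreeOf i (half P Q a b c z y) :=
  FreeOf.evR hyi (fun _ => (freeOf_one i).act hyi _) _ hz hzi rfl

/-- The part of the Lie derivative of a half bracket that survives after the Hessian terms have
cancelled. The slots of the three test functions are `s₀`, `s₁`, `s₂`. -/
theorem elim_half_lieD {s₀ s₁ s₂ : Fin 3} (h01 : s₀ ≠ s₁) (h02 : s₀ ≠ s₂) (h12 : s₁ ≠ s₂)
    (h : freq U s₀ + freq U s₁ + freq U s₂ = totalFreq U) (ξ : VField U)
    (P Q : MatOp U) (hP : IsSkew P) (i j k : Fin n) :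
    elim (half (lieD ξ P) Q i j k (freq U s₁) (freq U s₂)
        + half P (lieD ξ Q) i j k (freq U s₁) (freq U s₂))
      = elim (evR 0 (fieldSym ξ) (half P Q i j k (freq U s₁) (freq U s₂)))
        - (elim (hess (fieldSym ξ i) (freq U s₂) (fun l => act (freq U s₂) (Q l k) 1)
            (freq U s₁) (fun l => act (freq U s₁) (P l j) 1))
          - elim (hess (fieldSym ξ j) (freq U s₂) (fun l => act (freq U s₂) (Q l k) 1)
            (freq U s₀) (fun l => act (freq U s₀) (P l i) 1)))
        - ∑ l, elim (ins s₀ (adjLin ξ i l (freq U s₀)) (half P Q l j k (freq U s₁) (freq U s₂)))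
        - ∑ l, elim (ins s₁ (adjLin ξ j l (freq U s₁)) (half P Q i l k (freq U s₁) (freq U s₂)))
        - ∑ l, elim (ins s₂ (adjLin ξ k l (freq U s₂)) (half P Q i j l (freq U s₁) (freq U s₂))) := by
  rw [half_lieD (isFreq_X _) (isFreq_X _), map_sub, map_sub, map_sub, map_sub,
    elim_hess_add (isFreq_X _) (isFreq_X _) h ξ P hP, map_sum, map_sum, map_sum]
  have f1 : ∀ l, elim (act (freq U s₁ + freq U s₂) (lin (ξ i) l)
      (half P Q l j k (freq U s₁) (freq U s₂)))
      = elim (ins s₀ (adjLin ξ i l (freq U s₀)) (half P Q l j k (freq U s₁) (freq U s₂))) :=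
    fun l => elim_slot (by rw [← h]; ring)
      (freeOf_half (isFreq_X _) (freeOf_X h01.symm) (freeOf_X h02.symm) P Q l j k) ξ i l
  have f2 : ∀ l, ins s₁ (adjLin ξ j l (freq U s₁)) (half P Q i l k (freq U s₁) (freq U s₂))
      = evAct (freq U s₂) (fun l => act (freq U s₂) (Q l k) 1) (freq U s₁) (P i l)
        (adjLin ξ j l (freq U s₁)) :=
    fun l => ins_half_left (freeOf_X h12.symm) _ P Q i l k
  have f3 : ∀ l, ins s₂ (adjLin ξ k l (freq U s₂)) (half P Q i j l (freq U s₁) (freq U s₂))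
      = evR (freq U s₂) (fun r => act (freq U s₂) (Q r l) (adjLin ξ k l (freq U s₂)))
        (act (freq U s₁) (P i j) 1) :=
    fun l => ins_half_right (isFreq_X _) (freeOf_X h12) _ P Q i j l
  simp only [f1, f2, f3]

/-- The Lie derivative satisfies the Leibniz rule for the Schouten bracket; here the consequence for
bivectors with vanishing bracket. -/
theorem schouten_lieD_add (ξ : VField U) {P Q : MatOp U} (hP : IsSkew P) (hQ : IsSkew Q)
    (h0 : ∀ i j k, schouten P Q i j k = 0) (i j k : Fin n) :
    schouten (lieD ξ P) Q i j k + schouten P (lieD ξ Q) i j k = 0 := by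
  have hev : elim (evR 0 (fieldSym ξ) (bracketDensity P Q i j k)) = 0 := by
    obtain ⟨V, hV⟩ := (elim_eq_zero_iff _).1 ((schouten_eq P Q i j k).symm.trans (h0 i j k))
    rw [hV, evR_dFreq (((isFreq_X _).add (isFreq_X _)).add (isFreq_X _)), add_zero, elim_dFreq]
  have hins : ∀ s b i j k, elim (ins s b (bracketDensity P Q i j k)) = 0 :=
    fun s b i j k => elim_ins s b ((schouten_eq P Q i j k).symm.trans (h0 i j k))
  have i0 : ∑ l, elim (ins 0 (adjLin ξ i l (freq U 0)) (bracketDensity P Q l j k)) = 0 :=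
    Finset.sum_eq_zero fun l _ => hins _ _ _ _ _
  have i1 : ∑ l, elim (ins 1 (adjLin ξ j l (freq U 1)) (bracketDensity P Q i l k)) = 0 :=
    Finset.sum_eq_zero fun l _ => hins _ _ _ _ _
  have i2 : ∑ l, elim (ins 2 (adjLin ξ k l (freq U 2)) (bracketDensity P Q i j l)) = 0 :=
    Finset.sum_eq_zero fun l _ => hins _ _ _ _ _
  have t1 : freq U 0 + freq U 1 + freq U 2 = totalFreq U := rfl
  have t2 : freq U 2 + freq U 0 + freq U 1 = totalFreq U := by rw [totalFreq]; ring
  have t3 : freq U 1 + freq U 2 + freq U 0 = totalFreq U := by rw [totalFreq]; ring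
  have a1 := elim_half_lieD (by decide) (by decide) (by decide) t1 ξ P Q hP i j k
  have a2 := elim_half_lieD (by decide) (by decide) (by decide) t1 ξ Q P hQ i j k
  have b1 := elim_half_lieD (by decide) (by decide) (by decide) t2 ξ P Q hP k i j
  have b2 := elim_half_lieD (by decide) (by decide) (by decide) t2 ξ Q P hQ k i j
  have c1 := elim_half_lieD (by decide) (by decide) (by decide) t3 ξ P Q hP j k i
  have c2 := elim_half_lieD (by decide) (by decide) (by decide) t3 ξ Q P hQ j k i
  have hh : ∀ (a : Fin n) (s t : Fin 3) (b c : Fin n) (P Q : MatOp U),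
      elim (hess (fieldSym ξ a) (freq U s) (fun l => act (freq U s) (P l b) 1) (freq U t)
        fun l => act (freq U t) (Q l c) 1)
      = elim (hess (fieldSym ξ a) (freq U t) (fun l => act (freq U t) (Q l c) 1) (freq U s)
        fun l => act (freq U s) (P l b) 1) :=
    fun a s t b c P Q => congrArg elim (hess_comm (isFreq_X s) (isFreq_X t) _ _ _)
  have h1 := hh i 2 1 k j Q P
  have h2 := hh i 2 1 k j P Q
  have h3 := hh k 1 0 j i Q P
  have h4 := hh k 1 0 j i P Q
  have h5 := hh j 0 2 i k Q P
  have h6 := hh j 0 2 i k P Q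
  rw [schouten_eq, schouten_eq]
  simp only [bracketDensity, symHalf, map_add, Finset.sum_add_distrib] at *
  linear_combination a1 + a2 + b1 + b2 + c1 + c2 + hev - i0 - i1 - i2 - h1 - h2 - h3 - h4 - h5 - h6

end LieDerivative

/-! ### Adjoints, skewness and degrees -/

section Adjoint

variable {n : ℕ} {U : Opens (Fin n → ℝ)}

/-- An operator is determined by its bilinear densities modulo total derivatives. -/
theorem elim_act_injective {P Q : DiffOp U}
    (h : elim (act (freq U 1 + freq U 2) P 1) = elim (act (freq U 1 + freq U 2) Q 1)) : P = Q := by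
  have key : ∀ P : DiffOp U, elim (act (freq U 1 + freq U 2) P 1)
      = Polynomial.aeval (MvPolynomial.X 0 + MvPolynomial.X 1 : TriSymbol U) P := by
    intro P
    rw [act_one ((isFreq_X _).add (isFreq_X _)),
      ← elim_emb (Polynomial.aeval (MvPolynomial.X 0 + MvPolynomial.X 1 : TriSymbol U) P),
      ← Polynomial.aeval_algHom_apply (emb (freq U 1) (freq U 2)), map_add (emb _ _), emb_X0,
      emb_X1]
  have key2 : ∀ P : DiffOp U, MvPolynomial.aeval ![(Polynomial.X : DiffOp U), 0]
      (Polynomial.aeval (MvPolynomial.X 0 + MvPolynomial.X 1 : TriSymbol U) P) = P := by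
    intro P
    rw [← Polynomial.aeval_algHom_apply, map_add, MvPolynomial.aeval_X, MvPolynomial.aeval_X]
    simp
  rw [key, key] at h
  rw [← key2 P, h, key2]

theorem elim_act_opAdj (P : DiffOp U) :
    elim (act (freq U 1 + freq U 2) (opAdj P) 1) = elim (act (freq U 0) P 1) := by
  have := elim_mul_act (z := freq U 1 + freq U 2) (y := freq U 0) (by rw [totalFreq]; ring) P 1 1
  simpa using this.symm

theorem opAdj_opAdj (P : DiffOp U) : opAdj (opAdj P) = P := by
  refine elim_act_injective ?_
  have := elim_mul_act (y := freq U 1 + freq U 2) (z := freq U 0) (by rw [totalFreq]; ring) P 1 1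
  rw [elim_act_opAdj]
  simpa using this.symm

theorem opAdj_opComp (P Q : DiffOp U) : opAdj (opComp P Q) = opComp (opAdj Q) (opAdj P) := by
  refine elim_act_injective ?_
  have h : freq U 1 + freq U 2 + freq U 0 = totalFreq U := by rw [totalFreq]; ring
  have h1 := elim_mul_act h P 1 (act (freq U 0) Q 1)
  have h2 := elim_mul_act h Q (act (freq U 1 + freq U 2) (opAdj P) 1) 1
  rw [one_mul] at h1
  rw [mul_one] at h2
  rw [elim_act_opAdj, act_opComp, act_opComp, h1, h2]

theorem opAdj_evolOp (ξ : VField U) (P : DiffOp U) :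
    opAdj (evolOp ξ P) = evolOp ξ (opAdj P) := by
  refine elim_act_injective ?_
  rw [elim_act_opAdj, act_evolOp (isFreq_X _), act_evolOp ((isFreq_X _).add (isFreq_X _)),
    ← sub_eq_zero, ← map_sub, ← map_sub]
  have h := (elim_act_opAdj P).symm
  rw [← sub_eq_zero, ← map_sub] at h
  obtain ⟨V, hV⟩ := (elim_eq_zero_iff _).1 h
  rw [hV, evR_dFreq (((isFreq_X _).add (isFreq_X _)).add (isFreq_X _)), add_zero, elim_dFreq]

/-- The action of a vector field on the coefficients as an additive map. -/
def evolOpHom (ξ : VField U) : DiffOp U →+ DiffOp U where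
  toFun := evolOp ξ
  map_zero' := by simp [evolOp]
  map_add' P Q := Polynomial.sum_add_index P Q _ (by simp [evol_eq_evo])
    (by simp [evol_eq_evo])

theorem evolOp_neg (ξ : VField U) (P : DiffOp U) : evolOp ξ (-P) = -evolOp ξ P :=
  map_neg (evolOpHom ξ) P

theorem opComp_neg_left (P Q : DiffOp U) : opComp (-P) Q = -opComp P Q := by
  rw [opComp_eq, map_neg, opComp_eq]

theorem opComp_neg_right (P Q : DiffOp U) : opComp P (-Q) = -opComp P Q := by
  rw [← opAdj_opAdj (opComp P (-Q)), opAdj_opComp, opAdj_neg, opComp_neg_left, opAdj_neg,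
    ← opAdj_opComp, opAdj_opAdj]

theorem IsSkew.lieD {P : MatOp U} (hP : IsSkew P) (ξ : VField U) : IsSkew (lieD ξ P) := by
  intro i j
  rw [lieD_apply, lieD_apply, sub_eq_add_neg, sub_eq_add_neg, opAdj_add, opAdj_add, opAdj_evolOp,
    hP i j, evolOp_neg, ← Finset.sum_neg_distrib, ← Finset.sum_neg_distrib]
  have hs : ∀ f : Fin n → DiffOp U, opAdj (∑ k, f k) = ∑ k, opAdj (f k) :=
    fun f => map_sum opAdjHom f _
  have h1 : ∀ k, opAdj (-opComp (lin (ξ j) k) (P k i)) = opComp (P i k) (opAdj (lin (ξ j) k)) := by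
    intro k
    rw [opAdj_neg, opAdj_opComp, hP i k, opComp_neg_left, neg_neg]
  have h2 : ∀ k, opAdj (-opComp (P j k) (opAdj (lin (ξ i) k))) = opComp (lin (ξ i) k) (P k j) := by
    intro k
    rw [opAdj_neg, opAdj_opComp, opAdj_opAdj, hP k j, opComp_neg_right, neg_neg]
  rw [hs, hs]
  simp only [h1, h2]
  abel

theorem IsSkew.add {P Q : MatOp U} (hP : IsSkew P) (hQ : IsSkew Q) : IsSkew (P + Q) := by
  intro i j
  rw [Matrix.add_apply, Matrix.add_apply, opAdj_add, hP, hQ, neg_add]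

theorem IsSkew.neg {P : MatOp U} (hP : IsSkew P) : IsSkew (-P) := by
  intro i j
  rw [Matrix.neg_apply, Matrix.neg_apply, opAdj_neg, hP]

theorem opAdj_smul (c : ℝ) (P : DiffOp U) : opAdj (c • P) = c • opAdj P := by
  have h1 : ∀ P : DiffOp U, dxComp (c • P) = c • dxComp P := by
    intro P
    have : ∀ P : DiffOp U, c • P = (algebraMap ℝ (DiffPoly U) c) • P := fun P => by
      rw [algebraMap_smul]
    rw [this, dxComp_smul, ← totalDer_apply, Derivation.map_algebraMap, zero_smul, zero_add,
      ← this]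
  induction P using Polynomial.induction_on' with
  | add P Q hP hQ => rw [smul_add, opAdj_add, hP, hQ, opAdj_add, smul_add]
  | monomial m a =>
    rw [Polynomial.smul_monomial, opAdj_monomial, opAdj_monomial]
    induction m with
    | zero => simp [opFun, Polynomial.smul_C]
    | succ m ih =>
      rw [Function.iterate_succ_apply', Function.iterate_succ_apply', ih]
      change -dxComp _ = c • -dxComp _
      rw [h1, smul_neg]

theorem IsSkew.smul {P : MatOp U} (hP : IsSkew P) (c : ℝ) : IsSkew (c • P) := by
  intro i j
  rw [Matrix.smul_apply, Matrix.smul_apply, opAdj_smul, hP, smul_neg]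

theorem isSkew_zero : IsSkew (0 : MatOp U) := fun i j => by simp [opAdj_zero]

end Adjoint

section Degrees

variable {n : ℕ} {U : Opens (Fin n → ℝ)}

theorem hasDegree_C (c : SmoothFn U) : HasDegree (MvPolynomial.C c : DiffPoly U) 0 :=
  MvPolynomial.isWeightedHomogeneous_C _ _

theorem hasDegree_X (v : Fin n × ℕ) : HasDegree (MvPolynomial.X v : DiffPoly U) (v.2 + 1) :=
  MvPolynomial.isWeightedHomogeneous_X _ _ _

theorem hasDegree_zero (d : ℕ) : HasDegree (0 : DiffPoly U) d :=
  MvPolynomial.isWeightedHomogeneous_zero _ _ _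

theorem HasDegree.add {f g : DiffPoly U} {d : ℕ} (hf : HasDegree f d) (hg : HasDegree g d) :
    HasDegree (f + g) d := MvPolynomial.IsWeightedHomogeneous.add hf hg

theorem HasDegree.mul {f g : DiffPoly U} {d e : ℕ} (hf : HasDegree f d) (hg : HasDegree g e) :
    HasDegree (f * g) (d + e) := MvPolynomial.IsWeightedHomogeneous.mul hf hg

theorem HasDegree.smul {f : DiffPoly U} {d : ℕ} (hf : HasDegree f d) (c : ℝ) :
    HasDegree (c • f) d := by
  have h := HasDegree.mul (hasDegree_C (algebraMap ℝ (SmoothFn U) c)) hf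
  rw [zero_add] at h
  rwa [← algebraMap_smul (SmoothFn U), MvPolynomial.smul_eq_C_mul]

theorem HasDegree.neg {f : DiffPoly U} {d : ℕ} (hf : HasDegree f d) : HasDegree (-f) d := by
  have := hf.smul (-1)
  rwa [neg_one_smul] at this

theorem HasDegree.sub {f g : DiffPoly U} {d : ℕ} (hf : HasDegree f d) (hg : HasDegree g d) :
    HasDegree (f - g) d := by
  rw [sub_eq_add_neg]; exact hf.add hg.neg

/-- Homogeneous differential polynomials are built from functions by multiplication with jet
variables and addition. -/
theorem HasDegree.induction {M : ℕ → DiffPoly U → Prop} (h0 : ∀ d, M d 0)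
    (hC : ∀ c, M 0 (MvPolynomial.C c)) (hadd : ∀ d f g, M d f → M d g → M d (f + g))
    (hX : ∀ d f (v : Fin n × ℕ), M d f → HasDegree f d → M (d + (v.2 + 1)) (f * MvPolynomial.X v))
    {d : ℕ} {f : DiffPoly U} (hf : HasDegree f d) : M d f := by
  have hmon : ∀ m c, M (Finsupp.weight (fun v : Fin n × ℕ => v.2 + 1) m)
      (MvPolynomial.monomial m c) := by
    intro m c
    have : ∃ d, HasDegree (MvPolynomial.monomial m c) d ∧ M d (MvPolynomial.monomial m c) := by
      refine MvPolynomial.induction_on_monomial (motive := fun p => ∃ d, HasDegree p d ∧ M d p)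
        (fun c => ⟨0, hasDegree_C c, hC c⟩) (fun p v hp => ?_) m c
      obtain ⟨d, hd, hm⟩ := hp
      exact ⟨_, hd.mul (hasDegree_X v), hX d p v hm hd⟩
    obtain ⟨d, hd, hm⟩ := this
    by_cases hc : c = 0
    · subst hc; rw [map_zero]; exact h0 _
    · have := hd (d := m) (by simpa using hc)
      rwa [this]
  rw [MvPolynomial.as_sum f]
  refine Finset.sum_induction _ (M d) (hadd d) (h0 d) fun m hm => ?_
  have := hf (MvPolynomial.mem_support_iff.1 hm)
  rw [← this]
  exact hmon _ _

/-- An evolutionary derivation whose jets have the expected degrees shifts the degree. -/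
theorem evo_graded {B : Type*} [CommRing B] [Algebra (SmoothFn U) B]
    [Algebra (DiffPoly U) B] [Algebra ℝ B] [IsScalarTower (SmoothFn U) (DiffPoly U) B]
    [IsScalarTower ℝ (SmoothFn U) B] (G : ℕ → B → Prop) (h0 : ∀ d, G d 0)
    (hadd : ∀ d b c, G d b → G d c → G d (b + c))
    (hsmul : ∀ d e (a : DiffPoly U) b, HasDegree a d → G e b → G (d + e) (a • b))
    {w : Fin n → ℕ → B} {e : ℕ} (hw : ∀ k s, G (s + e) (w k s)) {d : ℕ} {f : DiffPoly U}
    (hf : HasDegree f d) : G (d + e) (evo w f) := by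
  refine HasDegree.induction (M := fun d f => G (d + e) (evo w f)) (fun d => by simpa using h0 _)
    (fun c => ?_) (fun d f g hf hg => by rw [map_add]; exact hadd _ _ _ hf hg)
    (fun d f v hm hd => ?_) hf
  · rw [evo_C]
    refine Finset.sum_induction _ (G (0 + e)) (hadd _) (h0 _) fun k _ => ?_
    rw [← algebraMap_func]
    have := hsmul _ _ _ _ (hasDegree_C (partialD k c)) (hw k 0)
    rwa [zero_add] at this
  · rw [Derivation.leibniz, evo_X]
    refine hadd _ _ _ ?_ ?_
    · have := hsmul _ _ _ _ hd (hw v.1 (v.2 + 1))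
      rwa [← add_assoc] at this
    · have := hsmul _ _ _ _ (hasDegree_X v) hm
      rwa [show v.2 + 1 + (d + e) = d + (v.2 + 1) + e by ring] at this

theorem hasDegree_jet (k : Fin n) (s : ℕ) : HasDegree (jet U k s) s := by
  cases s with
  | zero => exact hasDegree_C _
  | succ s => exact hasDegree_X (k, s)

theorem HasDegree.totalD {f : DiffPoly U} {d : ℕ} (hf : HasDegree f d) :
    HasDegree (totalD f) (d + 1) := by
  rw [← totalDer_apply]
  refine evo_graded (fun d f => HasDegree f d) hasDegree_zero (fun _ _ _ => HasDegree.add)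
    (fun _ _ _ _ => HasDegree.mul) (fun k s => hasDegree_jet k (s + 1)) hf

theorem HasDegree.iterate_totalD {f : DiffPoly U} {d : ℕ} (hf : HasDegree f d) (s : ℕ) :
    HasDegree (HydroDeform.totalD^[s] f) (s + d) := by
  induction s with
  | zero => simpa using hf
  | succ s ih =>
    rw [Function.iterate_succ_apply', add_right_comm]
    exact ih.totalD

theorem HasDegree.evol {f : DiffPoly U} {d e : ℕ} (hf : HasDegree f d) {ξ : VField U}
    (hξ : ∀ k, HasDegree (ξ k) e) : HasDegree (evol ξ f) (d + e) := by
  rw [evol_eq_evo]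
  exact evo_graded (fun d f => HasDegree f d) hasDegree_zero (fun _ _ _ => HasDegree.add)
    (fun _ _ _ _ => HasDegree.mul) (fun k s => (hξ k).iterate_totalD s) hf

/-- `P = ∑_m a_m d_x^m` with `a_m` of degree `d - m`. -/
def OpDegree (d : ℕ) (P : DiffOp U) : Prop :=
  ∀ m, (d < m → P.coeff m = 0) ∧ ∀ s, m + s = d → HasDegree (P.coeff m) s

theorem opDegree_zero (d : ℕ) : OpDegree d (0 : DiffOp U) :=
  fun m => ⟨fun _ => by simp, fun s _ => by simpa using hasDegree_zero s⟩

theorem OpDegree.add {d : ℕ} {P Q : DiffOp U} (hP : OpDegree d P) (hQ : OpDegree d Q) :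
    OpDegree d (P + Q) := fun m => ⟨fun h => by simp [(hP m).1 h, (hQ m).1 h],
      fun s h => by rw [Polynomial.coeff_add]; exact ((hP m).2 s h).add ((hQ m).2 s h)⟩

theorem OpDegree.neg {d : ℕ} {P : DiffOp U} (hP : OpDegree d P) : OpDegree d (-P) :=
  fun m => ⟨fun h => by simp [(hP m).1 h],
    fun s h => by rw [Polynomial.coeff_neg]; exact ((hP m).2 s h).neg⟩

theorem OpDegree.sub {d : ℕ} {P Q : DiffOp U} (hP : OpDegree d P) (hQ : OpDegree d Q) :
    OpDegree d (P - Q) := by rw [sub_eq_add_neg]; exact hP.add hQ.neg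

theorem OpDegree.smul {d : ℕ} {P : DiffOp U} (hP : OpDegree d P) (c : ℝ) : OpDegree d (c • P) :=
  fun m => ⟨fun h => by simp [(hP m).1 h],
    fun s h => by rw [Polynomial.coeff_smul]; exact ((hP m).2 s h).smul c⟩

theorem OpDegree.sum {ι : Type*} {S : Finset ι} {d : ℕ} {P : ι → DiffOp U}
    (hP : ∀ i ∈ S, OpDegree d (P i)) : OpDegree d (∑ i ∈ S, P i) :=
  Finset.sum_induction _ (OpDegree d) (fun _ _ => OpDegree.add) (opDegree_zero d) hP

theorem opDegree_monomial {d m s : ℕ} (h : m + s = d) {a : DiffPoly U} (ha : HasDegree a s) :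
    OpDegree d (Polynomial.monomial m a) := by
  intro m'
  rw [Polynomial.coeff_monomial]
  refine ⟨fun h' => if_neg (by omega), fun s' h' => ?_⟩
  split_ifs with hm
  · obtain rfl : s' = s := by omega
    exact ha
  · exact hasDegree_zero _

theorem OpDegree.induction {M : DiffOp U → Prop} (h0 : M 0) (hadd : ∀ P Q, M P → M Q → M (P + Q))
    {d : ℕ} (hmon : ∀ m s a, m + s = d → HasDegree a s → M (Polynomial.monomial m a))
    {P : DiffOp U} (hP : OpDegree d P) : M P := by
  rw [Polynomial.as_sum_support P]
  refine Finset.sum_induction _ M hadd h0 fun m hm => ?_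
  have h := Polynomial.mem_support_iff.1 hm
  obtain ⟨s, hs⟩ : ∃ s, d = m + s := Nat.exists_eq_add_of_le (by
    by_contra hc
    exact h ((hP m).1 (by omega)))
  exact hmon m s _ hs.symm ((hP m).2 s hs.symm)

theorem OpDegree.smul_poly {d e : ℕ} {P : DiffOp U} (hP : OpDegree d P) {a : DiffPoly U}
    (ha : HasDegree a e) : OpDegree (e + d) (a • P) := by
  refine OpDegree.induction (M := fun P => OpDegree (e + d) (a • P)) (by simpa using opDegree_zero _)
    (fun P Q hP hQ => by rw [smul_add]; exact hP.add hQ) (fun m s b h hb => ?_) hP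
  rw [Polynomial.smul_monomial]
  exact opDegree_monomial (by omega) (ha.mul hb)

theorem OpDegree.dxComp {d : ℕ} {P : DiffOp U} (hP : OpDegree d P) :
    OpDegree (d + 1) (dxComp P) := by
  refine OpDegree.induction (M := fun P => OpDegree (d + 1) (HydroDeform.dxComp P))
    (by simpa [← dxCompHom_apply] using opDegree_zero _)
    (fun P Q hP hQ => by rw [dxComp_add]; exact hP.add hQ) (fun m s b h hb => ?_) hP
  rw [dxComp_monomial]
  exact (opDegree_monomial (by omega) hb.totalD).add (opDegree_monomial (by omega) hb)

theorem OpDegree.opComp {d e : ℕ} {P Q : DiffOp U} (hP : OpDegree d P) (hQ : OpDegree e Q) :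
    OpDegree (d + e) (opComp P Q) := by
  rw [opComp_eq]
  refine OpDegree.induction (M := fun P => OpDegree (d + e) (seqMap _ P))
    (by simpa using opDegree_zero _)
    (fun P Q hP hQ => by rw [map_add]; exact hP.add hQ) (fun m s b h hb => ?_) hP
  rw [seqMap_monomial]
  have : OpDegree (e + m) (HydroDeform.dxComp^[m] Q) := by
    clear h
    induction m with
    | zero => exact hQ
    | succ m ih => rw [Function.iterate_succ_apply']; exact ih.dxComp
  have h2 := this.smul_poly hb
  rwa [show s + (e + m) = d + e by omega] at h2

theorem OpDegree.opAdj {d : ℕ} {P : DiffOp U} (hP : OpDegree d P) : OpDegree d (opAdj P) := by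
  refine OpDegree.induction (M := fun P => OpDegree d (HydroDeform.opAdj P))
    (by simpa [opAdj_zero] using opDegree_zero _)
    (fun P Q hP hQ => by rw [opAdj_add]; exact hP.add hQ) (fun m s b h hb => ?_) hP
  rw [opAdj_monomial]
  have : OpDegree (s + m) ((-dxCompHom : DiffOp U →+ DiffOp U)^[m] (opFun b)) := by
    clear h
    induction m with
    | zero => exact opDegree_monomial (m := 0) (by omega) hb
    | succ m ih => rw [Function.iterate_succ_apply']; exact ih.dxComp.neg
  rwa [show s + m = d by omega] at this

theorem HasDegree.lin {f : DiffPoly U} {d : ℕ} (hf : HasDegree f d) (k : Fin n) :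
    OpDegree d (lin f k) := by
  rw [lin_eq_evo]
  refine evo_graded (fun d P => OpDegree d P) opDegree_zero (fun _ _ _ => OpDegree.add)
    (fun _ _ _ _ ha hb => hb.smul_poly ha) (e := 0) (fun k' s => ?_) hf
  split_ifs
  · rw [← Polynomial.monomial_one_right_eq_X_pow]
    exact opDegree_monomial (by omega) (hasDegree_C 1)
  · exact opDegree_zero _

theorem OpDegree.evolOp {d e : ℕ} {P : DiffOp U} (hP : OpDegree d P) {ξ : VField U}
    (hξ : ∀ k, HasDegree (ξ k) e) : OpDegree (d + e) (evolOp ξ P) := by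
  refine OpDegree.induction (M := fun P => OpDegree (d + e) (evolOpHom ξ P))
    (by simpa using opDegree_zero _)
    (fun P Q hP hQ => by rw [map_add]; exact hP.add hQ) (fun m s b h hb => ?_) hP
  change OpDegree _ ((Polynomial.monomial m b).sum
    fun m a => Polynomial.monomial m (HydroDeform.evol ξ a))
  rw [Polynomial.sum_monomial_index b (fun m a => Polynomial.monomial m (HydroDeform.evol ξ a))
    (by simp [evol_eq_evo])]
  exact opDegree_monomial (by omega) (hb.evol hξ)

theorem hasOpDegree_iff {P : MatOp U} {d : ℕ} : HasOpDegree P d ↔ ∀ i j, OpDegree d (P i j) := by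
  refine forall_congr' fun i => forall_congr' fun j => ⟨fun h m => ⟨h.1 m, fun s hs => ?_⟩,
    fun h => ⟨fun m => (h m).1, fun s hs => (h _).2 s (by omega)⟩⟩
  have := h.2 s (by omega)
  rwa [show d - s = m by omega] at this

theorem HasOpDegree.lieD {P : MatOp U} {d e : ℕ} (hP : HasOpDegree P d) {ξ : VField U}
    (hξ : ∀ k, HasDegree (ξ k) e) : HasOpDegree (lieD ξ P) (d + e) := by
  rw [hasOpDegree_iff] at hP ⊢
  intro i j
  rw [lieD_apply]
  refine (((hP i j).evolOp hξ).sub (OpDegree.sum fun k _ => ?_)).sub (OpDegree.sum fun k _ => ?_)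
  · rw [add_comm]; exact ((hξ i).lin k).opComp (hP k j)
  · exact (hP i k).opComp ((hξ j).lin k).opAdj

theorem HasOpDegree.add {P Q : MatOp U} {d : ℕ} (hP : HasOpDegree P d) (hQ : HasOpDegree Q d) :
    HasOpDegree (P + Q) d := by
  rw [hasOpDegree_iff] at *
  exact fun i j => (hP i j).add (hQ i j)

theorem HasOpDegree.neg {P : MatOp U} {d : ℕ} (hP : HasOpDegree P d) : HasOpDegree (-P) d := by
  rw [hasOpDegree_iff] at *
  exact fun i j => (hP i j).neg

theorem HasOpDegree.smul {P : MatOp U} {d : ℕ} (hP : HasOpDegree P d) (c : ℝ) :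
    HasOpDegree (c • P) d := by
  rw [hasOpDegree_iff] at *
  exact fun i j => (hP i j).smul c

theorem hasOpDegree_zero (d : ℕ) : HasOpDegree (0 : MatOp U) d :=
  hasOpDegree_iff.2 fun _ _ => opDegree_zero d

end Degrees

/-! ### Antiderivatives of smooth functions -/

section Antiderivative

open MeasureTheory intervalIntegral Set Filter
open scoped Interval

variable {n : ℕ} {U : Opens (Fin n → ℝ)}

/-- The point `x` with the `k`-th coordinate contracted to `c` by the factor `s`. -/
def contractAt (k : Fin n) (c : ℝ) (s : ℝ) (x : Fin n → ℝ) : Fin n → ℝ :=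
  Function.update x k (c + s * (x k - c))

/-- The linear part of `contractAt`. -/
def contractLin (k : Fin n) (s : ℝ) : (Fin n → ℝ) →L[ℝ] (Fin n → ℝ) :=
  ContinuousLinearMap.pi fun l =>
    if l = k then s • ContinuousLinearMap.proj l else ContinuousLinearMap.proj l

theorem hasFDerivAt_contractAt (k : Fin n) (c s : ℝ) (x : Fin n → ℝ) :
    HasFDerivAt (contractAt k c s) (contractLin k s) x := by
  rw [hasFDerivAt_pi']
  intro l
  by_cases h : l = k
  · subst h
    have h1 : HasFDerivAt (fun x : Fin n → ℝ => c + s * (x l - c))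
        (s • ContinuousLinearMap.proj (R := ℝ) (φ := fun _ : Fin n => ℝ) l) x :=
      (((ContinuousLinearMap.proj (R := ℝ) (φ := fun _ : Fin n => ℝ) l).hasFDerivAt.sub_const
        c).const_mul s).const_add c
    have e1 : (fun y => contractAt l c s y l) = fun y : Fin n → ℝ => c + s * (y l - c) := by
      ext y; simp [contractAt]
    have e2 : (ContinuousLinearMap.proj (R := ℝ) (φ := fun _ : Fin n => ℝ) l).comp
        (contractLin l s) = s • ContinuousLinearMap.proj (R := ℝ) (φ := fun _ : Fin n => ℝ) l := by
      ext v; simp [contractLin]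
    rw [e1, e2]
    exact h1
  · have h1 := (ContinuousLinearMap.proj (R := ℝ) (φ := fun _ : Fin n => ℝ) l).hasFDerivAt (x := x)
    have e1 : (fun y => contractAt k c s y l) = fun y : Fin n → ℝ => y l := by
      ext y; simp [contractAt, h]
    have e2 : (ContinuousLinearMap.proj (R := ℝ) (φ := fun _ : Fin n => ℝ) l).comp
        (contractLin k s) = ContinuousLinearMap.proj (R := ℝ) (φ := fun _ : Fin n => ℝ) l := by
      ext v; simp [contractLin, h]
    rw [e1, e2]
    exact h1

theorem continuous_contractAt (k : Fin n) (c : ℝ) :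
    Continuous fun z : (Fin n → ℝ) × ℝ => contractAt k c z.2 z.1 := by
  unfold contractAt
  exact Continuous.update continuous_fst k (by fun_prop)

theorem continuous_contractLin (k : Fin n) : Continuous (contractLin (n := n) k) := by
  have : contractLin (n := n) k = fun s => s • contractLin k 1 + (1 - s) • contractLin k 0 := by
    ext s v l
    by_cases h : l = k
    · simp [contractLin, h]
    · simp [contractLin, h]; ring
  rw [this]
  fun_prop

theorem contractLin_single (k l : Fin n) (s : ℝ) : contractLin k s (Pi.single l 1)
    = (if l = k then s else 1) • (Pi.single l 1 : Fin n → ℝ) := by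
  ext m
  by_cases h : m = l
  · subst h
    by_cases h' : m = k <;> simp [contractLin, h']
  · have h0 : (Pi.single l 1 : Fin n → ℝ) m = 0 := Pi.single_eq_of_ne h 1
    by_cases h' : m = k
    · subst h'
      simp [contractLin, h0]
    · simp [contractLin, h', h0]

variable {k : Fin n} {c : ℝ}

/-- Differentiation under the integral sign for `∫₀¹ s^j f (contractAt k c s x) ds`. -/
theorem hasFDerivAt_contraction_integral
    (hU : ∀ x ∈ U, ∀ s ∈ Icc (0 : ℝ) 1, contractAt k c s x ∈ U) (j : ℕ)
    {f : (Fin n → ℝ) → ℝ} (hf : ContDiffOn ℝ ∞ f U) {x : Fin n → ℝ} (hx : x ∈ U) :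
    HasFDerivAt (fun x => ∫ s in (0 : ℝ)..1, s ^ j * f (contractAt k c s x))
      (∫ s in (0 : ℝ)..1, s ^ j • (fderiv ℝ f (contractAt k c s x)).comp (contractLin k s)) x := by
  obtain ⟨ε, hε, hball⟩ := Metric.isOpen_iff.1 U.isOpen x hx
  have hK : Metric.closedBall x (ε / 2) ⊆ U :=
    (Metric.closedBall_subset_ball (by linarith)).trans hball
  have hmap : MapsTo (fun z : (Fin n → ℝ) × ℝ => contractAt k c z.2 z.1)
      ((U : Set (Fin n → ℝ)) ×ˢ Icc (0 : ℝ) 1) U := fun z hz => hU z.1 hz.1 z.2 hz.2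
  have hF : ContinuousOn (fun z : (Fin n → ℝ) × ℝ => z.2 ^ j * f (contractAt k c z.2 z.1))
      ((U : Set (Fin n → ℝ)) ×ˢ Icc (0 : ℝ) 1) :=
    (continuous_snd.pow j).continuousOn.mul
      (hf.continuousOn.comp (continuous_contractAt k c).continuousOn hmap)
  have hF' : ContinuousOn (fun z : (Fin n → ℝ) × ℝ =>
      z.2 ^ j • (fderiv ℝ f (contractAt k c z.2 z.1)).comp (contractLin k z.2))
      ((U : Set (Fin n → ℝ)) ×ˢ Icc (0 : ℝ) 1) := by
    refine (continuous_snd.pow j).continuousOn.smul (ContinuousOn.clm_comp ?_ ?_)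
    · exact (hf.continuousOn_fderiv_of_isOpen U.isOpen (by simp)).comp
        (continuous_contractAt k c).continuousOn hmap
    · exact ((continuous_contractLin k).comp continuous_snd).continuousOn
  have hslice : ∀ y ∈ U, MapsTo (fun s : ℝ => (y, s)) (Icc (0 : ℝ) 1)
      ((U : Set (Fin n → ℝ)) ×ˢ Icc (0 : ℝ) 1) := fun y hy s hs => ⟨hy, hs⟩
  have hcF : ∀ y ∈ U, ContinuousOn (fun s => s ^ j * f (contractAt k c s y)) (Icc 0 1) :=
    fun y hy => hF.comp (by fun_prop) (hslice y hy)
  have hcF' : ∀ y ∈ U, ContinuousOn (fun s =>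
      s ^ j • (fderiv ℝ f (contractAt k c s y)).comp (contractLin k s)) (Icc 0 1) :=
    fun y hy => hF'.comp (by fun_prop) (hslice y hy)
  have huIoc : Ι (0 : ℝ) 1 = Ioc 0 1 := uIoc_of_le zero_le_one
  obtain ⟨C, hC⟩ := ((isCompact_closedBall x (ε / 2)).prod isCompact_Icc).exists_bound_of_continuousOn
    (hF'.mono (prod_mono hK subset_rfl))
  refine hasFDerivAt_integral_of_dominated_of_fderiv_le
    (F := fun y s => s ^ j * f (contractAt k c s y))
    (F' := fun y s => s ^ j • (fderiv ℝ f (contractAt k c s y)).comp (contractLin k s))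
    (bound := fun _ => C)
    (s := Metric.ball x (ε / 2)) (Metric.ball_mem_nhds x (by linarith)) ?_ ?_ ?_ ?_ ?_ ?_
  · filter_upwards [U.isOpen.mem_nhds hx] with y hy
    rw [huIoc]
    exact ((hcF y hy).mono Ioc_subset_Icc_self).aestronglyMeasurable measurableSet_Ioc
  · exact ContinuousOn.intervalIntegrable (by rw [uIcc_of_le zero_le_one]; exact hcF x hx)
  · rw [huIoc]
    exact ((hcF' x hx).mono Ioc_subset_Icc_self).aestronglyMeasurable measurableSet_Ioc
  · refine Eventually.of_forall fun s hs y hy => hC (y, s) ⟨Metric.ball_subset_closedBall hy, ?_⟩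
    rw [huIoc] at hs
    exact Ioc_subset_Icc_self hs
  · exact intervalIntegrable_const
  · refine Eventually.of_forall fun s hs y hy => ?_
    rw [huIoc] at hs
    have hyU := hU y (hK (Metric.ball_subset_closedBall hy)) s (Ioc_subset_Icc_self hs)
    have hd : DifferentiableAt ℝ f (contractAt k c s y) :=
      (hf.contDiffAt (U.isOpen.mem_nhds hyU)).differentiableAt (by simp)
    exact (hd.hasFDerivAt.comp y (hasFDerivAt_contractAt k c s y)).const_mul _

/-- Weighted averages of a smooth function over the contractions are smooth. -/
theorem contDiffOn_contraction_integral
    (hU : ∀ x ∈ U, ∀ s ∈ Icc (0 : ℝ) 1, contractAt k c s x ∈ U) (m : ℕ) :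
    ∀ (j : ℕ) {f : (Fin n → ℝ) → ℝ}, ContDiffOn ℝ ∞ f U →
      ContDiffOn ℝ m (fun x => ∫ s in (0 : ℝ)..1, s ^ j * f (contractAt k c s x)) U := by
  induction m with
  | zero =>
    intro j f hf
    refine contDiffOn_zero.2 fun x hx => ?_
    exact (hasFDerivAt_contraction_integral hU j hf hx).continuousAt.continuousWithinAt
  | succ m ih =>
    intro j f hf
    have hcast : ((m + 1 : ℕ) : WithTop ℕ∞) = (m : WithTop ℕ∞) + 1 := by push_cast; rfl
    rw [hcast, contDiffOn_succ_iff_fderiv_of_isOpen U.isOpen]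
    refine ⟨fun x hx => (hasFDerivAt_contraction_integral hU j hf hx).differentiableAt.differentiableWithinAt,
      by simp, ?_⟩
    rw [contDiffOn_clm_apply]
    intro v
    have hv : v = ∑ l, v l • (Pi.single l 1 : Fin n → ℝ) := by
      ext i; simp [Finset.sum_apply, Pi.single_apply]
    have hl : ∀ l, ContDiffOn ℝ m (fun x => fderiv ℝ (fun x => ∫ s in (0 : ℝ)..1,
        s ^ j * f (contractAt k c s x)) x (Pi.single l 1)) U := by
      intro l
      have hfl : ContDiffOn ℝ ∞ (fun x => fderiv ℝ f x (Pi.single l 1)) U :=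
        (hf.fderiv_of_isOpen U.isOpen (by simp)).clm_apply contDiffOn_const
      refine (ih (if l = k then j + 1 else j) hfl).congr fun x hx => ?_
      have hint : IntervalIntegrable (fun s =>
          s ^ j • (fderiv ℝ f (contractAt k c s x)).comp (contractLin k s)) volume 0 1 := by
        refine ContinuousOn.intervalIntegrable ?_
        rw [uIcc_of_le zero_le_one]
        refine (continuous_id.pow j).continuousOn.smul (ContinuousOn.clm_comp ?_ ?_)
        · refine (hf.continuousOn_fderiv_of_isOpen U.isOpen (by simp)).comp ?_ (hU x hx)
          exact ((continuous_contractAt k c).comp (Continuous.prodMk_right x)).continuousOn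
        · exact (continuous_contractLin k).continuousOn
      rw [(hasFDerivAt_contraction_integral hU j hf hx).fderiv,
        ContinuousLinearMap.intervalIntegral_apply hint]
      refine integral_congr fun s _ => ?_
      simp only [_root_.smul_apply, ContinuousLinearMap.comp_apply,
        contractLin_single, map_smul, smul_eq_mul]
      split_ifs
      · ring
      · ring
    rw [hv]
    simp only [map_sum, map_smul, smul_eq_mul]
    exact ContDiffOn.sum fun l _ => contDiffOn_const.mul (hl l)

theorem extendZero_apply (f : SmoothFn U) (x : U) : extendZero U f.1 x.1 = f.1 x :=
  extendZero_of_mem U f.1 x.2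

theorem hasFDerivAt_extendZero (f : SmoothFn U) (x : U) :
    HasFDerivAt (extendZero U f.1) (fderiv ℝ (extendZero U f.1) x.1) x.1 :=
  (f.differentiableAt x.2).hasFDerivAt

theorem hasDerivAt_extendZero_update (f : SmoothFn U) (x : U) (k : Fin n) :
    HasDerivAt (fun t => extendZero U f.1 (Function.update x.1 k t)) ((partialD k f).1 x) (x.1 k) := by
  have h1 : HasFDerivAt (extendZero U f.1) (fderiv ℝ (extendZero U f.1) x.1)
      (Function.update x.1 k (x.1 k)) := by
    rw [Function.update_eq_self]; exact hasFDerivAt_extendZero f x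
  exact h1.comp_hasDerivAt (x.1 k) (hasDerivAt_update x.1 k (x.1 k))

/-- Smooth functions have smooth antiderivatives in the `k`-th coordinate, when the domain can be
contracted in this coordinate. -/
theorem exists_antiderivative (hU : ∀ x ∈ U, ∀ s ∈ Icc (0 : ℝ) 1, contractAt k c s x ∈ U)
    (f : SmoothFn U) : ∃ F : SmoothFn U, partialD k F = f ∧
      ∀ x, F.1 x = ∫ t in c..(x.1 k), extendZero U f.1 (Function.update x.1 k t) := by
  have hF : ∀ x : Fin n → ℝ, (∫ t in c..(x k), extendZero U f.1 (Function.update x k t))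
      = (x k - c) * ∫ s in (0 : ℝ)..1, s ^ 0 * extendZero U f.1 (contractAt k c s x) := by
    intro x
    have := intervalIntegral.smul_integral_comp_add_mul
      (fun t => extendZero U f.1 (Function.update x k t)) (x k - c) c (a := 0) (b := 1)
    simp only [mul_zero, add_zero, mul_one, add_sub_cancel, smul_eq_mul] at this
    rw [← this]
    congr 1
    refine integral_congr fun s _ => ?_
    simp [contractAt, mul_comm]
  let F : SmoothFn U := ⟨fun x => ∫ t in c..(x.1 k), extendZero U f.1 (Function.update x.1 k t), by
    have h1 : ContDiffOn ℝ ∞ (fun x : Fin n → ℝ => (x k - c) *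
        ∫ s in (0 : ℝ)..1, s ^ 0 * extendZero U f.1 (contractAt k c s x)) U :=
      ((contDiff_apply ℝ ℝ k).contDiffOn.sub contDiffOn_const).mul
        (contDiffOn_infty.2 fun m => contDiffOn_contraction_integral hU m 0 f.contDiffOn)
    refine h1.congr fun x hx => ?_
    rw [extendZero_of_mem U _ hx, ← hF]⟩
  refine ⟨F, Subtype.ext (funext fun x => ?_), fun x => rfl⟩
  have hline : Continuous fun t => Function.update x.1 k t :=
    continuous_const.update k continuous_id
  have hopen : IsOpen ((fun t => Function.update x.1 k t) ⁻¹' (U : Set (Fin n → ℝ))) :=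
    U.isOpen.preimage hline
  have hxk : x.1 k ∈ (fun t => Function.update x.1 k t) ⁻¹' (U : Set (Fin n → ℝ)) := by
    simp
  have hcont : ContinuousOn (fun t => extendZero U f.1 (Function.update x.1 k t))
      ((fun t => Function.update x.1 k t) ⁻¹' (U : Set (Fin n → ℝ))) :=
    f.contDiffOn.continuousOn.comp hline.continuousOn fun t ht => ht
  have hseg : uIcc c (x.1 k) ⊆ (fun t => Function.update x.1 k t) ⁻¹' (U : Set (Fin n → ℝ)) := by
    intro t ht
    rw [← segment_eq_uIcc, segment_eq_image'] at ht
    obtain ⟨s, hs, rfl⟩ := ht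
    exact hU x.1 x.2 s hs
  have h1 : HasDerivAt (fun b => ∫ t in c..b, extendZero U f.1 (Function.update x.1 k t))
      (extendZero U f.1 (Function.update x.1 k (x.1 k))) (x.1 k) :=
    integral_hasDerivAt_right (hcont.mono hseg).intervalIntegrable
      (hcont.stronglyMeasurableAtFilter hopen _ hxk) (hcont.continuousAt (hopen.mem_nhds hxk))
  have h2 := hasDerivAt_extendZero_update F x k
  have h3 : (fun t => extendZero U F.1 (Function.update x.1 k t)) =ᶠ[nhds (x.1 k)]
      fun b => ∫ t in c..b, extendZero U f.1 (Function.update x.1 k t) := by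
    filter_upwards [hopen.mem_nhds hxk] with b hb
    rw [extendZero_of_mem U _ hb]
    simp [F]
  have h4 := h2.unique (h1.congr_of_eventuallyEq h3)
  rw [h4, Function.update_eq_self, extendZero_apply]

end Antiderivative

/-! ### Smooth functions on a box -/

section Box

variable {n : ℕ}

/-- Composition of a smooth function with a function on `ℝ` that is smooth at its values. -/
def SmoothFn.comp {U : Opens (Fin n → ℝ)} (φ : ℝ → ℝ) (f : SmoothFn U)
    (hφ : ∀ x : U, ContDiffAt ℝ ∞ φ (f.1 x)) : SmoothFn U :=
  ⟨fun x => φ (f.1 x), by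
    have h : ContDiffOn ℝ ∞ (fun x => φ (extendZero U f.1 x)) U := by
      intro x hx
      have h1 := hφ ⟨x, hx⟩
      rw [← extendZero_of_mem U f.1 hx] at h1
      exact ContDiffAt.comp_contDiffWithinAt x h1 (f.contDiffOn x hx)
    refine h.congr fun x hx => ?_
    have hx' : x ∈ U := hx
    simp [extendZero_of_mem U _ hx']⟩

theorem SmoothFn.ext' {U : Opens (Fin n → ℝ)} {f g : SmoothFn U} (h : ∀ x, f.1 x = g.1 x) :
    f = g := Subtype.ext (funext h)

theorem partialD_comp {U : Opens (Fin n → ℝ)} (φ φ' : ℝ → ℝ) (f : SmoothFn U)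
    (hφ : ∀ x : U, ContDiffAt ℝ ∞ φ (f.1 x)) (k : Fin n) (x : U)
    (h' : HasDerivAt φ (φ' (f.1 x)) (f.1 x)) :
    (partialD k (f.comp φ hφ)).1 x = φ' (f.1 x) * (partialD k f).1 x := by
  have h1 := hasDerivAt_extendZero_update (f.comp φ hφ) x k
  have h2 := hasDerivAt_extendZero_update f x k
  have e0 : extendZero U f.1 (Function.update x.1 k (x.1 k)) = f.1 x := by
    rw [Function.update_eq_self, extendZero_apply]
  have h3 : HasDerivAt (fun t => φ (extendZero U f.1 (Function.update x.1 k t)))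
      (φ' (f.1 x) * (partialD k f).1 x) (x.1 k) := by
    rw [← e0] at h'
    have := HasDerivAt.comp (x.1 k) h' h2
    rw [e0] at this
    exact this
  refine h1.unique (h3.congr_of_eventuallyEq ?_)
  have hline : Continuous fun t => Function.update x.1 k t :=
    continuous_const.update k continuous_id
  have hxk : x.1 k ∈ (fun t => Function.update x.1 k t) ⁻¹' (U : Set (Fin n → ℝ)) := by simp
  filter_upwards [(U.isOpen.preimage hline).mem_nhds hxk] with t ht
  rw [extendZero_of_mem U _ ht, extendZero_of_mem U _ ht]
  rfl

/-- The exponential of a smooth function. -/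
def expFn {U : Opens (Fin n → ℝ)} (f : SmoothFn U) : SmoothFn U :=
  f.comp Real.exp fun _ => Real.contDiff_exp.contDiffAt

theorem partialD_expFn {U : Opens (Fin n → ℝ)} (f : SmoothFn U) (k : Fin n) :
    partialD k (expFn f) = expFn f * partialD k f :=
  SmoothFn.ext' fun x => partialD_comp Real.exp Real.exp f _ k x (Real.hasDerivAt_exp _)

theorem expFn_mul_neg {U : Opens (Fin n → ℝ)} (f : SmoothFn U) : expFn f * expFn (-f) = 1 :=
  SmoothFn.ext' fun x => by
    change Real.exp (f.1 x) * Real.exp (-(f.1 x)) = 1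
    rw [← Real.exp_add, add_neg_cancel, Real.exp_zero]

/-- A smooth function without zeros has a smooth reciprocal. -/
theorem exists_inverse {U : Opens (Fin n → ℝ)} (f : SmoothFn U) (hf : ∀ x, f.1 x ≠ 0) :
    ∃ g : SmoothFn U, f * g = 1 :=
  ⟨f.comp (fun t => t⁻¹) fun x => contDiffAt_inv ℝ (hf x),
    SmoothFn.ext' fun x => mul_inv_cancel₀ (hf x)⟩

theorem partialD_coord {U : Opens (Fin n → ℝ)} (j k : Fin n) :
    partialD j (coord U k) = if k = j then 1 else 0 := by
  refine SmoothFn.ext' fun x => ?_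
  have h1 := (extendZero_eventuallyEq (coord U k).1 (fun y => y k) (fun y => rfl)
    x.2).fderiv_eq (𝕜 := ℝ)
  change fderiv ℝ (extendZero U (coord U k).1) x.1 (Pi.single j 1) = _
  rw [h1, (hasFDerivAt_apply k x.1).fderiv]
  by_cases h : k = j
  · subst h; simp; rfl
  · simp [h]; rfl

/-- The open set `U` of the plane is a product of two intervals. -/
def IsBox (U : Opens (Fin 2 → ℝ)) : Prop :=
  ∃ I J : Set ℝ, I.OrdConnected ∧ J.OrdConnected ∧ ∀ u, u ∈ U ↔ u 0 ∈ I ∧ u 1 ∈ J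

variable {U : Opens (Fin 2 → ℝ)}

theorem IsBox.update_mem (hU : IsBox U) (k : Fin 2) {x y : Fin 2 → ℝ} (hx : x ∈ U) (hy : y ∈ U)
    {t : ℝ} (ht : t ∈ Set.uIcc (y k) (x k)) : Function.update x k t ∈ U := by
  obtain ⟨I, J, hI, hJ, h⟩ := hU
  rw [h] at hx hy ⊢
  fin_cases k
  · exact ⟨by simpa using hI.uIcc_subset hy.1 hx.1 ht, by simpa using hx.2⟩
  · exact ⟨by simpa using hx.1, by simpa using hJ.uIcc_subset hy.2 hx.2 ht⟩

theorem IsBox.contractAt_mem (hU : IsBox U) (k : Fin 2) {y : Fin 2 → ℝ} (hy : y ∈ U) :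
    ∀ x ∈ U, ∀ s ∈ Set.Icc (0 : ℝ) 1, contractAt k (y k) s x ∈ U := by
  intro x hx s hs
  refine hU.update_mem k hx hy ?_
  rw [← segment_eq_uIcc, segment_eq_image']
  exact ⟨s, hs, rfl⟩

/-- On a box, smooth functions have antiderivatives in each coordinate. -/
theorem IsBox.exists_partialD_eq (hU : IsBox U) (k : Fin 2) (f : SmoothFn U) :
    ∃ F : SmoothFn U, partialD k F = f := by
  by_cases hne : Nonempty U
  · obtain ⟨y⟩ := hne
    obtain ⟨F, hF, -⟩ := exists_antiderivative (hU.contractAt_mem k y.2) f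
    exact ⟨F, hF⟩
  · exact ⟨0, SmoothFn.ext' fun x => (hne ⟨x⟩).elim⟩

theorem IsBox.exists_fnOfU2_partialD_eq (hU : IsBox U) {f : SmoothFn U} (hf : FnOfU2 f) :
    ∃ F : SmoothFn U, FnOfU2 F ∧ partialD 1 F = f := by
  by_cases hne : Nonempty U
  · obtain ⟨y⟩ := hne
    obtain ⟨F, hF, hF'⟩ := exists_antiderivative (hU.contractAt_mem 1 y.2) f
    refine ⟨F, fun a b hab => ?_, hF⟩
    rw [hF', hF', hab]
    refine intervalIntegral.integral_congr fun t ht => ?_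
    have h1 : Function.update a.1 1 t ∈ U := hU.update_mem 1 a.2 y.2 (by rwa [hab])
    have h2 : Function.update b.1 1 t ∈ U := hU.update_mem 1 b.2 y.2 ht
    rw [extendZero_of_mem U _ h1, extendZero_of_mem U _ h2]
    exact hf _ _ (by simp)
  · exact ⟨0, fun x => (hne ⟨x⟩).elim, SmoothFn.ext' fun x => (hne ⟨x⟩).elim⟩

/-- On a box, a function with vanishing `u^1`-derivative depends on `u^2` only. -/
theorem IsBox.fnOfU2_of_partialD (hU : IsBox U) {f : SmoothFn U} (hf : partialD 0 f = 0) :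
    FnOfU2 f := by
  intro x y hxy
  have hmem : ∀ t ∈ Set.uIcc (x.1 0) (y.1 0), Function.update y.1 0 t ∈ U := fun t ht =>
    hU.update_mem 0 y.2 x.2 ht
  have hd : ∀ t ∈ Set.uIcc (x.1 0) (y.1 0), HasDerivWithinAt
      (fun t => extendZero U f.1 (Function.update y.1 0 t)) ((fun _ => (0 : ℝ)) t)
      (Set.uIcc (x.1 0) (y.1 0)) t := by
    intro t ht
    have := hasDerivAt_extendZero_update f ⟨Function.update y.1 0 t, hmem t ht⟩ 0
    simp only [Function.update_idem, Function.update_self, hf] at this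
    exact this.hasDerivWithinAt
  have h := Convex.norm_image_sub_le_of_norm_hasDerivWithin_le (C := 0) hd (by simp)
    (convex_uIcc _ _) Set.left_mem_uIcc Set.right_mem_uIcc
  simp only [zero_mul, norm_le_zero_iff, sub_eq_zero, Function.update_eq_self,
    extendZero_apply] at h
  have e : Function.update y.1 0 (x.1 0) = x.1 := by
    ext l
    fin_cases l
    · simp
    · simpa using hxy.symm
  rw [e, extendZero_apply] at h
  exact h.symm

theorem FnOfU2.partialD {f : SmoothFn U} (hf : FnOfU2 f) : partialD 0 f = 0 := by
  refine SmoothFn.ext' fun x => ?_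
  have h1 := hasDerivAt_extendZero_update f x 0
  refine h1.unique ((hasDerivAt_const (x.1 0) (f.1 x)).congr_of_eventuallyEq ?_)
  have hline : Continuous fun t => Function.update x.1 0 t :=
    continuous_const.update 0 continuous_id
  have hxk : x.1 0 ∈ (fun t => Function.update x.1 0 t) ⁻¹' (U : Set (Fin 2 → ℝ)) := by simp
  filter_upwards [(U.isOpen.preimage hline).mem_nhds hxk] with t ht
  rw [extendZero_of_mem U _ ht]
  exact hf _ _ (by simp)

theorem IsBox.fnOfU2_iff (hU : IsBox U) {f : SmoothFn U} : FnOfU2 f ↔ HydroDeform.partialD 0 f = 0 :=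
  ⟨FnOfU2.partialD, hU.fnOfU2_of_partialD⟩

theorem FnOfU2.zero : FnOfU2 (0 : SmoothFn U) := fun _ _ _ => rfl

theorem FnOfU2.add {f g : SmoothFn U} (hf : FnOfU2 f) (hg : FnOfU2 g) : FnOfU2 (f + g) :=
  fun x y h => congrArg₂ (· + ·) (hf x y h) (hg x y h)

theorem FnOfU2.mul {f g : SmoothFn U} (hf : FnOfU2 f) (hg : FnOfU2 g) : FnOfU2 (f * g) :=
  fun x y h => congrArg₂ (· * ·) (hf x y h) (hg x y h)

theorem FnOfU2.neg {f : SmoothFn U} (hf : FnOfU2 f) : FnOfU2 (-f) :=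
  fun x y h => congrArg (- ·) (hf x y h)

theorem FnOfU2.smul {f : SmoothFn U} (c : ℝ) (hf : FnOfU2 f) : FnOfU2 (c • f) :=
  fun x y h => congrArg (c * ·) (hf x y h)

theorem FnOfU2.expFn {f : SmoothFn U} (hf : FnOfU2 f) : FnOfU2 (expFn f) :=
  fun x y h => congrArg Real.exp (hf x y h)

theorem IsBox.fnOfU2_partialD (hU : IsBox U) {f : SmoothFn U} (hf : FnOfU2 f) :
    FnOfU2 (HydroDeform.partialD 1 f) := by
  rw [hU.fnOfU2_iff] at *
  rw [partialD_comm, hf, map_zero]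

theorem FnOfU2.of_mul_eq_one {f g : SmoothFn U} (hf : FnOfU2 f) (h : f * g = 1) : FnOfU2 g := by
  intro x y hxy
  have h1 : f.1 x * g.1 x = 1 := congrFun (congrArg Subtype.val h) x
  have h2 : f.1 y * g.1 y = 1 := congrFun (congrArg Subtype.val h) y
  rw [hf x y hxy] at h1
  exact mul_left_cancel₀ (left_ne_zero_of_mul_eq_one h2) (h1.trans h2.symm)

/-- Linear differential equations of first order in `u^2` are solvable on a box. -/
theorem IsBox.exists_linear_ode (hU : IsBox U) {a b : SmoothFn U} (ha : FnOfU2 a)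
    (hb : FnOfU2 b) : ∃ w : SmoothFn U, FnOfU2 w ∧ HydroDeform.partialD 1 w + a * w = b := by
  obtain ⟨A, hA, hA'⟩ := hU.exists_fnOfU2_partialD_eq ha
  obtain ⟨B, hB, hB'⟩ := hU.exists_fnOfU2_partialD_eq (hA.expFn.mul hb)
  refine ⟨HydroDeform.expFn (-A) * B, hA.neg.expFn.mul hB, ?_⟩
  rw [Derivation.leibniz, partialD_expFn, hB', map_neg, hA']
  have := expFn_mul_neg A
  simp only [smul_eq_mul]
  linear_combination b * this

end Box

/-! ### Calculus with differential polynomials of low degree -/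

section Calculus

variable {n : ℕ} {U : Opens (Fin n → ℝ)}

theorem jetPartial_C_zero (k : Fin n) (c : SmoothFn U) :
    jetPartial k 0 (MvPolynomial.C c) = MvPolynomial.C (partialD k c) := by
  rw [← jetDer_apply, jetDer, evo_C]
  simp [MvPolynomial.smul_eq_C_mul]

theorem jetPartial_C_succ (k : Fin n) (s : ℕ) (c : SmoothFn U) :
    jetPartial k (s + 1) (MvPolynomial.C c) = 0 := by simp [jetPartial]

theorem jetPartial_X_zero (k : Fin n) (v : Fin n × ℕ) :
    jetPartial k 0 (MvPolynomial.X v : DiffPoly U) = 0 := by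
  rw [← jetDer_apply]; simp [jetDer]

theorem jetPartial_X_succ (k : Fin n) (s : ℕ) (v : Fin n × ℕ) :
    jetPartial k (s + 1) (MvPolynomial.X v : DiffPoly U) = if v = (k, s) then 1 else 0 := by
  simp [jetPartial, MvPolynomial.pderiv_X, Pi.single_apply]

theorem jetPartial_add (k : Fin n) (s : ℕ) (f g : DiffPoly U) :
    jetPartial k s (f + g) = jetPartial k s f + jetPartial k s g := by
  simp only [← jetDer_apply, map_add]

theorem jetPartial_sub (k : Fin n) (s : ℕ) (f g : DiffPoly U) :
    jetPartial k s (f - g) = jetPartial k s f - jetPartial k s g := by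
  simp only [← jetDer_apply, map_sub]

theorem jetPartial_neg (k : Fin n) (s : ℕ) (f : DiffPoly U) :
    jetPartial k s (-f) = -jetPartial k s f := by
  simp only [← jetDer_apply, map_neg]

theorem jetPartial_zero (k : Fin n) (s : ℕ) : jetPartial k s (0 : DiffPoly U) = 0 := by
  simp only [← jetDer_apply, map_zero]

theorem jetPartial_one (k : Fin n) (s : ℕ) : jetPartial k s (1 : DiffPoly U) = 0 := by
  simp only [← jetDer_apply, Derivation.map_one_eq_zero]

theorem jetPartial_smul (k : Fin n) (s : ℕ) (c : ℝ) (f : DiffPoly U) :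
    jetPartial k s (c • f) = c • jetPartial k s f := by
  simp only [← jetDer_apply, Derivation.map_smul]

theorem jetPartial_mul (k : Fin n) (s : ℕ) (f g : DiffPoly U) :
    jetPartial k s (f * g) = jetPartial k s f * g + f * jetPartial k s g := by
  simp only [← jetDer_apply, Derivation.leibniz, smul_eq_mul]
  ring

theorem totalD_sub (f g : DiffPoly U) : totalD (f - g) = totalD f - totalD g := by
  simp only [← totalDer_apply, map_sub]

theorem totalD_neg (f : DiffPoly U) : totalD (-f) = -totalD f := by
  simp only [← totalDer_apply, map_neg]

theorem totalD_zero : totalD (0 : DiffPoly U) = 0 := by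
  simp only [← totalDer_apply, map_zero]

theorem totalD_one : totalD (1 : DiffPoly U) = 0 := by
  simp only [← totalDer_apply, Derivation.map_one_eq_zero]

theorem totalD_smul (c : ℝ) (f : DiffPoly U) : totalD (c • f) = c • totalD f := by
  simp only [← totalDer_apply, Derivation.map_smul]

theorem totalD_C₂ {U : Opens (Fin 2 → ℝ)} (c : SmoothFn U) :
    totalD (MvPolynomial.C c : DiffPoly U) = MvPolynomial.C (partialD 0 c) * MvPolynomial.X (0, 0)
      + MvPolynomial.C (partialD 1 c) * MvPolynomial.X (1, 0) := by
  rw [totalD_C, Fin.sum_univ_two]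
  simp [jet, MvPolynomial.smul_eq_C_mul]

theorem totalD_X' (v : Fin n × ℕ) :
    totalD (MvPolynomial.X v : DiffPoly U) = MvPolynomial.X (v.1, v.2 + 1) := totalD_X v

theorem HasDegree.exists_C {f : DiffPoly U} (hf : HasDegree f 0) :
    ∃ c, f = MvPolynomial.C c := by
  suffices h : ∀ d (f : DiffPoly U), HasDegree f d → d = 0 → ∃ c, f = MvPolynomial.C c from
    h 0 f hf rfl
  intro d f hf
  refine HasDegree.induction (M := fun d f => d = 0 → ∃ c, f = MvPolynomial.C c)
    (fun _ _ => ⟨0, by simp⟩) (fun c _ => ⟨c, rfl⟩) ?_ ?_ hf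
  · rintro d f g hf hg h
    obtain ⟨a, rfl⟩ := hf h
    obtain ⟨b, rfl⟩ := hg h
    exact ⟨a + b, by simp⟩
  · intro d f v _ _ h
    omega

/-- A differential polynomial of positive degree is a combination of jet variables. -/
theorem HasDegree.exists_sum {f : DiffPoly U} {d : ℕ} (hf : HasDegree f (d + 1)) :
    ∃ g : Fin n → ℕ → DiffPoly U, (∀ k s, s ≤ d → HasDegree (g k s) (d - s)) ∧
      f = ∑ k, ∑ s ∈ Finset.range (d + 1), g k s * MvPolynomial.X (k, s) := by
  suffices h : ∀ d' (f : DiffPoly U), HasDegree f d' → ∀ d, d' = d + 1 →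
      ∃ g : Fin n → ℕ → DiffPoly U, (∀ k s, s ≤ d → HasDegree (g k s) (d - s)) ∧
        f = ∑ k, ∑ s ∈ Finset.range (d + 1), g k s * MvPolynomial.X (k, s) from
    h _ f hf d rfl
  intro d' f hf
  refine HasDegree.induction (M := fun d' f => ∀ d, d' = d + 1 →
      ∃ g : Fin n → ℕ → DiffPoly U, (∀ k s, s ≤ d → HasDegree (g k s) (d - s)) ∧
        f = ∑ k, ∑ s ∈ Finset.range (d + 1), g k s * MvPolynomial.X (k, s)) ?_ ?_ ?_ ?_ hf
  · exact fun _ d _ => ⟨0, fun _ _ _ => hasDegree_zero _, by simp⟩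
  · intro c d h; omega
  · rintro d' f f' hf hf' d h
    obtain ⟨g, hg, rfl⟩ := hf d h
    obtain ⟨g', hg', rfl⟩ := hf' d h
    refine ⟨g + g', fun k s hs => (hg k s hs).add (hg' k s hs), ?_⟩
    simp only [Pi.add_apply, add_mul, Finset.sum_add_distrib]
  · intro d' f v _ hf d h
    obtain rfl : d = d' + v.2 := by omega
    refine ⟨fun k s => if (k, s) = v then f else 0, fun k s hs => ?_, ?_⟩
    · by_cases h' : (k, s) = v
      · subst h'
        simpa using hf
      · simpa [h'] using hasDegree_zero _
    · obtain ⟨k, s⟩ := v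
      rw [Finset.sum_eq_single k, Finset.sum_eq_single s]
      · simp
      · intro s' _ hs'
        simp [hs']
      · intro hs
        simp at hs
      · intro k' _ hk'
        simp [hk']
      · simp

attribute [simp] jetPartial_C_zero jetPartial_C_succ jetPartial_X_zero jetPartial_X_succ
  jetPartial_add jetPartial_sub jetPartial_neg jetPartial_zero jetPartial_one jetPartial_smul jetPartial_mul
  totalD_C₂ totalD_X' totalD_add totalD_sub totalD_neg totalD_zero totalD_one totalD_smul totalD_mul

variable {U : Opens (Fin 2 → ℝ)}

theorem HasDegree.exists_one {f : DiffPoly U} (hf : HasDegree f 1) :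
    ∃ a b : SmoothFn U, f = MvPolynomial.C a * MvPolynomial.X (0, 0)
      + MvPolynomial.C b * MvPolynomial.X (1, 0) := by
  obtain ⟨g, hg, rfl⟩ := hf.exists_sum
  obtain ⟨a, ha⟩ := (hg 0 0 le_rfl).exists_C
  obtain ⟨b, hb⟩ := (hg 1 0 le_rfl).exists_C
  exact ⟨a, b, by simp [Fin.sum_univ_two, ha, hb]⟩

theorem HasDegree.exists_two {f : DiffPoly U} (hf : HasDegree f 2) :
    ∃ a b c d e : SmoothFn U, f = MvPolynomial.C a * MvPolynomial.X (0, 1)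
      + MvPolynomial.C b * MvPolynomial.X (1, 1)
      + MvPolynomial.C c * MvPolynomial.X (0, 0) ^ 2
      + MvPolynomial.C d * (MvPolynomial.X (0, 0) * MvPolynomial.X (1, 0))
      + MvPolynomial.C e * MvPolynomial.X (1, 0) ^ 2 := by
  obtain ⟨g, hg, rfl⟩ := hf.exists_sum
  obtain ⟨a, ha⟩ := (hg 0 1 le_rfl).exists_C
  obtain ⟨b, hb⟩ := (hg 1 1 le_rfl).exists_C
  obtain ⟨c, d, h⟩ := (hg 0 0 (by omega)).exists_one
  obtain ⟨c', d', h'⟩ := (hg 1 0 (by omega)).exists_one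
  refine ⟨a, b, c, d + c', d', ?_⟩
  simp only [Fin.sum_univ_two, Finset.sum_range_succ, Finset.sum_range_zero, ha, hb, h, h', map_add]
  ring

theorem HasDegree.exists_three {f : DiffPoly U} (hf : HasDegree f 3) :
    ∃ a b c₀ c₁ c₂ c₃ e₀ e₁ e₂ e₃ : SmoothFn U, f = MvPolynomial.C a * MvPolynomial.X (0, 2)
      + MvPolynomial.C b * MvPolynomial.X (1, 2)
      + MvPolynomial.C c₀ * (MvPolynomial.X (0, 0) * MvPolynomial.X (0, 1))
      + MvPolynomial.C c₁ * (MvPolynomial.X (0, 0) * MvPolynomial.X (1, 1))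
      + MvPolynomial.C c₂ * (MvPolynomial.X (1, 0) * MvPolynomial.X (0, 1))
      + MvPolynomial.C c₃ * (MvPolynomial.X (1, 0) * MvPolynomial.X (1, 1))
      + MvPolynomial.C e₀ * MvPolynomial.X (0, 0) ^ 3
      + MvPolynomial.C e₁ * (MvPolynomial.X (0, 0) ^ 2 * MvPolynomial.X (1, 0))
      + MvPolynomial.C e₂ * (MvPolynomial.X (0, 0) * MvPolynomial.X (1, 0) ^ 2)
      + MvPolynomial.C e₃ * MvPolynomial.X (1, 0) ^ 3 := by
  obtain ⟨g, hg, rfl⟩ := hf.exists_sum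
  obtain ⟨a, ha⟩ := (hg 0 2 le_rfl).exists_C
  obtain ⟨b, hb⟩ := (hg 1 2 le_rfl).exists_C
  obtain ⟨a0, b0, h0⟩ := (hg 0 1 (by omega)).exists_one
  obtain ⟨a1, b1, h1⟩ := (hg 1 1 (by omega)).exists_one
  obtain ⟨r0, r1, r2, r3, r4, hr⟩ := (hg 0 0 (by omega)).exists_two
  obtain ⟨s0, s1, s2, s3, s4, hs⟩ := (hg 1 0 (by omega)).exists_two
  refine ⟨a, b, a0 + r0, a1 + r1, b0 + s0, b1 + s1, r2, r3 + s2, r4 + s3, s4, ?_⟩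
  simp only [Fin.sum_univ_two, Finset.sum_range_succ, Finset.sum_range_zero, ha, hb, h0, h1, hr, hs,
    map_add]
  ring

/-- The differential polynomial `f` does not depend on the jets of `u^1`. -/
def IndepU1 (f : DiffPoly U) : Prop := ∀ s, jetPartial 0 s f = 0

theorem eq_zero_of_mul_natCast {R : Type*} [CommRing R] [Algebra ℝ R] {a : R} (n : ℕ)
    (hn : n ≠ 0) (h : a * n = 0) : a = 0 := by
  have e : (n : R) = algebraMap ℝ R n := by simp
  have h' : (n⁻¹ : ℝ) • (a * n) = a := by
    rw [e, mul_comm, ← Algebra.smul_def, smul_smul, inv_mul_cancel₀ (by exact_mod_cast hn), one_smul]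
  rw [← h', h, smul_zero]

theorem C_eq_zero {a : SmoothFn U} (h : (MvPolynomial.C a : DiffPoly U) = 0) : a = 0 :=
  MvPolynomial.C_injective _ _ (by rw [h, map_zero])

theorem IndepU1.exists_C {f : DiffPoly U} (hi : IndepU1 f) (hf : HasDegree f 0) :
    ∃ a : SmoothFn U, partialD 0 a = 0 ∧ f = MvPolynomial.C a := by
  obtain ⟨a, rfl⟩ := hf.exists_C
  refine ⟨a, C_eq_zero ?_, rfl⟩
  rw [← jetPartial_C_zero]; exact hi 0

theorem IndepU1.exists_one {f : DiffPoly U} (hi : IndepU1 f) (hf : HasDegree f 1) :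
    ∃ b : SmoothFn U, partialD 0 b = 0 ∧ f = MvPolynomial.C b * MvPolynomial.X (1, 0) := by
  obtain ⟨a, b, rfl⟩ := hf.exists_one
  have h1 := hi 1
  simp at h1
  subst h1
  have h0 := congrArg (jetPartial 1 1) (hi 0)
  simp at h0
  exact ⟨b, h0, by simp⟩

theorem IndepU1.exists_two {f : DiffPoly U} (hi : IndepU1 f) (hf : HasDegree f 2) :
    ∃ p q : SmoothFn U, partialD 0 p = 0 ∧ partialD 0 q = 0 ∧
      f = MvPolynomial.C p * MvPolynomial.X (1, 1) + MvPolynomial.C q * MvPolynomial.X (1, 0) ^ 2 := by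
  obtain ⟨a, b, c, d, e, rfl⟩ := hf.exists_two
  have ha := hi 2
  simp [pow_two] at ha
  subst ha
  have hc := congrArg (jetPartial 0 1) (hi 1)
  simp [pow_two] at hc
  have hd := congrArg (jetPartial 1 1) (hi 1)
  simp [pow_two] at hd
  have hb := congrArg (jetPartial 1 2) (hi 0)
  simp [pow_two] at hb
  have he := congrArg (fun f => jetPartial 1 1 (jetPartial 1 1 f)) (hi 0)
  simp [pow_two] at he
  have hc' := C_eq_zero (eq_zero_of_mul_natCast 2 two_ne_zero (by push_cast; linear_combination hc))
  have he' := C_eq_zero (eq_zero_of_mul_natCast 2 two_ne_zero (by push_cast; linear_combination he))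
  exact ⟨b, e, hb, he', by simp [hc', hd]⟩

theorem IndepU1.exists_three {f : DiffPoly U} (hi : IndepU1 f) (hf : HasDegree f 3) :
    ∃ l m n : SmoothFn U, partialD 0 l = 0 ∧ partialD 0 m = 0 ∧ partialD 0 n = 0 ∧
      f = MvPolynomial.C l * MvPolynomial.X (1, 2)
        + MvPolynomial.C m * (MvPolynomial.X (1, 0) * MvPolynomial.X (1, 1))
        + MvPolynomial.C n * MvPolynomial.X (1, 0) ^ 3 := by
  obtain ⟨a, b, c₀, c₁, c₂, c₃, e₀, e₁, e₂, e₃, rfl⟩ := hf.exists_three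
  have ha := hi 3
  simp [pow_succ] at ha
  subst ha
  have hc₀ := congrArg (jetPartial 0 1) (hi 2)
  simp [pow_succ] at hc₀
  have hc₂ := congrArg (jetPartial 1 1) (hi 2)
  simp [pow_succ] at hc₂
  have hc₁ := congrArg (jetPartial 1 2) (hi 1)
  simp [pow_succ] at hc₁
  subst hc₀ hc₁ hc₂
  have he₀ := congrArg (fun f => jetPartial 0 1 (jetPartial 0 1 f)) (hi 1)
  simp [pow_succ] at he₀
  have he₁ := congrArg (fun f => jetPartial 0 1 (jetPartial 1 1 f)) (hi 1)
  simp [pow_succ] at he₁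
  have he₂ := congrArg (fun f => jetPartial 1 1 (jetPartial 1 1 f)) (hi 1)
  simp [pow_succ] at he₂
  have he₀' := C_eq_zero (eq_zero_of_mul_natCast 6 (by norm_num)
    (by push_cast; linear_combination he₀))
  have he₁' := C_eq_zero (eq_zero_of_mul_natCast 2 two_ne_zero
    (by push_cast; linear_combination he₁))
  have he₂' := C_eq_zero (eq_zero_of_mul_natCast 2 two_ne_zero
    (by push_cast; linear_combination he₂))
  subst he₀' he₁' he₂'
  have hb := congrArg (jetPartial 1 3) (hi 0)
  simp [pow_succ] at hb
  have hc₃ := congrArg (fun f => jetPartial 1 1 (jetPartial 1 2 f)) (hi 0)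
  simp [pow_succ] at hc₃
  have he₃ := congrArg (fun f => jetPartial 1 1 (jetPartial 1 1 (jetPartial 1 1 f))) (hi 0)
  simp [pow_succ] at he₃
  have he₃' := C_eq_zero (eq_zero_of_mul_natCast 6 (by norm_num)
    (by push_cast; linear_combination he₃))
  exact ⟨b, c₃, e₃, hb, hc₃, he₃', by simp⟩

/-! ### Skew-adjoint operators of order one and three -/

theorem coeff_dxComp_zero {n : ℕ} {U : Opens (Fin n → ℝ)} (P : DiffOp U) :
    (dxComp P).coeff 0 = totalD (P.coeff 0) := by
  induction P using Polynomial.induction_on' with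
  | add P Q hP hQ => simp [dxComp_add, hP, hQ]
  | monomial m a =>
    rw [dxComp_monomial]
    cases m <;> simp [Polynomial.coeff_monomial]

theorem coeff_dxComp_succ {n : ℕ} {U : Opens (Fin n → ℝ)} (P : DiffOp U) (k : ℕ) :
    (dxComp P).coeff (k + 1) = totalD (P.coeff (k + 1)) + P.coeff k := by
  induction P using Polynomial.induction_on' with
  | add P Q hP hQ => simp [dxComp_add, hP, hQ]; ring
  | monomial m a =>
    rw [dxComp_monomial]
    by_cases h : m = k
    · subst h
      simp [Polynomial.coeff_monomial]
    · by_cases h' : m = k + 1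
      · subst h'; simp [Polynomial.coeff_monomial]
      · simp [Polynomial.coeff_monomial, h, h']

theorem coeff_opAdj_monomial_succ {n : ℕ} {U : Opens (Fin n → ℝ)} (m : ℕ) (a : DiffPoly U) (k : ℕ) :
    (opAdj (Polynomial.monomial (m + 1) a)).coeff k
      = -(dxComp (opAdj (Polynomial.monomial m a))).coeff k := by
  rw [opAdj_monomial, Function.iterate_succ_apply', ← opAdj_monomial, AddMonoidHom.neg_apply,
    dxCompHom_apply, Polynomial.coeff_neg]

theorem opAdj_monomial_zero {n : ℕ} {U : Opens (Fin n → ℝ)} (a : DiffPoly U) :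
    opAdj (Polynomial.monomial 0 a) = Polynomial.C a := by
  rw [opAdj_monomial]; rfl

/-- The coefficients of the adjoint of an operator of order at most four. -/
theorem coeff_opAdj {n : ℕ} {U : Opens (Fin n → ℝ)} {P : DiffOp U}
    (hP : ∀ m, 4 < m → P.coeff m = 0) :
    (∀ m, 4 < m → (opAdj P).coeff m = 0) ∧ (opAdj P).coeff 4 = P.coeff 4 ∧
    (opAdj P).coeff 3 = -P.coeff 3 + 4 * totalD (P.coeff 4) ∧
    (opAdj P).coeff 2 = P.coeff 2 - 3 * totalD (P.coeff 3) + 6 * totalD (totalD (P.coeff 4)) ∧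
    (opAdj P).coeff 1 = -P.coeff 1 + 2 * totalD (P.coeff 2) - 3 * totalD (totalD (P.coeff 3))
      + 4 * totalD (totalD (totalD (P.coeff 4))) ∧
    (opAdj P).coeff 0 = P.coeff 0 - totalD (P.coeff 1) + totalD (totalD (P.coeff 2))
      - totalD (totalD (totalD (P.coeff 3))) + totalD (totalD (totalD (totalD (P.coeff 4)))) := by
  have h : P = ∑ m ∈ Finset.range 5, Polynomial.monomial m (P.coeff m) := by
    refine Polynomial.ext fun m => ?_
    simp only [Polynomial.finsetSum_coeff, Polynomial.coeff_monomial]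
    rw [Finset.sum_ite_eq']
    split_ifs with h
    · rfl
    · exact hP m (by simp at h; omega)
  have h' : opAdj P = ∑ m ∈ Finset.range 5, opAdj (Polynomial.monomial m (P.coeff m)) := by
    conv_lhs => rw [h]
    exact map_sum opAdjHom _ _
  rw [h']
  have hm : ∀ m, 4 < m → ∃ k, m = k + 5 := fun m hm => ⟨m - 5, by omega⟩
  refine ⟨fun m h => ?_, ?_⟩
  · obtain ⟨k, rfl⟩ := hm m h
    simp only [Finset.sum_range_succ, Finset.sum_range_zero, zero_add, Polynomial.coeff_add,
      coeff_opAdj_monomial_succ, coeff_dxComp_succ, opAdj_monomial_zero,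
      Polynomial.coeff_C_succ, totalD_neg, totalD_add, totalD_zero]
    ring
  simp only [Finset.sum_range_succ, Finset.sum_range_zero, zero_add, Polynomial.coeff_add,
    coeff_opAdj_monomial_succ, coeff_dxComp_zero, coeff_dxComp_succ, opAdj_monomial_zero,
    Polynomial.coeff_C_zero, Polynomial.coeff_C_succ, totalD_neg, totalD_add, totalD_zero]
  refine ⟨by ring, by ring, by ring, by ring, by ring⟩

theorem half_smul_two_mul {R : Type*} [CommRing R] [Algebra ℝ R] {a b : R} (h : 2 * a = b) :
    a = (1 / 2 : ℝ) • b := by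
  have e : (2 : R) = algebraMap ℝ R 2 := (map_ofNat (algebraMap ℝ R) 2).symm
  rw [← h, e, ← Algebra.smul_def, smul_smul]
  norm_num

section Scalars

variable {R : Type*} [CommRing R] [Algebra ℝ R] (x y : R)

theorem half_smul_three_mul : (1 / 2 : ℝ) • (3 * x) = (3 / 2 : ℝ) • x := by algebra

theorem half_smul_sub_three_halves_smul_add : (1 / 2 : ℝ) • (x - (3 / 2 : ℝ) • y + y)
    = (1 / 2 : ℝ) • x - (1 / 4 : ℝ) • y := by module

theorem skew_coeff_zero_identity : (1 / 2 : ℝ) • x - (1 / 4 : ℝ) • y - x + (3 / 2 : ℝ) • y - y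
    = (1 / 4 : ℝ) • y - (1 / 2 : ℝ) • x := by module

theorem skew_coeff_one_identity : -x + 2 * (3 / 2 : ℝ) • y - 3 * y = -x := by algebra

theorem skew_coeff_two_identity : (3 / 2 : ℝ) • x - 3 * x = -((3 / 2 : ℝ) • x) := by algebra

end Scalars

/-- A skew-adjoint operator of degree two is determined by its coefficient of `d_x`. -/
theorem opDegree_two_skew_form {n : ℕ} {U : Opens (Fin n → ℝ)} {A : DiffOp U} (hA : OpDegree 2 A)
    (h : opAdj A = -A) : ∃ b, HasDegree b 1 ∧
      A = opFun b * dx + opFun ((1 / 2 : ℝ) • totalD b) := by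
  obtain ⟨-, -, -, h2, -, h0⟩ := coeff_opAdj (P := A) fun m hm => (hA m).1 (by omega)
  rw [h, Polynomial.coeff_neg, (hA 4).1 (by omega), (hA 3).1 (by omega)] at h2 h0
  simp only [totalD_zero] at h2 h0
  have e2 : A.coeff 2 = 0 := eq_zero_of_mul_natCast 2 two_ne_zero
    (by push_cast; linear_combination -h2)
  rw [e2] at h0
  simp only [totalD_zero] at h0
  have e0 := half_smul_two_mul (a := A.coeff 0) (b := totalD (A.coeff 1))
    (by linear_combination -h0)
  refine ⟨A.coeff 1, (hA 1).2 1 rfl, Polynomial.ext fun m => ?_⟩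
  match m with
  | 0 => simp [opFun, dx, e0]
  | 1 => simp [opFun, dx]
  | 2 => simp [opFun, dx, e2]
  | m + 3 => rw [(hA _).1 (by omega)]; simp [opFun, dx]

/-- A skew-adjoint operator of degree three is determined by its coefficients of `d_x^3` and `d_x`. -/
theorem opDegree_three_skew_form {n : ℕ} {U : Opens (Fin n → ℝ)} {A : DiffOp U} (hA : OpDegree 3 A)
    (h : opAdj A = -A) : ∃ a c, HasDegree a 0 ∧ HasDegree c 2 ∧
      A = opFun a * dx ^ 3 + opFun ((3 / 2 : ℝ) • totalD a) * dx ^ 2 + opFun c * dx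
        + opFun ((1 / 2 : ℝ) • totalD c - (1 / 4 : ℝ) • totalD (totalD (totalD a))) := by
  obtain ⟨-, -, -, h2, -, h0⟩ := coeff_opAdj (P := A) fun m hm => (hA m).1 (by omega)
  rw [h, Polynomial.coeff_neg, (hA 4).1 (by omega)] at h2 h0
  simp only [totalD_zero] at h2 h0
  have e2 : A.coeff 2 = (3 / 2 : ℝ) • totalD (A.coeff 3) := by
    rw [half_smul_two_mul (a := A.coeff 2) (b := 3 * totalD (A.coeff 3))
      (by linear_combination -h2), half_smul_three_mul]
  have e0 : A.coeff 0 = (1 / 2 : ℝ) • totalD (A.coeff 1)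
      - (1 / 4 : ℝ) • totalD (totalD (totalD (A.coeff 3))) := by
    rw [half_smul_two_mul (a := A.coeff 0) (b := totalD (A.coeff 1)
      - totalD (totalD (A.coeff 2)) + totalD (totalD (totalD (A.coeff 3))))
      (by linear_combination -h0), e2, totalD_smul, totalD_smul, half_smul_sub_three_halves_smul_add]
  refine ⟨A.coeff 3, A.coeff 1, (hA 3).2 0 rfl, (hA 1).2 2 rfl, Polynomial.ext fun m => ?_⟩
  match m with
  | 0 => simpa [opFun, dx] using e0
  | 1 => simp [opFun, dx, Polynomial.coeff_X_pow]
  | 2 => simpa [opFun, dx, Polynomial.coeff_X_pow, Polynomial.coeff_X] using e2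
  | 3 => simp [opFun, dx, Polynomial.coeff_X_pow]
  | m + 4 => rw [(hA _).1 (by omega)]; simp [opFun, dx]

/-- The operators of `opDegree_three_skew_form` are skew-adjoint. -/
theorem opAdj_skew_three {n : ℕ} {U : Opens (Fin n → ℝ)} (a c : DiffPoly U) :
    opAdj (opFun a * dx ^ 3 + opFun ((3 / 2 : ℝ) • totalD a) * dx ^ 2 + opFun c * dx
        + opFun ((1 / 2 : ℝ) • totalD c - (1 / 4 : ℝ) • totalD (totalD (totalD a))))
      = -(opFun a * dx ^ 3 + opFun ((3 / 2 : ℝ) • totalD a) * dx ^ 2 + opFun c * dx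
        + opFun ((1 / 2 : ℝ) • totalD c - (1 / 4 : ℝ) • totalD (totalD (totalD a)))) := by
  obtain ⟨h5, h4, h3, h2, h1, h0⟩ := coeff_opAdj (P := opFun a * dx ^ 3
    + opFun ((3 / 2 : ℝ) • totalD a) * dx ^ 2 + opFun c * dx
    + opFun ((1 / 2 : ℝ) • totalD c - (1 / 4 : ℝ) • totalD (totalD (totalD a)))) (fun m hm => by
      obtain ⟨k, rfl⟩ : ∃ k, m = k + 4 := ⟨m - 4, by omega⟩
      simp [opFun, dx])
  refine Polynomial.ext fun m => ?_
  match m with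
  | 0 =>
    rw [h0]
    simpa [opFun, dx, Polynomial.coeff_X] using skew_coeff_zero_identity _ _
  | 1 =>
    rw [h1]
    simpa [opFun, dx, Polynomial.coeff_X_pow, Polynomial.coeff_X] using skew_coeff_one_identity _ _
  | 2 =>
    rw [h2]
    simpa [opFun, dx, Polynomial.coeff_X_pow, Polynomial.coeff_X] using skew_coeff_two_identity _
  | 3 =>
    rw [h3]
    simp [opFun, dx, Polynomial.coeff_X_pow]
  | 4 =>
    rw [h4]
    simp [opFun, dx, Polynomial.coeff_X_pow]
  | m + 5 =>
    rw [h5 _ (by omega)]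
    simp [opFun, dx]

end Calculus

/-! ### Bilinearity of the Schouten bracket -/

section Bilinear

variable {n : ℕ} {U : Opens (Fin n → ℝ)}

theorem schouten_comm (P Q : MatOp U) (i j k : Fin n) : schouten P Q i j k = schouten Q P i j k := by
  simp only [schouten, add_comm]

theorem half_add_left (P P' Q : MatOp U) (i j k : Fin n) (z y : FreqRing U) :
    half (P + P') Q i j k z y = half P Q i j k z y + half P' Q i j k z y := by
  simp only [half, Matrix.add_apply, act_add, map_add]

theorem half_add_right (P Q Q' : MatOp U) (i j k : Fin n) (z y : FreqRing U) :
    half P (Q + Q') i j k z y = half P Q i j k z y + half P Q' i j k z y := by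
  simp only [half, Matrix.add_apply, act_add]
  exact evR_add _ _ _ _

theorem schouten_add_right (P Q Q' : MatOp U) (i j k : Fin n) :
    schouten P (Q + Q') i j k = schouten P Q i j k + schouten P Q' i j k := by
  have e : bracketDensity P (Q + Q') i j k = bracketDensity P Q i j k + bracketDensity P Q' i j k := by
    simp only [bracketDensity, symHalf, half_add_left, half_add_right]
    ring
  rw [schouten_eq, schouten_eq, schouten_eq, e, map_add]

theorem schouten_add_left (P P' Q : MatOp U) (i j k : Fin n) :
    schouten (P + P') Q i j k = schouten P Q i j k + schouten P' Q i j k := by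
  rw [schouten_comm, schouten_add_right, schouten_comm Q, schouten_comm Q]

theorem schouten_zero_right (P : MatOp U) (i j k : Fin n) : schouten P 0 i j k = 0 := by
  have h := schouten_add_right P 0 0 i j k
  simpa using h

theorem schouten_neg_right (P Q : MatOp U) (i j k : Fin n) :
    schouten P (-Q) i j k = -schouten P Q i j k := by
  have h := schouten_add_right P Q (-Q) i j k
  rw [add_neg_cancel, schouten_zero_right] at h
  linear_combination -h

theorem dxComp_zero : dxComp (0 : DiffOp U) = 0 := by
  rw [← dxCompHom_apply, map_zero]

theorem opComp_zero (A : DiffOp U) : opComp A 0 = 0 := by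
  have h : ∀ m, (dxComp (U := U))^[m] 0 = 0 := fun m => by
    induction m with
    | zero => rfl
    | succ m ih => rw [Function.iterate_succ_apply', ih, dxComp_zero]
  simp [opComp, h, Polynomial.sum]

theorem zero_opComp (A : DiffOp U) : opComp 0 A = 0 := by simp [opComp]

theorem dxComp_X_pow (m : ℕ) : dxComp (Polynomial.X ^ m : DiffOp U) = Polynomial.X ^ (m + 1) := by
  rw [← Polynomial.monomial_one_right_eq_X_pow, dxComp_monomial, totalD_one, map_zero, zero_add,
    Polynomial.monomial_one_right_eq_X_pow]

theorem iterate_dxComp_dx (m : ℕ) : dxComp^[m] (dx : DiffOp U) = Polynomial.X ^ (m + 1) := by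
  induction m with
  | zero => simp [dx]
  | succ m ih => rw [Function.iterate_succ_apply', ih, dxComp_X_pow]

theorem opComp_dx (A : DiffOp U) : opComp A dx = A * Polynomial.X := by
  simp only [opComp, iterate_dxComp_dx]
  conv_rhs => rw [A.as_sum_support_C_mul_X_pow, Finset.sum_mul]
  exact Finset.sum_congr rfl fun m _ => by
    change Polynomial.C _ * Polynomial.X ^ (m + 1) = _
    rw [pow_succ, mul_assoc]

theorem opComp_C (a : DiffPoly U) (A : DiffOp U) : opComp (opFun a) A = opFun a * A := by
  simp [opComp, opFun]

theorem dx_opComp (A : DiffOp U) : opComp dx A = dxComp A := by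
  simp [opComp, dx, opFun]

theorem opAdj_dx : opAdj (dx : DiffOp U) = -dx := by
  rw [dx, ← Polynomial.monomial_one_one_eq_X, opAdj_monomial]
  simp only [Function.iterate_succ, Function.iterate_zero, Function.comp_apply, id, opFun,
    AddMonoidHom.neg_apply, dxCompHom_apply, map_one]
  rw [← pow_zero Polynomial.X, dxComp_X_pow, zero_add, pow_one, Polynomial.monomial_one_one_eq_X]

end Bilinear

/-! ### Bivectors that commute with `P01` -/

section Closed

variable {U : Opens (Fin 2 → ℝ)}

/-- The operator `P01` has constant coefficients, so its derivatives vanish. -/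
theorem half_P01_left (Q : MatOp U) (i j k : Fin 2) {z : FreqRing U} (hz : IsFreq z)
    (y : FreqRing U) : half (P01 U) Q i j k z y = 0 := by
  rw [half, act_one hz]
  fin_cases i <;> fin_cases j <;> simp [P01, dx, hz.evR]

/-- The symbol of the derivative of an operator `A` along the field with components `dx, 0`. -/
def u1Sym (A : DiffOp U) : TriSymbol U :=
  A.sum fun m a => MvPolynomial.X 0 ^ m *
    Polynomial.aeval (MvPolynomial.X 1 : TriSymbol U) (lin a 0 * Polynomial.X)

/-- The second column of `P01` is zero. -/
theorem half_P01_right_one (Q : MatOp U) (i j : Fin 2) {y : FreqRing U} (z : FreqRing U) :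
    half Q (P01 U) i j 1 z y = 0 := by
  have : (fun l => act y (P01 U l 1) 1) = (0 : Fin 2 → FreqRing U) := by
    funext l
    fin_cases l <;> simp [P01, act_zero]
  rw [half, this, evR_zero]

theorem half_P01_right_zero (Q : MatOp U) (i j : Fin 2) {z y : FreqRing U} (hz : IsFreq z)
    (hy : IsFreq y) : half Q (P01 U) i j 0 z y = emb z y (u1Sym (Q i j)) := by
  have e : halfBracket Q (P01 U) i j 0 = u1Sym (Q i j) := by
    rw [halfBracket, u1Sym, Polynomial.sum, Polynomial.sum]
    refine Finset.sum_congr rfl fun m _ => ?_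
    have h0 : P01 U 0 0 = dx := rfl
    have h1 : P01 U 1 0 = 0 := rfl
    rw [Fin.sum_univ_two, h0, h1, opComp_dx, opComp_zero, map_zero, add_zero]
  rw [half, ← emb_halfBracket hz hy, e]

theorem fin_two_finsupp (a b c d : ℕ) :
    Finsupp.single (0 : Fin 2) a + Finsupp.single 1 b = Finsupp.single 0 c + Finsupp.single 1 d ↔
      a = c ∧ b = d := by
  constructor
  · intro h
    exact ⟨by simpa using DFunLike.congr_fun h 0, by simpa using DFunLike.congr_fun h 1⟩
  · rintro ⟨rfl, rfl⟩; rfl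

theorem coeff_X0_mul_aeval (m a b : ℕ) (B : DiffOp U) :
    (MvPolynomial.X 0 ^ m * Polynomial.aeval (MvPolynomial.X 1 : TriSymbol U) B).coeff
      (Finsupp.single 0 a + Finsupp.single 1 b) = if m = a then B.coeff b else 0 := by
  induction B using Polynomial.induction_on' with
  | add P Q hP hQ =>
    rw [map_add, mul_add, MvPolynomial.coeff_add, hP, hQ, Polynomial.coeff_add]
    split_ifs <;> simp
  | monomial k c =>
    have : (MvPolynomial.X 0 ^ m * Polynomial.aeval (MvPolynomial.X 1 : TriSymbol U)
        (Polynomial.monomial k c) : TriSymbol U)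
        = MvPolynomial.monomial (Finsupp.single 0 m + Finsupp.single 1 k) c := by
      rw [Polynomial.aeval_monomial, MvPolynomial.algebraMap_eq, MvPolynomial.X_pow_eq_monomial,
        MvPolynomial.X_pow_eq_monomial, MvPolynomial.C_mul_monomial, MvPolynomial.monomial_mul]
      simp
    rw [this, MvPolynomial.coeff_monomial, Polynomial.coeff_monomial]
    simp only [fin_two_finsupp]
    by_cases h1 : m = a <;> by_cases h2 : k = b <;> simp [h1, h2]

theorem coeff_u1Sym (A : DiffOp U) (a b : ℕ) :
    (u1Sym A).coeff (Finsupp.single 0 a + Finsupp.single 1 b)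
      = (lin (A.coeff a) 0 * Polynomial.X).coeff b := by
  rw [u1Sym, Polynomial.sum, MvPolynomial.coeff_sum]
  simp only [coeff_X0_mul_aeval]
  rw [Finset.sum_ite_eq']
  split_ifs with h
  · rfl
  · rw [Polynomial.notMem_support_iff.1 h]
    have : lin (0 : DiffPoly U) 0 = 0 := Polynomial.ext fun s => by rw [coeff_lin]; simp
    rw [this, zero_mul, Polynomial.coeff_zero]

theorem coeff_u1Sym_succ (A : DiffOp U) (a s : ℕ) :
    (u1Sym A).coeff (Finsupp.single 0 a + Finsupp.single 1 (s + 1)) = jetPartial 0 s (A.coeff a) := by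
  rw [coeff_u1Sym, Polynomial.coeff_mul_X, coeff_lin]

theorem coeff_u1Sym_zero (A : DiffOp U) (a : ℕ) :
    (u1Sym A).coeff (Finsupp.single 0 a + Finsupp.single 1 0) = 0 := by
  rw [coeff_u1Sym, Polynomial.coeff_mul_X_zero]

/-- If the coefficients of `A` do not depend on the jets of `u^1`, its symbol vanishes. -/
theorem u1Sym_eq_zero {A : DiffOp U} (hA : ∀ m, IndepU1 (A.coeff m)) : u1Sym A = 0 := by
  rw [u1Sym, Polynomial.sum]
  refine Finset.sum_eq_zero fun m _ => ?_
  have : lin (A.coeff m) 0 = 0 := Polynomial.ext fun s => by rw [coeff_lin, hA m s]; simp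
  rw [this, zero_mul, map_zero, mul_zero]

theorem bracketDensity_P01 (Q : MatOp U) (i j k : Fin 2) : bracketDensity (P01 U) Q i j k
    = half Q (P01 U) i j k (freq U 1) (freq U 2) + half Q (P01 U) k i j (freq U 0) (freq U 1)
      + half Q (P01 U) j k i (freq U 2) (freq U 0) := by
  simp only [bracketDensity, symHalf, half_P01_left _ _ _ _ (isFreq_X _), zero_add]

/-- If a bivector commutes with `P01`, its entry `Q 1 1` does not depend on the jets of `u^1`. -/
theorem indepU1_of_closed {Q : MatOp U} (h : ∀ i j k, schouten (P01 U) Q i j k = 0) (m : ℕ) :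
    IndepU1 ((Q 1 1).coeff m) := by
  intro s
  have h1 := h 1 1 0
  rw [schouten_eq, bracketDensity_P01, half_P01_right_one, half_P01_right_one, add_zero, add_zero,
    half_P01_right_zero _ _ _ (isFreq_X _) (isFreq_X _), elim_emb] at h1
  rw [← coeff_u1Sym_succ, h1, MvPolynomial.coeff_zero]

/-- Passing to the adjoint operator exchanges two test functions. -/
theorem elim_u1Sym_opAdj {i j l : Fin 3} (h : freq U l + freq U i + freq U j = totalFreq U)
    (A : DiffOp U) :
    elim (emb (freq U i) (freq U j) (u1Sym (opAdj A))) = elim (emb (freq U l) (freq U j) (u1Sym A)) := by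
  have e : ∀ (A : DiffOp U) (i : Fin 3), emb (freq U i) (freq U j) (u1Sym A)
      = evR (freq U j) (fun l => act (freq U j) (P01 U l 0) 1) (act (freq U i) A 1) := by
    intro A i
    exact (half_P01_right_zero (!![A, 0; 0, 0] : MatOp U) 0 0 (isFreq_X _) (isFreq_X _)).symm
  have := elim_mul_evR_adjLin (isFreq_X i) (isFreq_X l) h
    (fun l => act (freq U j) (P01 U l 0) 1) A 1
  rw [one_mul, evAct_one] at this
  rw [e, e, this]

theorem u1Sym_neg (A : DiffOp U) : u1Sym (-A) = -u1Sym A := by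
  have e : ∀ A : DiffOp U, emb (freq U 1) (freq U 2) (u1Sym A)
      = evR (freq U 2) (fun l => act (freq U 2) (P01 U l 0) 1) (act (freq U 1) A 1) := fun A =>
    (half_P01_right_zero (!![A, 0; 0, 0] : MatOp U) 0 0 (isFreq_X _) (isFreq_X _)).symm
  rw [← elim_emb (u1Sym (-A)), e, act_neg, map_neg, map_neg, ← e, elim_emb]

theorem emb_swap (z y : FreqRing U) (T : TriSymbol U) :
    emb y z T = emb z y (MvPolynomial.rename (Equiv.swap 0 1) T) := by
  rw [emb, emb, MvPolynomial.aeval_rename]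
  congr 2
  funext i
  fin_cases i <;> simp

/-- The coefficients `A_m` of the entry `Q 1 0` of a bivector that commutes with `P01` satisfy
`∂ A_m / ∂ u^1_{(k)} = ∂ A_{k+1} / ∂ u^1_{(m-1)}`, where the right side is zero for `m = 0`. -/
theorem coeff_symm_of_closed {Q : MatOp U} (hQ : IsSkew Q)
    (h : ∀ i j k, schouten (P01 U) Q i j k = 0) :
    IndepU1 ((Q 1 0).coeff 0) ∧ ∀ m s,
      jetPartial 0 s ((Q 1 0).coeff (m + 1)) = jetPartial 0 m ((Q 1 0).coeff (s + 1)) := by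
  have h1 := h 1 0 0
  have hadj : Q 0 1 = -opAdj (Q 1 0) := by rw [hQ 0 1, neg_neg]
  rw [schouten_eq, bracketDensity_P01, half_P01_right_one, add_zero,
    half_P01_right_zero _ _ _ (isFreq_X _) (isFreq_X _), half_P01_right_zero _ _ _ (isFreq_X _)
    (isFreq_X _), hadj, u1Sym_neg, map_neg, map_add, map_neg, elim_emb,
    elim_u1Sym_opAdj (l := 2) (by rw [totalFreq]; ring), emb_swap, elim_emb] at h1
  have h2 : ∀ a b, (u1Sym (Q 1 0)).coeff (Finsupp.single 0 a + Finsupp.single 1 b)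
      = (u1Sym (Q 1 0)).coeff (Finsupp.single 0 b + Finsupp.single 1 a) := by
    intro a b
    have e : Finsupp.single (0 : Fin 2) a + Finsupp.single 1 b
        = Finsupp.mapDomain (Equiv.swap (0 : Fin 2) 1)
          (Finsupp.single (0 : Fin 2) b + Finsupp.single 1 a) := by
      rw [Finsupp.mapDomain_add, Finsupp.mapDomain_single, Finsupp.mapDomain_single,
        Equiv.swap_apply_left, Equiv.swap_apply_right, add_comm]
    conv_rhs => rw [← MvPolynomial.coeff_rename_mapDomain _ (Equiv.swap (0 : Fin 2) 1).injective, ← e]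
    rw [← sub_eq_zero, ← MvPolynomial.coeff_sub, sub_eq_add_neg, h1, MvPolynomial.coeff_zero]
  refine ⟨fun s => ?_, fun m s => ?_⟩
  · rw [← coeff_u1Sym_succ, h2, coeff_u1Sym_zero]
  · rw [← coeff_u1Sym_succ, h2, coeff_u1Sym_succ]

/-- The restriction of a density to the symbols that do not involve the frequency of the last test
function, after elimination of the first frequency. -/
def restrict₂ : FreqRing U →+ DiffOp U :=
  (MvPolynomial.aeval ![Polynomial.X, 0] : TriSymbol U →ₐ[DiffPoly U] DiffOp U).toAddMonoidHom.comp
    elim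

theorem restrict₂_apply (T : FreqRing U) : restrict₂ T
    = (MvPolynomial.aeval ![Polynomial.X, 0] : TriSymbol U →ₐ[DiffPoly U] DiffOp U) (elim T) := rfl

theorem restrict₂_X2_mul (T : FreqRing U) : restrict₂ (freq U 2 * T) = 0 := by
  rw [restrict₂_apply, elim_X2_mul, map_mul]
  simp

theorem restrict₂_X1_mul (T : FreqRing U) :
    restrict₂ (freq U 1 * T) = Polynomial.X * restrict₂ T := by
  rw [restrict₂_apply, elim_X1_mul, map_mul, restrict₂_apply]
  simp

theorem restrict₂_emb (T : TriSymbol U) : restrict₂ (emb (freq U 1) (freq U 2) T)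
    = (MvPolynomial.aeval ![Polynomial.X, 0] : TriSymbol U →ₐ[DiffPoly U] DiffOp U) T := by
  rw [restrict₂_apply, elim_emb]

theorem restrict₂_act_X1 (A : DiffOp U) : restrict₂ (act (freq U 1) A 1) = A := by
  have : act (freq U 1) A 1 = emb (freq U 1) (freq U 2) (Polynomial.aeval (MvPolynomial.X 0) A) := by
    rw [act_one (isFreq_X _), ← Polynomial.aeval_algHom_apply, emb_X0]
  rw [this, restrict₂_emb, ← Polynomial.aeval_algHom_apply]
  simp

theorem restrict₂_act_X2 (A : DiffOp U) :
    restrict₂ (act (freq U 2) A 1) = Polynomial.C (A.coeff 0) := by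
  have : act (freq U 2) A 1 = emb (freq U 1) (freq U 2) (Polynomial.aeval (MvPolynomial.X 1) A) := by
    rw [act_one (isFreq_X _), ← Polynomial.aeval_algHom_apply, emb_X1]
  rw [this, restrict₂_emb, ← Polynomial.aeval_algHom_apply]
  simp [Polynomial.aeval_def, Polynomial.eval₂_at_zero]

theorem restrict₂_act_X0 (A : DiffOp U) : restrict₂ (act (freq U 0) A 1) = opAdj A := by
  rw [restrict₂_apply, ← elim_act_opAdj, ← restrict₂_apply]
  have : act (freq U 1 + freq U 2) (opAdj A) 1 = emb (freq U 1) (freq U 2)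
      (Polynomial.aeval (MvPolynomial.X 0 + MvPolynomial.X 1) (opAdj A)) := by
    rw [act_one ((isFreq_X _).add (isFreq_X _)), ← Polynomial.aeval_algHom_apply, map_add, emb_X0,
      emb_X1]
  rw [this, restrict₂_emb, ← Polynomial.aeval_algHom_apply]
  simp

theorem restrict₂_X0_mul_act_X1 (A : DiffOp U) :
    restrict₂ (freq U 0 * act (freq U 1) A 1) = -dxComp A := by
  have h : dFreq (totalFreq U) (act (freq U 1) A 1) = freq U 0 * act (freq U 1) A 1
      + act (freq U 1) (dxComp A) 1 + freq U 2 * act (freq U 1) A 1 := by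
    rw [act_dxComp, dFreq_apply, dFreq_apply, totalFreq]
    ring
  have h2 : restrict₂ (dFreq (totalFreq U) (act (freq U 1) A 1)) = 0 := by
    rw [restrict₂_apply, elim_dFreq, map_zero]
  rw [h, map_add, map_add, restrict₂_X2_mul, restrict₂_act_X1] at h2
  linear_combination h2

/-- Modulo the first frequency, only the free term of the operator contributes to its symbol. -/
theorem emb_u1Sym_eq (z y : FreqRing U) (A : DiffOp U) : ∃ T, emb z y (u1Sym A)
    = z * T + Polynomial.aeval y (lin (A.coeff 0) 0 * Polynomial.X) := by
  have key : ∀ m (a : DiffPoly U), ∃ T, emb z y (MvPolynomial.X 0 ^ m *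
      Polynomial.aeval (MvPolynomial.X 1 : TriSymbol U) (lin a 0 * Polynomial.X))
      = z * T + if m = 0 then Polynomial.aeval y (lin a 0 * Polynomial.X) else 0 := by
    intro m a
    rw [map_mul, map_pow, emb_X0, ← Polynomial.aeval_algHom_apply, emb_X1]
    cases m with
    | zero => exact ⟨0, by simp⟩
    | succ m =>
      exact ⟨z ^ m * Polynomial.aeval y (lin a 0 * Polynomial.X), by
        rw [pow_succ', mul_assoc]; simp⟩
  choose T hT using key
  refine ⟨∑ m ∈ A.support, T m (A.coeff m), ?_⟩
  rw [u1Sym, Polynomial.sum, map_sum, Finset.sum_congr rfl fun m _ => hT m (A.coeff m),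
    Finset.sum_add_distrib, Finset.mul_sum, Finset.sum_ite_eq']
  congr 1
  split_ifs with h
  · rfl
  · rw [Polynomial.notMem_support_iff.1 h]
    have : lin (0 : DiffPoly U) 0 = 0 := Polynomial.ext fun s => by rw [coeff_lin]; simp
    rw [this, zero_mul, map_zero]

/-- The free term `a₀` of the entry `Q 0 0` of a bivector that commutes with `P01` has a
self-adjoint operator `L ∘ dx`, where `L` is the linearization of `a₀` in the direction of
`u^1`. -/
theorem opAdj_lin_of_closed {Q : MatOp U} (hQ : IsSkew Q)
    (h : ∀ i j k, schouten (P01 U) Q i j k = 0) :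
    opAdj (lin ((Q 0 0).coeff 0) 0 * Polynomial.X) = lin ((Q 0 0).coeff 0) 0 * Polynomial.X := by
  have h1 := h 0 0 0
  have hadj : -opAdj (Q 0 0) = Q 0 0 := by rw [hQ 0 0, neg_neg]
  rw [schouten_eq, bracketDensity_P01, half_P01_right_zero _ _ _ (isFreq_X _) (isFreq_X _),
    half_P01_right_zero _ _ _ (isFreq_X _) (isFreq_X _),
    half_P01_right_zero _ _ _ (isFreq_X _) (isFreq_X _), map_add, map_add] at h1
  have h2 : elim (emb (freq U 0) (freq U 1) (u1Sym (Q 0 0)))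
      = -elim (emb (freq U 2) (freq U 1) (u1Sym (Q 0 0))) := by
    conv_lhs => rw [← hadj]
    rw [u1Sym_neg, map_neg, map_neg, elim_u1Sym_opAdj (l := 2) (by rw [totalFreq]; ring)]
  rw [h2] at h1
  have h3 := congrArg
    (MvPolynomial.aeval ![Polynomial.X, 0] : TriSymbol U →ₐ[DiffPoly U] DiffOp U) h1
  simp only [map_add, map_neg, map_zero, ← restrict₂_apply] at h3
  obtain ⟨T, hT⟩ := emb_u1Sym_eq (freq U 2) (freq U 1) (Q 0 0)
  obtain ⟨T', hT'⟩ := emb_u1Sym_eq (freq U 2) (freq U 0) (Q 0 0)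
  have h4 : restrict₂ (emb (freq U 1) (freq U 2) (u1Sym (Q 0 0))) = 0 := by
    rw [restrict₂_emb, u1Sym, Polynomial.sum, map_sum]
    refine Finset.sum_eq_zero fun m _ => ?_
    rw [map_mul, map_mul (Polynomial.aeval _), map_mul]
    simp
  rw [h4, hT, hT', map_add, map_add, restrict₂_X2_mul, restrict₂_X2_mul, ← act_one (isFreq_X _),
    ← act_one (isFreq_X _), restrict₂_act_X1, restrict₂_act_X0] at h3
  linear_combination h3

end Closed

/-! ### Trivial deformations of `P01` -/

section Trivial

variable {U : Opens (Fin 2 → ℝ)}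

theorem matOp_ext {P Q : MatOp U} (h00 : P 0 0 = Q 0 0) (h01 : P 0 1 = Q 0 1)
    (h10 : P 1 0 = Q 1 0) (h11 : P 1 1 = Q 1 1) : P = Q := by
  refine Matrix.ext fun i j => ?_
  fin_cases i <;> fin_cases j
  · exact h00
  · exact h01
  · exact h10
  · exact h11

theorem isSkew_P01 : IsSkew (P01 U) := by
  intro i j
  fin_cases i <;> fin_cases j <;> simp [P01, opAdj_dx, opAdj_zero]

theorem opDegree_dx : OpDegree 1 (dx : DiffOp U) := by
  rw [dx, ← Polynomial.monomial_one_one_eq_X]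
  refine opDegree_monomial (s := 0) rfl ?_
  simpa using hasDegree_C (U := U) 1

theorem hasOpDegree_P01 : HasOpDegree (P01 U) 1 := by
  rw [hasOpDegree_iff]
  intro i j
  fin_cases i <;> fin_cases j <;> simp [P01, opDegree_dx, opDegree_zero]

theorem evolOp_zero {n : ℕ} {U : Opens (Fin n → ℝ)} (ξ : VField U) : evolOp ξ 0 = 0 :=
  map_zero (evolOpHom ξ)

theorem evol_one {n : ℕ} {U : Opens (Fin n → ℝ)} (ξ : VField U) : evol ξ 1 = 0 := by
  rw [evol_eq_evo, Derivation.map_one_eq_zero]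

theorem evolOp_monomial {n : ℕ} {U : Opens (Fin n → ℝ)} (ξ : VField U) (m : ℕ) (a : DiffPoly U) :
    evolOp ξ (Polynomial.monomial m a) = Polynomial.monomial m (evol ξ a) := by
  rw [evolOp, Polynomial.sum_monomial_index (f := fun m a => Polynomial.monomial m (evol ξ a))]
  rw [evol_eq_evo, map_zero, map_zero]

theorem evolOp_dx {n : ℕ} {U : Opens (Fin n → ℝ)} (ξ : VField U) : evolOp ξ (dx : DiffOp U) = 0 := by
  rw [dx, ← Polynomial.monomial_one_one_eq_X, evolOp_monomial, evol_one, map_zero]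

/-- The Lie derivative of `P01` changes the entry `0 0` by an operator of the form `L^* - L`. -/
theorem lieD_P01_zero (ξ : VField U) : lieD ξ (P01 U) 0 0
    = opAdj (lin (ξ 0) 0 * Polynomial.X) - lin (ξ 0) 0 * Polynomial.X := by
  have h00 : P01 U 0 0 = dx := rfl
  have h10 : P01 U 1 0 = 0 := rfl
  have h01 : P01 U 0 1 = 0 := rfl
  rw [lieD_apply, Fin.sum_univ_two, Fin.sum_univ_two, h00, h10, h01, evolOp_dx, opComp_zero,
    zero_opComp, ← opComp_dx, opAdj_opComp, opAdj_dx, opComp_neg_left]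
  ring

theorem lieD_P01_one_zero (ξ : VField U) : lieD ξ (P01 U) 1 0 = -(lin (ξ 1) 0 * Polynomial.X) := by
  have h00 : P01 U 0 0 = dx := rfl
  have h10 : P01 U 1 0 = 0 := rfl
  have h11 : P01 U 1 1 = 0 := rfl
  rw [lieD_apply, Fin.sum_univ_two, Fin.sum_univ_two, h00, h10, h11, evolOp_zero, opComp_zero,
    zero_opComp, zero_opComp, ← opComp_dx]
  ring

theorem lieD_P01_one_one (ξ : VField U) : lieD ξ (P01 U) 1 1 = 0 := by
  have h01 : P01 U 0 1 = 0 := rfl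
  have h10 : P01 U 1 0 = 0 := rfl
  have h11 : P01 U 1 1 = 0 := rfl
  rw [lieD_apply, Fin.sum_univ_two, Fin.sum_univ_two, h01, h10, h11, evolOp_zero, opComp_zero,
    opComp_zero, zero_opComp, zero_opComp]
  ring

theorem coeff_lin_mul_X (f : DiffPoly U) (s : ℕ) :
    (lin f 0 * Polynomial.X).coeff (s + 1) = jetPartial 0 s f := by
  rw [Polynomial.coeff_mul_X, coeff_lin]

theorem coeff_lin_mul_X_zero (f : DiffPoly U) : (lin f 0 * Polynomial.X).coeff 0 = 0 :=
  Polynomial.coeff_mul_X_zero _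

theorem eq_zero_of_skew_two {A : DiffOp U} (hA : OpDegree 2 A) (h : opAdj A = -A)
    (h1 : A.coeff 1 = 0) : A = 0 := by
  obtain ⟨b, -, rfl⟩ := opDegree_two_skew_form hA h
  simp [opFun, dx] at h1
  simp [h1, opFun]

theorem eq_zero_of_skew_three {A : DiffOp U} (hA : OpDegree 3 A) (h : opAdj A = -A)
    (h3 : A.coeff 3 = 0) (h1 : A.coeff 1 = 0) : A = 0 := by
  obtain ⟨a, c, -, -, rfl⟩ := opDegree_three_skew_form hA h
  simp [opFun, dx, Polynomial.coeff_X_pow] at h1 h3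
  simp [h1, h3, opFun]

theorem opAdj_C {n : ℕ} {U : Opens (Fin n → ℝ)} (a : DiffPoly U) : opAdj (opFun a) = opFun a := by
  rw [opFun, ← Polynomial.monomial_zero_left, opAdj_monomial_zero]; rfl

theorem C_smul (c : ℝ) (f : SmoothFn U) :
    (MvPolynomial.C (c • f) : DiffPoly U) = c • MvPolynomial.C f := by
  exact (MvPolynomial.smul_monomial c).symm

theorem eq_zero_of_smul_eq_neg {R : Type*} [AddCommGroup R] [Module ℝ R] {c : ℝ} (hc : c ≠ 0)
    {x : R} (h : c • x = -(c • x)) : x = 0 := by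
  have h2 : (2 * c) • x = 0 := by
    rw [mul_smul, two_smul]
    nth_rw 1 [h]
    rw [neg_add_cancel]
  exact (smul_eq_zero.1 h2).resolve_left (by simpa using hc)

/-- Every bivector of degree two that commutes with `P01` is equivalent to a first normal form. -/
theorem exists_normalForm1 (hU : IsBox U) {Q : MatOp U} (hQ : IsSkew Q) (hd : HasOpDegree Q 2)
    (h : ∀ i j k, schouten (P01 U) Q i j k = 0) :
    ∃ ξ : VField U, (∀ i, HasDegree (ξ i) 1) ∧ ∃ p q r : SmoothFn U,
      FnOfU2 p ∧ FnOfU2 q ∧ FnOfU2 r ∧ Q + lieD ξ (P01 U) = normalForm1 p q r := by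
  have hd' := hasOpDegree_iff.1 hd
  -- the diagonal entry in the direction of `u^1`
  obtain ⟨b, hb, e00⟩ := opDegree_two_skew_form (hd' 0 0) (hQ 0 0)
  obtain ⟨b₁, b₂, rfl⟩ := hb.exists_one
  have hb₁ : b₁ = 0 := by
    have ha : (Q 0 0).coeff 0 = (1 / 2 : ℝ) • totalD (MvPolynomial.C b₁ * MvPolynomial.X (0, 0)
      + MvPolynomial.C b₂ * MvPolynomial.X (1, 0)) := by simp [e00, opFun, dx]
    have hM := opAdj_lin_of_closed hQ h
    obtain ⟨-, -, h3, -⟩ := coeff_opAdj (P := lin ((Q 0 0).coeff 0) 0 * Polynomial.X) (fun m hm => by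
      obtain ⟨k, rfl⟩ : ∃ k, m = k + 4 + 1 := ⟨m - 5, by omega⟩
      rw [coeff_lin_mul_X, ha]
      simp)
    rw [hM, coeff_lin_mul_X, coeff_lin_mul_X, ha] at h3
    simp at h3
    exact C_eq_zero (eq_zero_of_smul_eq_neg (by norm_num) h3)
  subst hb₁
  simp only [map_zero, zero_mul, zero_add] at e00
  -- the `u^1`-component of the field has to satisfy `L^* - L = -Q 0 0` with `L = lin (ξ 0) 0 ∘ d_x`
  obtain ⟨X, hX⟩ := hU.exists_partialD_eq 0 ((1 / 2 : ℝ) • b₂)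
  -- the `u^2`-component is a primitive of the coefficients of `Q 1 0` with respect to the jets of
  -- `u^1`, which exists by the symmetry of these coefficients
  obtain ⟨hA₀, hA⟩ := coeff_symm_of_closed hQ h
  obtain ⟨f₁, e2⟩ := ((hd' 1 0 2).2 0 rfl).exists_C
  obtain ⟨α, β, e1⟩ := ((hd' 1 0 1).2 1 rfl).exists_one
  obtain ⟨f₂, hf₂⟩ := hU.exists_partialD_eq 0 β
  have hα : partialD 0 f₁ = α := by
    have := hA 1 0
    rw [e2, e1] at this
    simpa using this
  set ξ : VField U := ![MvPolynomial.C X * MvPolynomial.X (1, 0),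
    MvPolynomial.C f₁ * MvPolynomial.X (0, 0) + MvPolynomial.C f₂ * MvPolynomial.X (1, 0)] with hξ
  have hξ₀ : ξ 0 = MvPolynomial.C X * MvPolynomial.X (1, 0) := rfl
  have hξ₁ : ξ 1 = MvPolynomial.C f₁ * MvPolynomial.X (0, 0)
    + MvPolynomial.C f₂ * MvPolynomial.X (1, 0) := rfl
  have hξd : ∀ i, HasDegree (ξ i) 1 := by
    have hx : ∀ (c : SmoothFn U) k, HasDegree (MvPolynomial.C c * MvPolynomial.X (k, 0)) 1 :=
      fun c k => (hasDegree_C c).mul (hasDegree_X (k, 0))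
    intro i
    fin_cases i
    · exact hx _ _
    · exact (hx _ _).add (hx _ _)
  have hskew : IsSkew (Q + lieD ξ (P01 U)) := hQ.add (isSkew_P01.lieD ξ)
  have hdeg := hasOpDegree_iff.1 (hd.add (hasOpDegree_P01.lieD hξd))
  have k00 : (Q + lieD ξ (P01 U)) 0 0 = 0 := by
    refine eq_zero_of_skew_two (hdeg 0 0) (hskew 0 0) ?_
    obtain ⟨-, -, -, -, h1, -⟩ := coeff_opAdj (P := lin (ξ 0) 0 * Polynomial.X) (fun m hm => by
      obtain ⟨k, rfl⟩ : ∃ k, m = k + 4 + 1 := ⟨m - 5, by omega⟩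
      rw [coeff_lin_mul_X, hξ₀]
      simp)
    rw [Matrix.add_apply, lieD_P01_zero, Polynomial.coeff_add, Polynomial.coeff_sub, h1, e00, hξ₀]
    simp only [coeff_lin_mul_X]
    simp [opFun, dx, hX, C_smul]
    module
  have k10 : (Q + lieD ξ (P01 U)) 1 0 = opFun ((Q 1 0).coeff 0) := by
    rw [Matrix.add_apply, lieD_P01_one_zero, ← sub_eq_add_neg]
    refine Polynomial.ext fun m => ?_
    match m with
    | 0 => rw [Polynomial.coeff_sub, coeff_lin_mul_X_zero]; simp [opFun]
    | 1 => rw [Polynomial.coeff_sub, coeff_lin_mul_X, hξ₁, e1]; simp [opFun, hα, hf₂]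
    | 2 => rw [Polynomial.coeff_sub, coeff_lin_mul_X, hξ₁, e2]; simp [opFun]
    | m + 3 =>
      rw [Polynomial.coeff_sub, coeff_lin_mul_X, hξ₁, (hd' 1 0 _).1 (by omega)]; simp [opFun]
  have k01 : (Q + lieD ξ (P01 U)) 0 1 = -opFun ((Q 1 0).coeff 0) := by
    rw [← opAdj_C, ← k10, hskew 0 1, neg_neg]
  obtain ⟨p, q, hp, hq, e0⟩ := hA₀.exists_two ((hd' 1 0 0).2 2 rfl)
  obtain ⟨b, -, e11⟩ := opDegree_two_skew_form (hd' 1 1) (hQ 1 1)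
  have hb : (Q 1 1).coeff 1 = b := by simp [e11, opFun, dx]
  obtain ⟨r, hr, er⟩ := (indepU1_of_closed h 1).exists_one ((hd' 1 1 1).2 1 rfl)
  refine ⟨ξ, hξd, p, q, r, hU.fnOfU2_of_partialD hp, hU.fnOfU2_of_partialD hq,
    hU.fnOfU2_of_partialD hr, matOp_ext k00 ?_ ?_ ?_⟩
  · rw [k01, e0, ← neg_inj, neg_neg]
    change opFun _ = -opFun (-(func p * jet U 1 2) - func q * jet U 1 1 ^ 2)
    rw [opFun, opFun, ← map_neg]
    congr 1
    simp only [func, jet]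
    ring
  · rw [k10, e0]
    rfl
  · rw [Matrix.add_apply, lieD_P01_one_one, add_zero, e11, ← hb, er]
    rfl

/-- The commutator `[∂/∂u^k_{(s)}, d_x] = ∂/∂u^k_{(s-1)}`. -/
theorem jetPartial_totalD_succ (k : Fin 2) (s : ℕ) (f : DiffPoly U) :
    jetPartial k (s + 1) (totalD f) = totalD (jetPartial k (s + 1) f) + jetPartial k s f := by
  have h : ⁅jetDer (U := U) k (s + 1), totalDer (U := U)⁆ = jetDer k s := by
    refine derivation_ext (fun c => ?_) fun v => ?_
    · rw [Derivation.commutator_apply]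
      simp only [jetDer_apply, totalDer_apply]
      cases s with
      | zero => fin_cases k <;> simp
      | succ s => simp
    · rw [Derivation.commutator_apply]
      simp only [jetDer_apply, totalDer_apply]
      obtain ⟨l, t⟩ := v
      cases s with
      | zero => by_cases h : l = k ∧ t = 0 <;> simp [apply_ite totalD]
      | succ s => simp [apply_ite totalD]
  have := DFunLike.congr_fun h f
  rw [Derivation.commutator_apply] at this
  simp only [jetDer_apply, totalDer_apply] at this
  linear_combination this

/-- The relation between the derivatives of the coefficients of an entry of degree three that the
self-adjointness in `opAdj_lin_of_closed` gives. -/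
theorem selfAdjoint_scalars {R : Type*} [CommRing R] [Algebra ℝ R] {t₁ t₂ t₃ : R}
    (h : (1 / 2 : ℝ) • (t₁ + t₂) - (1 / 4 : ℝ) • (t₃ + (t₃ + t₃))
      = -((1 / 2 : ℝ) • (t₁ + t₂) - (1 / 4 : ℝ) • (t₃ + (t₃ + t₃)))
        + 4 * ((1 / 2 : ℝ) • t₁ - (1 / 4 : ℝ) • t₃)) :
    t₂ = t₁ + (1 / 2 : ℝ) • t₃ := by
  have e : ∀ x : R, 4 * x = (4 : ℝ) • x := fun x => by
    rw [Algebra.smul_def, map_ofNat]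
  rw [e] at h
  linear_combination (norm := module) h

theorem half_scalars {R : Type*} [CommRing R] [Algebra ℝ R] {x y : R} (h : x * (1 + 1) = y) :
    x = (1 / 2 : ℝ) • y := half_smul_two_mul (by linear_combination h)

theorem jetPartial_totalD_zero (k : Fin 2) (f : DiffPoly U) :
    jetPartial k 0 (totalD f) = totalD (jetPartial k 0 f) := by
  have h : ⁅jetDer (U := U) k 0, totalDer (U := U)⁆ = 0 := by
    refine derivation_ext (fun c => ?_) fun v => ?_
    · rw [Derivation.commutator_apply]
      simp only [jetDer_apply, totalDer_apply]
      fin_cases k <;> simp [partialD_comm (U := U) 1 0]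
    · rw [Derivation.commutator_apply]
      simp only [jetDer_apply, totalDer_apply]
      simp
  have := DFunLike.congr_fun h f
  rw [Derivation.commutator_apply] at this
  simp only [jetDer_apply, totalDer_apply, Derivation.coe_zero, Pi.zero_apply] at this
  linear_combination this

/-- Every bivector of degree three that commutes with `P01` is equivalent to a second normal form
with `p = q = 0`. -/
theorem exists_normalForm2 (hU : IsBox U) {Q : MatOp U} (hQ : IsSkew Q) (hd : HasOpDegree Q 3)
    (h : ∀ i j k, schouten (P01 U) Q i j k = 0) :
    ∃ ξ : VField U, (∀ i, HasDegree (ξ i) 2) ∧ ∃ e g h l m n : SmoothFn U,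
      FnOfU2 e ∧ FnOfU2 g ∧ FnOfU2 h ∧ FnOfU2 l ∧ FnOfU2 m ∧ FnOfU2 n ∧
      Q + lieD ξ (P01 U) = normalForm2 0 0 e g h l m n := by
  have hd' := hasOpDegree_iff.1 hd
  -- the diagonal entry in the direction of `u^1`
  obtain ⟨a, c, ha, hc, e00⟩ := opDegree_three_skew_form (hd' 0 0) (hQ 0 0)
  have hq3 : (Q 0 0).coeff 3 = a := by
    simp [e00, opFun, dx, Polynomial.coeff_X_pow]
  have hq1 : (Q 0 0).coeff 1 = c := by
    simp [e00, opFun, dx, Polynomial.coeff_X_pow]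
  have hγ : jetPartial 0 1 c = totalD (jetPartial 0 2 c)
      + (1 / 2 : ℝ) • totalD (jetPartial 0 0 a) := by
    have ha₀ : (Q 0 0).coeff 0
        = (1 / 2 : ℝ) • totalD c - (1 / 4 : ℝ) • totalD (totalD (totalD a)) := by
      simp [e00, opFun, dx]
    have ha1 : ∀ s, jetPartial 0 (s + 1) a = 0 := by
      obtain ⟨a, rfl⟩ := ha.exists_C
      simp
    have hc3 : ∀ s, jetPartial 0 (s + 3) c = 0 := by
      obtain ⟨c₁, c₂, c₃, c₄, c₅, rfl⟩ := hc.exists_two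
      simp [pow_two]
    obtain ⟨-, -, h3, -⟩ := coeff_opAdj (P := lin ((Q 0 0).coeff 0) 0 * Polynomial.X) (fun m hm => by
      obtain ⟨k, rfl⟩ : ∃ k, m = k + 4 + 1 := ⟨m - 5, by omega⟩
      rw [coeff_lin_mul_X, ha₀]
      simp only [jetPartial_sub, jetPartial_smul, jetPartial_totalD_succ, ha1, hc3, totalD_zero,
        add_zero, smul_zero, sub_zero])
    rw [opAdj_lin_of_closed hQ h, coeff_lin_mul_X, coeff_lin_mul_X, ha₀] at h3
    have e1 := ha1 0
    have e2 := ha1 1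
    have e3 := ha1 2
    have e4 := hc3 0
    simp only [zero_add, Nat.reduceAdd] at e1 e2 e3 e4
    simp only [jetPartial_sub, jetPartial_smul, jetPartial_totalD_succ, e1, e2, e3, e4,
      totalD_zero, zero_add, totalD_sub, totalD_smul,
      jetPartial_totalD_zero, Nat.reduceAdd] at h3
    exact selfAdjoint_scalars h3
  obtain ⟨a, rfl⟩ := ha.exists_C
  obtain ⟨c₁, c₂, c₃, c₄, c₅, rfl⟩ := hc.exists_two
  have hc₃ : c₃ = (1 / 2 : ℝ) • partialD 0 c₁ + (1 / 4 : ℝ) • partialD 0 (partialD 0 a) := by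
    have := congrArg (jetPartial 0 1) hγ
    simp [pow_two] at this
    refine MvPolynomial.C_injective (Fin 2 × ℕ) _ ?_
    rw [half_scalars this, map_add, C_smul, C_smul]
    module
  have hc₄ : c₄ = partialD 1 c₁ + (1 / 2 : ℝ) • partialD 1 (partialD 0 a) := by
    have := congrArg (jetPartial 1 1) hγ
    simp [pow_two] at this
    refine MvPolynomial.C_injective (Fin 2 × ℕ) _ ?_
    rw [this, map_add, C_smul (U := U)]
    norm_num
  -- the `u^1`-component of the field removes the coefficients `a` of `d_x^3` and `c` of `d_x` in
  -- `Q 0 0`; by `hc₃` and `hc₄` only the coefficient of `(u^2_x)^2` needs an integration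
  obtain ⟨X, hX⟩ := hU.exists_partialD_eq 0 ((1 / 2 : ℝ) • (c₅ - partialD 1 c₂))
  -- the `u^2`-component is a primitive of the coefficients of `Q 1 0` with respect to the jets of
  -- `u^1`, which exists by the symmetry of these coefficients
  obtain ⟨hA₀, hA⟩ := coeff_symm_of_closed hQ h
  obtain ⟨f₁, e3⟩ := ((hd' 1 0 3).2 0 rfl).exists_C
  obtain ⟨a₁, a₂, e2⟩ := ((hd' 1 0 2).2 1 rfl).exists_one
  obtain ⟨g₁, g₂, g₃, g₄, g₅, e1⟩ := ((hd' 1 0 1).2 2 rfl).exists_two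
  obtain ⟨f₂, hf₂⟩ := hU.exists_partialD_eq 0 g₂
  obtain ⟨f₅, hf₅⟩ := hU.exists_partialD_eq 0 g₅
  have hA20 := hA 2 0
  have hA10 := hA 1 0
  rw [e3, e1] at hA20
  rw [e2, e1] at hA10
  have k₁ := congrArg (jetPartial 0 1) hA10
  have k₂ := congrArg (jetPartial 1 1) hA10
  simp [pow_two] at hA20 k₁ k₂
  have hg₃ := half_scalars k₁.symm
  set ξ : VField U := ![MvPolynomial.C ((1 / 2 : ℝ) • a) * MvPolynomial.X (0, 1)
      + MvPolynomial.C ((5 / 8 : ℝ) • partialD 0 a - (1 / 4 : ℝ) • c₁) * MvPolynomial.X (0, 0) ^ 2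
      + MvPolynomial.C ((3 / 4 : ℝ) • partialD 1 a - (1 / 2 : ℝ) • c₂)
        * (MvPolynomial.X (0, 0) * MvPolynomial.X (1, 0))
      + MvPolynomial.C X * MvPolynomial.X (1, 0) ^ 2,
    MvPolynomial.C f₁ * MvPolynomial.X (0, 1) + MvPolynomial.C f₂ * MvPolynomial.X (1, 1)
      + MvPolynomial.C ((1 / 2 : ℝ) • a₁) * MvPolynomial.X (0, 0) ^ 2
      + MvPolynomial.C a₂ * (MvPolynomial.X (0, 0) * MvPolynomial.X (1, 0))
      + MvPolynomial.C f₅ * MvPolynomial.X (1, 0) ^ 2] with hξ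
  have hξ₀ : ξ 0 = MvPolynomial.C ((1 / 2 : ℝ) • a) * MvPolynomial.X (0, 1)
      + MvPolynomial.C ((5 / 8 : ℝ) • partialD 0 a - (1 / 4 : ℝ) • c₁) * MvPolynomial.X (0, 0) ^ 2
      + MvPolynomial.C ((3 / 4 : ℝ) • partialD 1 a - (1 / 2 : ℝ) • c₂)
        * (MvPolynomial.X (0, 0) * MvPolynomial.X (1, 0))
      + MvPolynomial.C X * MvPolynomial.X (1, 0) ^ 2 := rfl
  have hξ₁ : ξ 1 = MvPolynomial.C f₁ * MvPolynomial.X (0, 1)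
      + MvPolynomial.C f₂ * MvPolynomial.X (1, 1)
      + MvPolynomial.C ((1 / 2 : ℝ) • a₁) * MvPolynomial.X (0, 0) ^ 2
      + MvPolynomial.C a₂ * (MvPolynomial.X (0, 0) * MvPolynomial.X (1, 0))
      + MvPolynomial.C f₅ * MvPolynomial.X (1, 0) ^ 2 := rfl
  have hξd : ∀ i, HasDegree (ξ i) 2 := by
    have hx : ∀ (c : SmoothFn U) (f : DiffPoly U), HasDegree f 2 →
        HasDegree (MvPolynomial.C c * f) 2 := fun c f hf => by
      simpa using (hasDegree_C c).mul hf
    have hx2 : ∀ k l : Fin 2, HasDegree (MvPolynomial.X (k, 0) * MvPolynomial.X (l, 0)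
      : DiffPoly U) 2 := fun k l => (hasDegree_X (k, 0)).mul (hasDegree_X (l, 0))
    intro i
    fin_cases i
    · change HasDegree (ξ 0) 2
      rw [hξ₀, pow_two, pow_two]
      exact (((hx _ _ (hasDegree_X (0, 1))).add (hx _ _ (hx2 0 0))).add (hx _ _ (hx2 0 1))).add
        (hx _ _ (hx2 1 1))
    · change HasDegree (ξ 1) 2
      rw [hξ₁, pow_two, pow_two]
      exact ((((hx _ _ (hasDegree_X (0, 1))).add (hx _ _ (hasDegree_X (1, 1)))).add
        (hx _ _ (hx2 0 0))).add (hx _ _ (hx2 0 1))).add (hx _ _ (hx2 1 1))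
  have hskew : IsSkew (Q + lieD ξ (P01 U)) := hQ.add (isSkew_P01.lieD ξ)
  have hdeg := hasOpDegree_iff.1 (hd.add (hasOpDegree_P01.lieD hξd))
  have k00 : (Q + lieD ξ (P01 U)) 0 0 = 0 := by
    obtain ⟨-, -, h3, -, h1, -⟩ := coeff_opAdj (P := lin (ξ 0) 0 * Polynomial.X) (fun m hm => by
      obtain ⟨k, rfl⟩ : ∃ k, m = k + 4 + 1 := ⟨m - 5, by omega⟩
      rw [coeff_lin_mul_X, hξ₀]
      simp [pow_two])
    refine eq_zero_of_skew_three (hdeg 0 0) (hskew 0 0) ?_ ?_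
    · rw [Matrix.add_apply, lieD_P01_zero, Polynomial.coeff_add, Polynomial.coeff_sub, h3, hq3, hξ₀]
      simp only [coeff_lin_mul_X]
      simp [pow_two, C_smul]
      module
    · rw [Matrix.add_apply, lieD_P01_zero, Polynomial.coeff_add, Polynomial.coeff_sub, h1, hq1, hξ₀]
      simp only [coeff_lin_mul_X]
      simp [pow_two, C_smul, hX, hc₃, hc₄, partialD_comm (U := U) 1 0]
      -- all the rational scalars are multiples of `1 / 8`
      obtain ⟨t, ht⟩ : ∃ t : DiffPoly U, t = algebraMap ℝ (DiffPoly U) (1 / 8) := ⟨_, rfl⟩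
      have h8 : 8 * t = 1 := by
        rw [ht, ← map_ofNat (algebraMap ℝ (DiffPoly U)) 8, ← map_mul]
        norm_num
      have e : ∀ (n : ℕ) (c : ℝ) (x : DiffPoly U), c = n * (1 / 8) → c • x = n * t * x := by
        rintro n c x rfl
        rw [Algebra.smul_def, map_mul, map_natCast, ht]
      simp only [e 4 2⁻¹ _ (by norm_num), e 2 4⁻¹ _ (by norm_num), e 6 (3 / 4) _ (by norm_num),
        e 5 (5 / 8) _ (by norm_num)]
      push_cast
      linear_combination (-(MvPolynomial.C c₁ * MvPolynomial.X (0, 1)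
        + MvPolynomial.C c₂ * MvPolynomial.X (1, 1)
        + MvPolynomial.C (partialD 1 c₁) * MvPolynomial.X (0, 0) * MvPolynomial.X (1, 0)
        + MvPolynomial.C c₅ * MvPolynomial.X (1, 0) ^ 2)) * h8
  have k10 : (Q + lieD ξ (P01 U)) 1 0 = opFun ((Q 1 0).coeff 0) := by
    rw [Matrix.add_apply, lieD_P01_one_zero, ← sub_eq_add_neg]
    refine Polynomial.ext fun m => ?_
    match m with
    | 0 => rw [Polynomial.coeff_sub, coeff_lin_mul_X_zero]; simp [opFun]
    | 1 =>
      rw [Polynomial.coeff_sub, coeff_lin_mul_X, hξ₁, e1]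
      simp [opFun, pow_two, hf₂, hf₅, C_smul]
      rw [hg₃, hA20, k₂, smul_mul_assoc]
      module
    | 2 =>
      rw [Polynomial.coeff_sub, coeff_lin_mul_X, hξ₁, e2]
      simp [opFun, pow_two, C_smul]
      rw [mul_add]
      module
    | 3 => rw [Polynomial.coeff_sub, coeff_lin_mul_X, hξ₁, e3]; simp [opFun, pow_two]
    | m + 4 =>
      rw [Polynomial.coeff_sub, coeff_lin_mul_X, hξ₁, (hd' 1 0 _).1 (by omega)]
      simp [opFun, pow_two]
  have k01 : (Q + lieD ξ (P01 U)) 0 1 = -opFun ((Q 1 0).coeff 0) := by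
    rw [← opAdj_C, ← k10, hskew 0 1, neg_neg]
  obtain ⟨l, m, n, hl, hm, hn, e0⟩ := hA₀.exists_three ((hd' 1 0 0).2 3 rfl)
  obtain ⟨e, c', -, -, e11⟩ := opDegree_three_skew_form (hd' 1 1) (hQ 1 1)
  have he : (Q 1 1).coeff 3 = e := by
    simp [e11, opFun, dx, Polynomial.coeff_X_pow]
  have hc' : (Q 1 1).coeff 1 = c' := by
    simp [e11, opFun, dx, Polynomial.coeff_X_pow]
  obtain ⟨e, he', er⟩ := (indepU1_of_closed h 3).exists_C ((hd' 1 1 3).2 0 rfl)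
  obtain ⟨g, h', hg, hh', egh⟩ := (indepU1_of_closed h 1).exists_two ((hd' 1 1 1).2 2 rfl)
  refine ⟨ξ, hξd, e, g, h', l, m, n, hU.fnOfU2_of_partialD he', hU.fnOfU2_of_partialD hg,
    hU.fnOfU2_of_partialD hh', hU.fnOfU2_of_partialD hl, hU.fnOfU2_of_partialD hm,
    hU.fnOfU2_of_partialD hn, matOp_ext k00 ?_ ?_ ?_⟩
  · rw [k01, e0]
    change -opFun _ = opFun (eta12 0 0 l m n)
    rw [opFun, opFun, ← map_neg]
    congr 1
    simp [eta12, func, jet]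
    ring
  · rw [k10, e0]
    change opFun _ = -opFun (eta12 0 0 l m n)
    rw [opFun, opFun, ← map_neg]
    congr 1
    simp [eta12, func, jet]
    ring
  · have hD : totalD (MvPolynomial.C e : DiffPoly U) = func (prime e) * jet U 1 1 := by
      simp [he', func, jet, prime]
    rw [Matrix.add_apply, lieD_P01_one_one, add_zero, e11, ← he, ← hc', er, egh, hD]
    rfl

end Trivial

/-! ### The normal forms -/

section NormalForms

variable {U : Opens (Fin 2 → ℝ)}

theorem IndepU1.add {f g : DiffPoly U} (hf : IndepU1 f) (hg : IndepU1 g) : IndepU1 (f + g) :=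
  fun s => by rw [jetPartial_add, hf, hg, add_zero]

theorem IndepU1.neg {f : DiffPoly U} (hf : IndepU1 f) : IndepU1 (-f) :=
  fun s => by rw [jetPartial_neg, hf, neg_zero]

theorem IndepU1.sub {f g : DiffPoly U} (hf : IndepU1 f) (hg : IndepU1 g) : IndepU1 (f - g) :=
  fun s => by rw [jetPartial_sub, hf, hg, sub_zero]

theorem IndepU1.smul {f : DiffPoly U} (hf : IndepU1 f) (c : ℝ) : IndepU1 (c • f) :=
  fun s => by rw [jetPartial_smul, hf, smul_zero]

theorem IndepU1.mul {f g : DiffPoly U} (hf : IndepU1 f) (hg : IndepU1 g) : IndepU1 (f * g) :=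
  fun s => by rw [jetPartial_mul, hf, hg, zero_mul, mul_zero, add_zero]

theorem IndepU1.totalD {f : DiffPoly U} (hf : IndepU1 f) : IndepU1 (totalD f)
  | 0 => by rw [jetPartial_totalD_zero, hf, totalD_zero]
  | s + 1 => by rw [jetPartial_totalD_succ, hf, hf, totalD_zero, add_zero]

theorem indepU1_zero : IndepU1 (0 : DiffPoly U) := fun _ => jetPartial_zero _ _

theorem FnOfU2.indepU1 {f : SmoothFn U} (hf : FnOfU2 f) : IndepU1 (func f)
  | 0 => by rw [func, jetPartial_C_zero, hf.partialD, map_zero]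
  | s + 1 => jetPartial_C_succ _ _ _

theorem indepU1_jet (s : ℕ) : IndepU1 (jet U 1 (s + 1))
  | 0 => jetPartial_X_zero _ _
  | t + 1 => by rw [jet, jetPartial_X_succ]; simp

/-- The coefficients of the operator `A` do not depend on the jets of `u^1`. -/
def OpIndepU1 (A : DiffOp U) : Prop := ∀ m, IndepU1 (A.coeff m)

theorem OpIndepU1.add {A B : DiffOp U} (hA : OpIndepU1 A) (hB : OpIndepU1 B) : OpIndepU1 (A + B) :=
  fun m => by rw [Polynomial.coeff_add]; exact (hA m).add (hB m)

theorem opIndepU1_opFun_mul {a : DiffPoly U} (ha : IndepU1 a) (k : ℕ) :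
    OpIndepU1 (opFun a * dx ^ k) := fun m => by
  rw [opFun, dx, Polynomial.coeff_C_mul_X_pow]
  split_ifs
  · exact ha
  · exact indepU1_zero

theorem opIndepU1_opFun {a : DiffPoly U} (ha : IndepU1 a) : OpIndepU1 (opFun a) := by
  simpa using opIndepU1_opFun_mul ha 0

theorem opIndepU1_zero : OpIndepU1 (0 : DiffOp U) := fun m => by
  rw [Polynomial.coeff_zero]; exact indepU1_zero

/-- Bivectors that do not depend on `u^1` commute with `P01`. -/
theorem schouten_P01_eq_zero {Q : MatOp U} (hQ : ∀ i j, OpIndepU1 (Q i j)) (i j k : Fin 2) :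
    schouten (P01 U) Q i j k = 0 := by
  have h : ∀ i j k (a b : Fin 3), half Q (P01 U) i j k (freq U a) (freq U b) = 0 := by
    intro i j k a b
    fin_cases k
    · simp only [Fin.zero_eta]
      rw [half_P01_right_zero _ _ _ (isFreq_X _) (isFreq_X _), u1Sym_eq_zero (hQ i j), map_zero]
    · exact half_P01_right_one _ _ _ _
  rw [schouten_eq, bracketDensity_P01, h, h, h]
  simp

/-- The component `1 1 1` of a bracket with `P01` vanishes, as the second column of `P01` is zero. -/
theorem schouten_P01_one (Q : MatOp U) : schouten (P01 U) Q 1 1 1 = 0 := by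
  rw [schouten_eq, bracketDensity_P01, half_P01_right_one, half_P01_right_one, half_P01_right_one]
  simp

theorem opAdj_skew_two (b : DiffPoly U) :
    opAdj (opFun b * dx + opFun ((1 / 2 : ℝ) • totalD b))
      = -(opFun b * dx + opFun ((1 / 2 : ℝ) • totalD b)) := by
  have h := opAdj_skew_three (U := U) 0 b
  simpa [opFun] using h

theorem opDegree_opFun_mul {a : DiffPoly U} {s d : ℕ} (ha : HasDegree a s) (m : ℕ) (h : m + s = d) :
    OpDegree d (opFun a * dx ^ m) := by
  rw [opFun, dx, Polynomial.C_mul_X_pow_eq_monomial]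
  exact opDegree_monomial h ha

theorem opDegree_opFun {a : DiffPoly U} {d : ℕ} (ha : HasDegree a d) : OpDegree d (opFun a) := by
  simpa using opDegree_opFun_mul ha 0 (zero_add d)

theorem HasDegree.func_mul {f : DiffPoly U} {d : ℕ} (hf : HasDegree f d) (c : SmoothFn U) :
    HasDegree (func c * f) d := by
  have h := (hasDegree_C c).mul hf
  rwa [zero_add] at h

/-- The entry of `normalForm1` below the diagonal. -/
def eta21 (p q : SmoothFn U) : DiffPoly U := func p * jet U 1 2 + func q * jet U 1 1 ^ 2

theorem hasDegree_eta21 (p q : SmoothFn U) : HasDegree (eta21 p q) 2 := by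
  rw [eta21, pow_two]
  exact ((hasDegree_jet 1 2).func_mul p).add
    (((hasDegree_jet 1 1).mul (hasDegree_jet 1 1)).func_mul q)

theorem FnOfU2.indepU1_eta21 {p q : SmoothFn U} (hp : FnOfU2 p) (hq : FnOfU2 q) :
    IndepU1 (eta21 p q) := by
  rw [eta21, pow_two]
  exact (hp.indepU1.mul (indepU1_jet 1)).add (hq.indepU1.mul ((indepU1_jet 0).mul (indepU1_jet 0)))

theorem normalForm1_zero_one (p q r : SmoothFn U) :
    normalForm1 p q r 0 1 = -opFun (eta21 p q) := by
  change opFun _ = _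
  rw [opFun, opFun, ← map_neg]
  congr 1
  simp only [eta21]
  ring

theorem normalForm1_one_zero (p q r : SmoothFn U) :
    normalForm1 p q r 1 0 = opFun (eta21 p q) := rfl

theorem normalForm1_one_one (p q r : SmoothFn U) : normalForm1 p q r 1 1
    = opFun (func r * jet U 1 1) * dx + opFun ((1 / 2 : ℝ) • totalD (func r * jet U 1 1)) := rfl

theorem normalForm1_one_one_zero (p q : SmoothFn U) : normalForm1 p q 0 1 1 = 0 := by
  rw [normalForm1_one_one]
  simp [func, opFun]

theorem normalForm1_zero_zero (p q r : SmoothFn U) : normalForm1 p q r 0 0 = 0 := rfl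

theorem isSkew_normalForm1 (p q r : SmoothFn U) : IsSkew (normalForm1 p q r) := by
  intro i j
  fin_cases i <;> fin_cases j
  · simp [normalForm1_zero_zero, opAdj_zero]
  · simp [normalForm1_zero_one, normalForm1_one_zero, opAdj_C]
  · simp [normalForm1_zero_one, normalForm1_one_zero, opAdj_C, opAdj_neg]
  · exact opAdj_skew_two _

theorem hasOpDegree_normalForm1 (p q r : SmoothFn U) : HasOpDegree (normalForm1 p q r) 2 := by
  have hb : HasDegree (func r * jet U 1 1) 1 := (hasDegree_jet 1 1).func_mul r
  rw [hasOpDegree_iff]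
  intro i j
  fin_cases i <;> fin_cases j
  · exact opDegree_zero 2
  · simpa [normalForm1_zero_one] using (opDegree_opFun (hasDegree_eta21 p q)).neg
  · exact opDegree_opFun (hasDegree_eta21 p q)
  · refine OpDegree.add ?_ (opDegree_opFun (hb.totalD.smul _))
    have h := opDegree_opFun_mul hb 1 (d := 2) rfl
    rwa [pow_one] at h

theorem schouten_P01_normalForm1 {p q r : SmoothFn U} (hp : FnOfU2 p) (hq : FnOfU2 q)
    (hr : FnOfU2 r) (i j k : Fin 2) : schouten (P01 U) (normalForm1 p q r) i j k = 0 := by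
  have hA := hp.indepU1_eta21 hq
  have hb : IndepU1 (func r * jet U 1 1) := hr.indepU1.mul (indepU1_jet 0)
  refine schouten_P01_eq_zero (fun i j => ?_) i j k
  fin_cases i <;> fin_cases j
  · exact opIndepU1_zero
  · have := opIndepU1_opFun hA.neg
    simpa [normalForm1_zero_one, opFun] using this
  · exact opIndepU1_opFun hA
  · refine OpIndepU1.add ?_ (opIndepU1_opFun (hb.totalD.smul _))
    have h := opIndepU1_opFun_mul hb 1
    rwa [pow_one] at h

theorem normalForm2_one_one (p q e g h l m n : SmoothFn U) : normalForm2 p q e g h l m n 1 1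
    = opFun (func e) * dx ^ 3
      + opFun ((3 / 2 : ℝ) • (func (prime e) * jet U 1 1)) * dx ^ 2
      + opFun (gamma22 g h) * dx
      + opFun (eta22 e g h) := rfl

theorem totalD_func_of_fnOfU2 {e : SmoothFn U} (he : FnOfU2 e) :
    totalD (func e) = func (prime e) * jet U 1 1 := by
  simp [he.partialD, func, jet, prime]

theorem normalForm2_one_one_eq {p q e g h l m n : SmoothFn U} (he : FnOfU2 e) :
    normalForm2 p q e g h l m n 1 1
      = opFun (func e) * dx ^ 3 + opFun ((3 / 2 : ℝ) • totalD (func e)) * dx ^ 2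
        + opFun (gamma22 g h) * dx
        + opFun ((1 / 2 : ℝ) • totalD (gamma22 g h)
          - (1 / 4 : ℝ) • totalD (totalD (totalD (func e)))) := by
  rw [totalD_func_of_fnOfU2 he]
  rfl

theorem normalForm2_zero_zero (p q e g h l m n : SmoothFn U) :
    normalForm2 p q e g h l m n 0 0 = 0 := rfl

theorem normalForm2_zero_one (p q e g h l m n : SmoothFn U) :
    normalForm2 p q e g h l m n 0 1 = opFun (eta12 p q l m n) := rfl

theorem normalForm2_one_zero (p q e g h l m n : SmoothFn U) :
    normalForm2 p q e g h l m n 1 0 = -opFun (eta12 p q l m n) := rfl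

theorem isSkew_normalForm2 {p q e g h l m n : SmoothFn U} (he : FnOfU2 e) :
    IsSkew (normalForm2 p q e g h l m n) := by
  intro i j
  fin_cases i <;> fin_cases j
  · simp [normalForm2_zero_zero, opAdj_zero]
  · simp [normalForm2_zero_one, normalForm2_one_zero, opAdj_C, opAdj_neg]
  · simp [normalForm2_zero_one, normalForm2_one_zero, opAdj_C]
  · simp only [Fin.mk_one]
    rw [normalForm2_one_one_eq he]
    exact opAdj_skew_three _ _

theorem hasDegree_gamma22 (g h : SmoothFn U) : HasDegree (gamma22 g h) 2 := by
  rw [gamma22, pow_two]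
  exact ((hasDegree_jet 1 2).func_mul g).add
    (((hasDegree_jet 1 1).mul (hasDegree_jet 1 1)).func_mul h)

theorem hasDegree_eta12 (p q l m n : SmoothFn U) : HasDegree (eta12 p q l m n) 3 := by
  have h1 := hasDegree_jet (U := U) 1 1
  have h0 := hasDegree_jet (U := U) 0 1
  have h2 := hasDegree_jet (U := U) 1 2
  have h3 : HasDegree (jet U 1 1 ^ 3) 3 := by
    rw [pow_succ, pow_two]; exact (h1.mul h1).mul h1
  have h4 : HasDegree (jet U 1 1 ^ 2) 2 := by
    rw [pow_two]; exact h1.mul h1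
  rw [eta12]
  refine ((((hasDegree_jet 1 3).func_mul _).add ?_).add ?_ |>.add (h3.func_mul _)).add ?_
  · rw [mul_assoc]; exact (h0.mul h4).func_mul _
  · rw [mul_assoc]; exact (h0.mul h2).func_mul _
  · rw [mul_assoc]; exact (h1.mul h2).func_mul _

theorem hasOpDegree_normalForm2 {p q e g h l m n : SmoothFn U} (he : FnOfU2 e) :
    HasOpDegree (normalForm2 p q e g h l m n) 3 := by
  have he0 : HasDegree (func e) 0 := hasDegree_C e
  rw [hasOpDegree_iff]
  intro i j
  fin_cases i <;> fin_cases j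
  · exact opDegree_zero 3
  · exact opDegree_opFun (hasDegree_eta12 p q l m n)
  · exact (opDegree_opFun (hasDegree_eta12 p q l m n)).neg
  · simp only [Fin.mk_one]
    rw [normalForm2_one_one_eq he]
    refine (((opDegree_opFun_mul he0 3 rfl).add
      (opDegree_opFun_mul (he0.totalD.smul _) 2 rfl)).add ?_).add
      (opDegree_opFun (((hasDegree_gamma22 g h).totalD.smul _).sub (he0.totalD.totalD.totalD.smul _)))
    simpa using opDegree_opFun_mul (hasDegree_gamma22 g h) 1 rfl

theorem opIndepU1_normalForm2_one_one {p q e g h l m n : SmoothFn U} (he : FnOfU2 e)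
    (hg : FnOfU2 g) (hh : FnOfU2 h) : OpIndepU1 (normalForm2 p q e g h l m n 1 1) := by
  have hc : IndepU1 (gamma22 g h) := by
    rw [gamma22, pow_two]
    exact (hg.indepU1.mul (indepU1_jet 1)).add
      (hh.indepU1.mul ((indepU1_jet 0).mul (indepU1_jet 0)))
  rw [normalForm2_one_one_eq he]
  refine (((opIndepU1_opFun_mul he.indepU1 3).add
      (opIndepU1_opFun_mul (he.indepU1.totalD.smul _) 2)).add ?_).add
      (opIndepU1_opFun ((hc.totalD.smul _).sub (he.indepU1.totalD.totalD.totalD.smul _)))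
  simpa using opIndepU1_opFun_mul hc 1

/-! ### The bracket of the first normal form with itself -/

theorem evR_totalD {n : ℕ} {U : Opens (Fin n → ℝ)} (y : FreqRing U) (v : Fin n → FreqRing U)
    (b : DiffPoly U) :
    evR y v (MvPolynomial.C (totalD b)) = dFreq y (evR y v (MvPolynomial.C b)) := by
  have h := evR_dFreq (z := y) isFreq_zero v (MvPolynomial.C b)
  rw [dFreq_apply, symD_C, zero_mul, add_zero, zero_add] at h
  exact h

theorem opComp_add_left {n : ℕ} {U : Opens (Fin n → ℝ)} (A B D : DiffOp U) :
    opComp (A + B) D = opComp A D + opComp B D := by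
  simp only [opComp_eq, map_add]

theorem opComp_opFun_mul {n : ℕ} {U : Opens (Fin n → ℝ)} (a : DiffPoly U) (A B : DiffOp U) :
    opComp (opFun a * A) B = opFun a * opComp A B := by
  have h : ∀ A : DiffOp U, opFun a * A = a • A := fun A => by
    rw [opFun, Polynomial.smul_eq_C_mul]
  rw [h, h, opComp_eq, opComp_eq, map_smul]

/-- The half bracket of a bivector with itself in the direction of a skew-adjoint entry of degree
two. -/
theorem symHalf_self_of_skew_two {N : MatOp U} {i j k : Fin 2} {b : DiffPoly U}
    (hN : N i j = opFun b * dx + opFun ((1 / 2 : ℝ) • totalD b)) {z y : FreqRing U} (hz : IsFreq z)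
    {E : DiffOp U} (hE : E = ∑ l, opComp (lin b l) (N l k)) :
    symHalf N N i j k z y
      = act y (dxComp E) 1 + (z * act y E 1 + z * act y E 1) := by
  have h1 : act z (N i j) 1 = MvPolynomial.C b * z + (1 / 2 : ℝ) • MvPolynomial.C (totalD b) := by
    rw [hN, act_one hz]
    simp only [opFun, dx, map_add, map_mul, Polynomial.aeval_C, Polynomial.aeval_X,
      MvPolynomial.algebraMap_eq]
    congr 1
    exact (MvPolynomial.smul_monomial _).symm
  have h2 : evR y (fun l => act y (N l k) 1) (MvPolynomial.C b) = act y E 1 := by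
    rw [evR_eq_sum_act, hE, act_sum]
    simp only [act_opComp]
  have h3 : half N N i j k z y = z * act y E 1 + (1 / 2 : ℝ) • act y (dxComp E) 1 := by
    rw [half, h1, map_add, Derivation.leibniz, hz.evR, h2, Derivation.map_smul, evR_totalD, h2,
      act_dxComp]
    simp
  rw [symHalf, h3]
  module

/-- If the component `1 1 1` of the bracket of the first normal form with itself vanishes, then
`r = 0`: after elimination of the first frequency, the coefficient of the cube of the second one
is `2 r^2 u²_x` up to sign. -/
theorem eq_zero_of_schouten_normalForm1 {p q r : SmoothFn U} (hr : FnOfU2 r)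
    (h : schouten (normalForm1 p q r) (normalForm1 p q r) 1 1 1 = 0) : r = 0 := by
  set N := normalForm1 p q r with hN
  set b : DiffPoly U := func r * jet U 1 1 with hb
  have hN11 : N 1 1 = opFun b * dx + opFun ((1 / 2 : ℝ) • totalD b) := rfl
  set E : DiffOp U := ∑ l, opComp (lin b l) (N l 1) with hE
  have hbi : IndepU1 b := hr.indepU1.mul (indepU1_jet 0)
  have hl0 : lin b 0 = 0 := Polynomial.ext fun s => by rw [coeff_lin, hbi s]; simp
  have hl1 : lin b 1 = opFun (func r) * dx + opFun (func (prime r) * jet U 1 1) := by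
    refine Polynomial.ext fun s => ?_
    rw [coeff_lin, hb]
    match s with
    | 0 => simp [func, jet, opFun, dx, prime]
    | 1 => simp [func, jet, opFun, dx]
    | s + 2 => simp [func, jet, opFun, dx]
  have hE' : E = opFun (func r) * dxComp (N 1 1) + opFun (func (prime r) * jet U 1 1) * N 1 1 := by
    rw [hE, Fin.sum_univ_two, hl0, zero_opComp, hl1, opComp_add_left, opComp_opFun_mul, dx_opComp,
      opComp_C, zero_add]
  have c1 : (N 1 1).coeff 1 = b := by rw [hN11]; simp [opFun, dx]
  have c2 : ∀ m, (N 1 1).coeff (m + 2) = 0 := fun m => by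
    rw [hN11]; simp [opFun, dx]
  have e2 : E.coeff 2 = func r * b := by
    rw [hE', Polynomial.coeff_add, opFun, opFun, Polynomial.coeff_C_mul, Polynomial.coeff_C_mul,
      coeff_dxComp_succ, c1, c2 0]
    simp
  have e3 : ∀ m, E.coeff (m + 3) = 0 := fun m => by
    rw [hE', Polynomial.coeff_add, opFun, opFun, Polynomial.coeff_C_mul, Polynomial.coeff_C_mul,
      coeff_dxComp_succ, c2 (m + 1), c2 m]
    simp
  have d3 : (dxComp E).coeff 3 = func r * b := by rw [coeff_dxComp_succ, e3 0, e2]; simp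
  have d4 : ∀ m, (dxComp E).coeff (m + 4) = 0 := fun m => by
    rw [coeff_dxComp_succ, e3 (m + 1), e3 m]; simp
  obtain ⟨-, -, a3, -⟩ := coeff_opAdj (P := dxComp E) fun m hm => by
    obtain ⟨k, rfl⟩ : ∃ k, m = k + 1 + 4 := ⟨m - 5, by omega⟩
    exact d4 (k + 1)
  rw [d3, d4 0, totalD_zero, mul_zero, add_zero] at a3
  rw [schouten_eq, bracketDensity, symHalf_self_of_skew_two hN11 (isFreq_X _) hE,
    symHalf_self_of_skew_two hN11 (isFreq_X _) hE, symHalf_self_of_skew_two hN11 (isFreq_X _) hE] at h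
  have h' := congrArg
    (MvPolynomial.aeval ![Polynomial.X, 0] : TriSymbol U →ₐ[DiffPoly U] DiffOp U) h
  rw [← restrict₂_apply, map_zero] at h'
  simp only [map_add, restrict₂_X2_mul, restrict₂_X1_mul, restrict₂_act_X1, restrict₂_act_X2,
    restrict₂_act_X0, restrict₂_X0_mul_act_X1] at h'
  have h3 := congrArg (fun A : DiffOp U => A.coeff 3) h'
  simp only [Polynomial.coeff_add, Polynomial.coeff_neg, a3, d3, Polynomial.coeff_X_mul,
    Polynomial.coeff_C_succ, Polynomial.coeff_zero] at h3
  have h4 : func r * b = 0 := eq_zero_of_mul_natCast 2 two_ne_zero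
    (by push_cast; linear_combination -h3)
  have h5 := congrArg (jetPartial 1 1) h4
  simp [hb, func, jet] at h5
  have h6 : r * r = 0 := C_eq_zero (by rw [map_mul]; exact h5)
  refine SmoothFn.ext' fun x => ?_
  have h7 : r.1 x * r.1 x = 0 := congrFun (congrArg Subtype.val h6) x
  exact mul_self_eq_zero.1 h7

end NormalForms

/-! ### The second-order Jacobi identity -/

section SecondOrder

variable {U : Opens (Fin 2 → ℝ)}

theorem half_of_opFun {P Q : MatOp U} {i j k : Fin 2} {a : DiffPoly U} (hP : P i j = opFun a)
    (z y : FreqRing U) (hz : IsFreq z) :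
    half P Q i j k z y = act y (opComp (lin a 0) (Q 0 k) + opComp (lin a 1) (Q 1 k)) 1 := by
  have h1 : act z (P i j) 1 = MvPolynomial.C a := by
    rw [hP, act_one hz, opFun, Polynomial.aeval_C, MvPolynomial.algebraMap_eq]
  rw [half, h1, evR_eq_sum_act, Fin.sum_univ_two, act_add, act_opComp, act_opComp]

theorem half_of_eq_zero {P Q : MatOp U} {i j k : Fin 2} (hP : P i j = 0) (z y : FreqRing U) :
    half P Q i j k z y = 0 := by
  rw [half, hP, act_zero, map_zero]

theorem lin_eta21_zero {p q : SmoothFn U} (hp : FnOfU2 p) (hq : FnOfU2 q) :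
    lin (eta21 p q) 0 = 0 :=
  Polynomial.ext fun s => by rw [coeff_lin, hp.indepU1_eta21 hq s]; simp

theorem lin_eta21_one (p q : SmoothFn U) : lin (eta21 p q) 1
    = opFun (func p) * dx ^ 2 + opFun (2 * func q * jet U 1 1) * dx
      + opFun (func (prime p) * jet U 1 2 + func (prime q) * jet U 1 1 ^ 2) := by
  refine Polynomial.ext fun s => ?_
  rw [coeff_lin]
  have hX : ∀ k, (Polynomial.X ^ 2 : DiffOp U).coeff k = if k = 2 then 1 else 0 :=
    fun k => Polynomial.coeff_X_pow 2 k
  simp only [opFun, dx, Polynomial.coeff_add, Polynomial.coeff_C_mul, Polynomial.coeff_X,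
    Polynomial.coeff_C, eta21, pow_two]
  match s with
  | 0 => simp [func, jet, prime]
  | 1 =>
    simp [func, jet]
    ring
  | 2 => simp [func, jet]
  | s + 3 => simp [func, jet, Polynomial.coeff_X]

/-- The value of the linearization of `eta21 p q` on `eta21 p q`. -/
def eta21Lin (p q : SmoothFn U) : DiffPoly U :=
  func p * totalD (totalD (eta21 p q)) + 2 * func q * jet U 1 1 * totalD (eta21 p q)
    + (func (prime p) * jet U 1 2 + func (prime q) * jet U 1 1 ^ 2) * eta21 p q

theorem dxComp_opFun (a : DiffPoly U) :
    dxComp (opFun a) = opFun a * dx + opFun (totalD a) := by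
  refine Polynomial.ext fun s => ?_
  match s with
  | 0 => simp [coeff_dxComp_zero, opFun, dx]
  | 1 => simp [coeff_dxComp_succ, opFun, dx]
  | s + 2 => simp [coeff_dxComp_succ, opFun, dx]

/-- The derivative of `eta12` in the direction of `u^1`: it involves neither `l`, `m` nor `n`. -/
theorem lin_eta12_zero {p q l m n : SmoothFn U} (hp : FnOfU2 p) (hq : FnOfU2 q) (hl : FnOfU2 l)
    (hm : FnOfU2 m) (hn : FnOfU2 n) : lin (eta12 p q l m n) 0
    = opFun (func p * eta21 p q) * dx
      + opFun (func (2 * p ^ 2) * jet U 1 3 + func (2 * (p * prime q + q ^ 2)) * jet U 1 1 ^ 3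
        + func (2 * p * (3 * q + prime p)) * jet U 1 1 * jet U 1 2) := by
  have hc0 : partialD 0 (coord U 0) = 1 := by rw [partialD_coord]; simp
  have hp' : partialD 0 (partialD 1 p) = 0 := by rw [partialD_comm, hp.partialD, map_zero]
  have hq' : partialD 0 (partialD 1 q) = 0 := by rw [partialD_comm, hq.partialD, map_zero]
  have h2 : partialD 0 (2 : SmoothFn U) = 0 := (partialD (U := U) 0).map_natCast 2
  have h3 : partialD 0 (3 : SmoothFn U) = 0 := (partialD (U := U) 0).map_natCast 3
  have d1 : partialD 0 (2 * p ^ 2 * coord U 0 - l) = 2 * p ^ 2 := by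
    simp [Derivation.leibniz, pow_two, hp.partialD, hl.partialD, hc0, h2]
  have d2 : partialD 0 (p * q) = 0 := by
    simp [Derivation.leibniz, hp.partialD, hq.partialD]
  have d3 : partialD 0 (p ^ 2) = 0 := by
    simp [Derivation.leibniz, pow_two, hp.partialD]
  have d4 : partialD 0 (2 * coord U 0 * (p * prime q + q ^ 2) - n)
      = 2 * (p * prime q + q ^ 2) := by
    simp [Derivation.leibniz, pow_two, hp.partialD, hq.partialD, hn.partialD, hc0, h2, prime, hq']
    ring
  have d5 : partialD 0 (2 * p * coord U 0 * (3 * q + prime p) - m)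
      = 2 * p * (3 * q + prime p) := by
    simp [Derivation.leibniz, hp.partialD, hq.partialD, hm.partialD, hc0, h2, h3, prime, hp']
    ring
  refine Polynomial.ext fun s => ?_
  rw [coeff_lin]
  simp only [opFun, dx, Polynomial.coeff_add, Polynomial.coeff_C_mul, Polynomial.coeff_X,
    Polynomial.coeff_C, eta12, eta21]
  generalize 2 * p ^ 2 * coord U 0 - l = c1 at *
  generalize 2 * coord U 0 * (p * prime q + q ^ 2) - n = c4 at *
  generalize 2 * p * coord U 0 * (3 * q + prime p) - m = c5 at *
  have dp : func (p * q) = func p * func q := map_mul _ _ _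
  have dq : func (p ^ 2) = func p * func p := by rw [pow_two]; exact map_mul _ _ _
  match s with
  | 0 =>
    simp only [func, jet, jetPartial_add, jetPartial_mul, jetPartial_C_zero, jetPartial_X_zero,
      pow_two (MvPolynomial.X _ : DiffPoly U), pow_succ (MvPolynomial.X _ : DiffPoly U) 2, d1, d2,
      d3, d4, d5, map_zero]
    simp
  | 1 =>
    simp only [dp, dq]
    simp only [func, jet, jetPartial_add, jetPartial_mul, jetPartial_C_succ, jetPartial_X_succ,
      pow_two (MvPolynomial.X _ : DiffPoly U), pow_succ (MvPolynomial.X _ : DiffPoly U) 2]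
    simp
    ring
  | s + 2 =>
    simp only [func, jet, jetPartial_add, jetPartial_mul, jetPartial_C_succ, jetPartial_X_succ,
      pow_two (MvPolynomial.X _ : DiffPoly U), pow_succ (MvPolynomial.X _ : DiffPoly U) 2]
    simp

theorem dxComp_dxComp_opFun (a : DiffPoly U) : dxComp (dxComp (opFun a))
    = opFun a * dx ^ 2 + 2 * opFun (totalD a) * dx + opFun (totalD (totalD a)) := by
  rw [dxComp_opFun]
  refine Polynomial.ext fun s => ?_
  have hX : ∀ k, (Polynomial.X ^ 2 : DiffOp U).coeff k = if k = 2 then 1 else 0 :=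
    fun k => Polynomial.coeff_X_pow 2 k
  have e : 2 * opFun (totalD a) = opFun (2 * totalD a) := by rw [opFun, opFun, map_mul, map_ofNat]
  rw [e]
  simp only [opFun, dx, Polynomial.coeff_add, Polynomial.coeff_C_mul, hX, Polynomial.coeff_X,
    Polynomial.coeff_C]
  match s with
  | 0 => simp [coeff_dxComp_zero]
  | 1 =>
    simp [coeff_dxComp_succ]
    ring
  | 2 => simp [coeff_dxComp_succ]
  | s + 3 => simp [coeff_dxComp_succ]

theorem totalD_eta21 {p q : SmoothFn U} (hp : FnOfU2 p) (hq : FnOfU2 q) : totalD (eta21 p q)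
    = func p * jet U 1 3 + func (prime p + 2 * q) * jet U 1 1 * jet U 1 2
      + func (prime q) * jet U 1 1 ^ 3 := by
  simp only [eta21, pow_succ, pow_zero, one_mul]
  have C2 : (MvPolynomial.C 2 : DiffPoly U) = 2 := map_ofNat _ 2
  simp [func, jet, prime, hp.partialD, hq.partialD, C2]
  ring

/-- The operator through which the bracket of the first normal form with itself is expressed agrees,
up to a term of order zero, with the derivative of `eta12` in the direction of `u^1`. -/
theorem opComp_lin_eta21 {p q l m n : SmoothFn U} (hp : FnOfU2 p) (hq : FnOfU2 q) (hl : FnOfU2 l)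
    (hm : FnOfU2 m) (hn : FnOfU2 n) : opComp (lin (eta21 p q) 1) (opFun (eta21 p q))
      = lin (eta12 p q l m n) 0 * Polynomial.X + opFun (eta21Lin p q) := by
  have key : 2 * func q * jet U 1 1 * eta21 p q + 2 * func p * totalD (eta21 p q)
      = func (2 * p ^ 2) * jet U 1 3 + func (2 * (p * prime q + q ^ 2)) * jet U 1 1 ^ 3
        + func (2 * p * (3 * q + prime p)) * jet U 1 1 * jet U 1 2 := by
    rw [totalD_eta21 hp hq, eta21]
    simp only [func, map_mul, map_add, map_pow, map_ofNat]
    ring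
  have hd : ∀ A : DiffOp U, opComp (dx ^ 2) A = dxComp (dxComp A) := fun A => by
    rw [dx, ← Polynomial.monomial_one_right_eq_X_pow, opComp_eq, seqMap_monomial, one_smul]
    rfl
  rw [lin_eta12_zero hp hq hl hm hn, ← key, lin_eta21_one, opComp_add_left, opComp_add_left,
    opComp_opFun_mul, opComp_opFun_mul, opComp_C, hd, dx_opComp, dxComp_dxComp_opFun, dxComp_opFun,
    eta21Lin]
  simp only [opFun, dx, map_add, map_mul, map_ofNat]
  ring

/-- The half brackets of `normalForm1` with itself and of `normalForm2` with `P01` cancel up to terms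
without derivatives of the test functions. -/
theorem half_normalForm_add {p q e g h l m n : SmoothFn U} (hp : FnOfU2 p) (hq : FnOfU2 q)
    (he : FnOfU2 e) (hg : FnOfU2 g) (hh : FnOfU2 h) (hl : FnOfU2 l) (hm : FnOfU2 m) (hn : FnOfU2 n)
    {z y : FreqRing U} (hz : IsFreq z) (hy : IsFreq y) (i j k : Fin 2) :
    half (normalForm1 p q 0) (normalForm1 p q 0) i j k z y
      + half (normalForm2 p q e g h l m n) (P01 U) i j k z y
      = ![![![0, 0], ![-MvPolynomial.C (eta21Lin p q), 0]],
          ![![MvPolynomial.C (eta21Lin p q), 0], ![0, 0]]] i j k := by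
  have h01 : normalForm1 p q 0 0 1 = opFun (-eta21 p q) := by
    rw [normalForm1_zero_one, opFun, opFun, map_neg]
  have hl0 := lin_eta21_zero hp hq
  have hln : ∀ k, lin (-eta21 p q) k = -lin (eta21 p q) k := fun k =>
    Polynomial.ext fun s => by rw [coeff_lin, jetPartial_neg, Polynomial.coeff_neg, coeff_lin]
  have hC : ∀ a : DiffPoly U, act y (opFun a) 1 = MvPolynomial.C a := fun a => by
    rw [act_one hy, opFun, Polynomial.aeval_C, MvPolynomial.algebraMap_eq]
  have hop := opComp_lin_eta21 hp hq hl hm hn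
  have hp00 : P01 U 0 0 = dx := rfl
  have hp10 : P01 U 1 0 = 0 := rfl
  have e1 : half (normalForm2 p q e g h l m n) (P01 U) 0 1 0 z y
      = act y (lin (eta12 p q l m n) 0 * Polynomial.X) 1 := by
    rw [half_of_opFun (normalForm2_zero_one p q e g h l m n) z y hz, hp00, hp10, opComp_zero,
      opComp_dx, add_zero]
  have e2 : half (normalForm2 p q e g h l m n) (P01 U) 1 0 0 z y
      = -act y (lin (eta12 p q l m n) 0 * Polynomial.X) 1 := by
    rw [← e1, half, half, normalForm2_one_zero, normalForm2_zero_one, act_neg, map_neg]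
  have e3 : half (normalForm2 p q e g h l m n) (P01 U) 1 1 0 z y = 0 := by
    rw [half_P01_right_zero _ _ _ hz hy,
      u1Sym_eq_zero (opIndepU1_normalForm2_one_one he hg hh), map_zero]
  have e4 : half (normalForm1 p q 0) (normalForm1 p q 0) 1 0 0 z y
      = act y (lin (eta12 p q l m n) 0 * Polynomial.X) 1 + MvPolynomial.C (eta21Lin p q) := by
    rw [half_of_opFun (normalForm1_one_zero p q 0) z y hz, hl0, zero_opComp, zero_add,
      normalForm1_one_zero, hop, act_add, hC]
  have e5 : half (normalForm1 p q 0) (normalForm1 p q 0) 0 1 0 z y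
      = -half (normalForm1 p q 0) (normalForm1 p q 0) 1 0 0 z y := by
    rw [half, half, normalForm1_one_zero, normalForm1_zero_one, act_neg, map_neg]
  have e6 : half (normalForm1 p q 0) (normalForm1 p q 0) 1 0 1 z y = 0 := by
    rw [half_of_opFun (normalForm1_one_zero p q 0) z y hz, hl0, zero_opComp,
      normalForm1_one_one_zero, opComp_zero, add_zero, act_zero]
  have e7 : half (normalForm1 p q 0) (normalForm1 p q 0) 0 1 1 z y = 0 := by
    rw [half_of_opFun h01 z y hz, hln, hln, hl0, neg_zero, zero_opComp,
      normalForm1_one_one_zero, opComp_zero, add_zero, act_zero]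
  fin_cases i <;> fin_cases j <;> fin_cases k <;>
    simp only [Fin.zero_eta, Fin.mk_one, Matrix.cons_val_zero, Matrix.cons_val_one]
  · rw [half_of_eq_zero (normalForm1_zero_zero p q 0), half_of_eq_zero (normalForm2_zero_zero ..),
      add_zero]
  · rw [half_of_eq_zero (normalForm1_zero_zero p q 0), half_of_eq_zero (normalForm2_zero_zero ..),
      add_zero]
  · rw [e5, e4, e1]
    ring
  · rw [e7, half_P01_right_one, add_zero]
  · rw [e4, e2]
    ring
  · rw [e6, half_P01_right_one, add_zero]
  · rw [half_of_eq_zero (normalForm1_one_one_zero p q), e3, add_zero]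
  · rw [half_of_eq_zero (normalForm1_one_one_zero p q), half_P01_right_one, add_zero]

/-- The Jacobi identity at second order for the normal forms. The remainders of
`half_normalForm_add` with the indices `1 0 0` and `0 1 0` are opposite, so their cyclic sums
vanish. -/
theorem schouten_normalForm2 {p q e g h l m n : SmoothFn U} (hp : FnOfU2 p) (hq : FnOfU2 q)
    (he : FnOfU2 e) (hg : FnOfU2 g) (hh : FnOfU2 h) (hl : FnOfU2 l) (hm : FnOfU2 m) (hn : FnOfU2 n)
    (i j k : Fin 2) :
    schouten (normalForm1 p q 0) (normalForm1 p q 0) i j k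
      + 2 * schouten (P01 U) (normalForm2 p q e g h l m n) i j k = 0 := by
  have H : ∀ (i j k : Fin 2) (a b : Fin 3), _ := fun i j k a b =>
    half_normalForm_add hp hq he hg hh hl hm hn (isFreq_X a) (isFreq_X b) i j k
  have H' : bracketDensity (normalForm1 p q 0) (normalForm1 p q 0) i j k
      + 2 * bracketDensity (P01 U) (normalForm2 p q e g h l m n) i j k = 0 := by
    rw [bracketDensity_P01]
    simp only [bracketDensity, symHalf]
    have h1 := H i j k 1 2
    have h2 := H k i j 0 1
    have h3 := H j k i 2 0
    have h4 : ∀ c : FreqRing U, (![![![0, 0], ![-c, 0]], ![![c, 0], ![0, 0]]] : Fin 2 → Fin 2 → Fin 2 → FreqRing U) i j k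
      + (![![![0, 0], ![-c, 0]], ![![c, 0], ![0, 0]]] : Fin 2 → Fin 2 → Fin 2 → FreqRing U) k i j
      + (![![![0, 0], ![-c, 0]], ![![c, 0], ![0, 0]]] : Fin 2 → Fin 2 → Fin 2 → FreqRing U) j k i = 0 := by
      intro c
      fin_cases i <;> fin_cases j <;> fin_cases k <;> simp
    linear_combination 2 * h1 + 2 * h2 + 2 * h3 + 2 * h4 (MvPolynomial.C (eta21Lin p q))
  rw [schouten_eq, schouten_eq, two_mul, ← map_add, ← map_add, ← two_mul, H', map_zero]

end SecondOrder

/-! ### Low orders of a Lie series -/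

section LowOrder

variable {n : ℕ} {U : Opens (Fin n → ℝ)}

theorem evol_zero_left (f : DiffPoly U) : evol 0 f = 0 := by
  have h : (fun (k : Fin n) s => totalD^[s] ((0 : VField U) k)) = 0 := by
    funext k s
    induction s with
    | zero => rfl
    | succ s ih => rw [Function.iterate_succ_apply', ih]; simp
  have h2 := evR_fieldSym_C (0 : VField U) f
  have h3 : fieldSym (0 : VField U) = 0 := by
    funext k
    simp [fieldSym]
  rw [h3, evR_zero] at h2
  exact MvPolynomial.C_injective (Fin 3) _ (h2.symm.trans (map_zero _).symm)

theorem lin_zero (k : Fin n) : lin (0 : DiffPoly U) k = 0 :=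
  Polynomial.ext fun s => by rw [coeff_lin]; simp

theorem lieD_zero_left (P : MatOp U) : lieD 0 P = 0 := by
  refine Matrix.ext fun i j => ?_
  have h : evolOp (0 : VField U) (P i j) = 0 := by
    rw [evolOp, Polynomial.sum]
    exact Finset.sum_eq_zero fun m _ => by rw [evol_zero_left, map_zero]
  have hz : ∀ k, lin ((0 : VField U) i) k = 0 := fun k => lin_zero k
  have hz' : ∀ k, lin ((0 : VField U) j) k = 0 := fun k => lin_zero k
  rw [lieD_apply, h]
  simp only [hz, hz', opAdj_zero, zero_opComp, opComp_zero, Finset.sum_const_zero, sub_zero]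
  rfl

theorem miura_zero (Ξ : ℕ → VField U) (P : ℕ → MatOp U) : miura Ξ P 0 = P 0 := by
  simp [miura]

theorem lieSeries_zero {Ξ : ℕ → VField U} (h : Ξ 0 = 0) (P : ℕ → MatOp U) :
    lieSeries Ξ P 0 = 0 := by
  simp [lieSeries, h, lieD_zero_left]

theorem lieSeries_one {Ξ : ℕ → VField U} (h : Ξ 0 = 0) (P : ℕ → MatOp U) :
    lieSeries Ξ P 1 = lieD (Ξ 1) (P 0) := by
  simp [lieSeries, h, lieD_zero_left, Finset.Nat.antidiagonal_succ]

theorem lieSeries_two {Ξ : ℕ → VField U} (h : Ξ 0 = 0) (P : ℕ → MatOp U) :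
    lieSeries Ξ P 2 = lieD (Ξ 1) (P 1) + lieD (Ξ 2) (P 0) := by
  simp [lieSeries, h, lieD_zero_left, Finset.Nat.antidiagonal_succ]

theorem lieD_zero_right (ξ : VField U) : lieD ξ (0 : MatOp U) = 0 := by
  refine Matrix.ext fun i j => ?_
  rw [lieD_apply]
  simp [evolOp_zero, zero_opComp, opComp_zero]

theorem miura_one {Ξ : ℕ → VField U} (h : Ξ 0 = 0) (P : ℕ → MatOp U) :
    miura Ξ P 1 = P 1 + lieD (Ξ 1) (P 0) := by
  simp [miura, Finset.sum_range_succ, lieSeries_one h]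

theorem miura_two {Ξ : ℕ → VField U} (h : Ξ 0 = 0) (P : ℕ → MatOp U) :
    miura Ξ P 2 = P 2 + (lieD (Ξ 1) (P 1) + lieD (Ξ 2) (P 0))
      + (1 / 2 : ℝ) • lieD (Ξ 1) (lieD (Ξ 1) (P 0)) := by
  simp [miura, Finset.sum_range_succ, lieSeries_two h, lieSeries_one h, lieSeries_zero h,
    lieD_zero_right]

/-- The generator with the components `ξ₁`, `ξ₂` in degrees one and two. -/
def generator (ξ₁ ξ₂ : VField U) : ℕ → VField U
  | 1 => ξ₁
  | 2 => ξ₂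
  | _ => 0

theorem isMiuraGenerator_generator {ξ₁ ξ₂ : VField U} (h₁ : ∀ i, HasDegree (ξ₁ i) 1)
    (h₂ : ∀ i, HasDegree (ξ₂ i) 2) : IsMiuraGenerator (generator ξ₁ ξ₂) where
  zero := rfl
  degree m i := by
    match m with
    | 0 => exact hasDegree_zero 0
    | 1 => exact h₁ i
    | 2 => exact h₂ i
    | m + 3 => exact hasDegree_zero _

theorem reducesTo_one {P : ℕ → MatOp U} {P₀ P₁ P₂ : MatOp U} (h0 : P 0 = P₀) {ξ : VField U}
    (hξ : ∀ i, HasDegree (ξ i) 1) (h1 : P 1 + lieD ξ P₀ = P₁) :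
    ReducesTo 1 P (series P₀ P₁ P₂) := by
  refine ⟨generator ξ 0, isMiuraGenerator_generator hξ fun i => hasDegree_zero 2, fun m hm => ?_⟩
  interval_cases m
  · rw [miura_zero, h0]; rfl
  · rw [miura_one rfl, h0]; exact h1

theorem reducesTo_two {P : ℕ → MatOp U} {P₀ P₁ P₂ : MatOp U} (h0 : P 0 = P₀) {ξ₁ ξ₂ : VField U}
    (hξ₁ : ∀ i, HasDegree (ξ₁ i) 1) (hξ₂ : ∀ i, HasDegree (ξ₂ i) 2) (h1 : P 1 + lieD ξ₁ P₀ = P₁)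
    (h2 : P 2 + (lieD ξ₁ (P 1) + lieD ξ₂ P₀) + (1 / 2 : ℝ) • lieD ξ₁ (lieD ξ₁ P₀) = P₂) :
    ReducesTo 2 P (series P₀ P₁ P₂) := by
  refine ⟨generator ξ₁ ξ₂, isMiuraGenerator_generator hξ₁ hξ₂, fun m hm => ?_⟩
  interval_cases m
  · rw [miura_zero, h0]; rfl
  · rw [miura_one rfl, h0]; exact h1
  · rw [miura_two rfl, h0]; exact h2

end LowOrder

/-! ### Reduction to the normal forms -/

section Reduction

variable {U : Opens (Fin 2 → ℝ)}

theorem schouten_P01_P01 (i j k : Fin 2) : schouten (P01 U) (P01 U) i j k = 0 := by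
  have h := schouten_P01_eq_zero (Q := P01 U) (fun i j => ?_) i j k
  · exact h
  · intro m s
    fin_cases i <;> fin_cases j <;> simp [P01, dx, Polynomial.coeff_X]
    split_ifs <;> simp

/-- The brackets that have to vanish for a series of length three to be a deformation. -/
theorem isDeformation_series {k : ℕ} {P₁ P₂ : MatOp U} (hk : k ≤ 2) (s1 : IsSkew P₁) (s2 : IsSkew P₂)
    (d1 : HasOpDegree P₁ 2) (d2 : HasOpDegree P₂ 3)
    (h1 : ∀ i j l, schouten (P01 U) P₁ i j l = 0)
    (h2 : 2 ≤ k → ∀ i j l, schouten P₁ P₁ i j l + 2 * schouten (P01 U) P₂ i j l = 0) :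
    IsDeformation k (P01 U) (series (P01 U) P₁ P₂) where
  zero := rfl
  skew m := by
    match m with
    | 0 => exact isSkew_P01
    | 1 => exact s1
    | 2 => exact s2
    | m + 3 => exact isSkew_zero
  degree m := by
    match m with
    | 0 => exact hasOpDegree_P01
    | 1 => exact d1
    | 2 => exact d2
    | m + 3 => exact hasOpDegree_zero _
  jacobi m hm i j l := by
    have hm2 : m ≤ 2 := hm.trans hk
    interval_cases m
    · simpa [series] using schouten_P01_P01 i j l
    · simp [series, Finset.Nat.antidiagonal_succ, schouten_comm P₁, h1]
    · have h := h2 hm i j l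
      simp only [Finset.Nat.antidiagonal_succ, Finset.Nat.antidiagonal_zero]
      simp [series, schouten_comm P₂]
      linear_combination h

/-- The first-order part of a deformation is closed, hence equivalent to a first normal form. -/
theorem IsDeformation.exists_first (hU : IsBox U) {k : ℕ} (hk : 1 ≤ k) {P : ℕ → MatOp U}
    (hP : IsDeformation k (P01 U) P) :
    ∃ ξ : VField U, (∀ i, HasDegree (ξ i) 1) ∧ ∃ p q r : SmoothFn U,
      FnOfU2 p ∧ FnOfU2 q ∧ FnOfU2 r ∧ P 1 + lieD ξ (P01 U) = normalForm1 p q r := by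
  refine exists_normalForm1 hU (hP.skew 1) (hP.degree 1) fun i j l => ?_
  have h := hP.jacobi 1 hk i j l
  simp only [Finset.Nat.antidiagonal_succ, Finset.Nat.antidiagonal_zero] at h
  simp [hP.zero, schouten_comm (P 1)] at h
  exact eq_zero_of_mul_natCast 2 two_ne_zero (by push_cast; linear_combination h)

theorem eta12_add (p q l m n : SmoothFn U) :
    eta12 0 0 l m n + eta12 p q 0 0 0 = eta12 p q l m n := by
  simp only [eta12, func, map_mul, map_sub, map_add, map_pow, map_zero, prime]
  ring

/-- The second normal form is affine: its part with `p = q = 0` is added to the solution that `p` and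
`q` prescribe. -/
theorem normalForm2_add (p q e g h l m n : SmoothFn U) :
    normalForm2 0 0 e g h l m n + normalForm2 p q 0 0 0 0 0 0 = normalForm2 p q e g h l m n := by
  refine matOp_ext ?_ ?_ ?_ ?_
  · simp [Matrix.add_apply, normalForm2_zero_zero]
  · rw [Matrix.add_apply, normalForm2_zero_one, normalForm2_zero_one, normalForm2_zero_one,
      ← eta12_add p q l m n, opFun, opFun, opFun, map_add]
  · rw [Matrix.add_apply, normalForm2_one_zero, normalForm2_one_zero, normalForm2_one_zero,
      ← eta12_add p q l m n, opFun, opFun, opFun, map_add, neg_add]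
  · have hz : normalForm2 p q 0 0 0 0 0 0 1 1 = 0 := by
      simp [normalForm2_one_one, eta22, gamma22, func, opFun, prime]
    rw [Matrix.add_apply, hz, add_zero, normalForm2_one_one, normalForm2_one_one]

/-- The part of order two of the bracket of a transformed bivector with itself. -/
theorem schouten_lieD_two {P₀ P₁ P₂ : MatOp U} (ξ : VField U) (s0 : IsSkew P₀) (s1 : IsSkew P₁)
    (h0 : ∀ i j k, schouten P₀ P₀ i j k = 0) (h1 : ∀ i j k, schouten P₀ P₁ i j k = 0)
    (h2 : ∀ i j k, schouten P₁ P₁ i j k + 2 * schouten P₀ P₂ i j k = 0) (i j k : Fin 2) :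
    schouten (P₁ + lieD ξ P₀) (P₁ + lieD ξ P₀) i j k
      + 2 * schouten P₀ (P₂ + lieD ξ P₁ + (1 / 2 : ℝ) • lieD ξ (lieD ξ P₀)) i j k = 0 := by
  have a0 : ∀ i j k, schouten P₀ (lieD ξ P₀) i j k = 0 := fun i j k => by
    have h := schouten_lieD_add ξ s0 s0 h0 i j k
    rw [schouten_comm (lieD ξ P₀)] at h
    exact eq_zero_of_mul_natCast 2 two_ne_zero (by push_cast; linear_combination h)
  have a1 := schouten_lieD_add ξ s0 s1 h1 i j k
  have a2 := schouten_lieD_add ξ s0 (s0.lieD ξ) a0 i j k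
  have a3 := schouten_add_right P₀ ((1 / 2 : ℝ) • lieD ξ (lieD ξ P₀))
    ((1 / 2 : ℝ) • lieD ξ (lieD ξ P₀)) i j k
  have e : (1 / 2 : ℝ) • lieD ξ (lieD ξ P₀) + (1 / 2 : ℝ) • lieD ξ (lieD ξ P₀)
      = lieD ξ (lieD ξ P₀) := by rw [← add_smul]; norm_num
  rw [e] at a3
  rw [schouten_add_left, schouten_add_right, schouten_add_right, schouten_add_right,
    schouten_add_right, schouten_comm P₁ (lieD ξ P₀)]
  linear_combination h2 i j k + 2 * a1 + a2 - a3

/-- Reduction of a second-order deformation: the first step determines `Ξ₁`, the remaining freedom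
of `Ξ₂` normalizes a closed bivector of degree three. -/
theorem IsDeformation.exists_second (hU : IsBox U) {P : ℕ → MatOp U}
    (hP : IsDeformation 2 (P01 U) P) :
    ∃ p q e g h l m n : SmoothFn U,
      FnOfU2 p ∧ FnOfU2 q ∧ FnOfU2 e ∧ FnOfU2 g ∧ FnOfU2 h ∧ FnOfU2 l ∧ FnOfU2 m ∧ FnOfU2 n ∧
      ReducesTo 2 P (series (P01 U) (normalForm1 p q 0) (normalForm2 p q e g h l m n)) := by
  obtain ⟨ξ, hξ, p, q, r, hp, hq, hr, e1⟩ := hP.exists_first hU one_le_two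
  have h1 : ∀ i j k, schouten (P01 U) (P 1) i j k = 0 := fun i j k => by
    have h := hP.jacobi 1 one_le_two i j k
    simp only [Finset.Nat.antidiagonal_succ, Finset.Nat.antidiagonal_zero] at h
    simp [hP.zero, schouten_comm (P 1)] at h
    exact eq_zero_of_mul_natCast 2 two_ne_zero (by push_cast; linear_combination h)
  have h2 : ∀ i j k, schouten (P 1) (P 1) i j k + 2 * schouten (P01 U) (P 2) i j k = 0 :=
    fun i j k => by
      have h := hP.jacobi 2 le_rfl i j k
      simp only [Finset.Nat.antidiagonal_succ, Finset.Nat.antidiagonal_zero] at h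
      simp [hP.zero, schouten_comm (P 2)] at h
      linear_combination h
  have h3 := schouten_lieD_two ξ isSkew_P01 (hP.skew 1) schouten_P01_P01 h1 h2
  rw [e1] at h3
  set R : MatOp U := P 2 + lieD ξ (P 1) + (1 / 2 : ℝ) • lieD ξ (lieD ξ (P01 U)) with hR
  -- the component `1 1 1` of the bracket with `P01` vanishes
  have hr0 : r = 0 := eq_zero_of_schouten_normalForm1 (p := p) (q := q) hr (by
    have h := h3 1 1 1
    rwa [schouten_P01_one, mul_zero, add_zero] at h)
  subst hr0
  have z := FnOfU2.zero (U := U)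
  have hRs : IsSkew R := ((hP.skew 2).add ((hP.skew 1).lieD ξ)).add
    (((isSkew_P01.lieD ξ).lieD ξ).smul _)
  have hRd : HasOpDegree R 3 := ((hP.degree 2).add ((hP.degree 1).lieD hξ)).add
    (((hasOpDegree_P01.lieD hξ).lieD hξ).smul _)
  obtain ⟨η, hη, e, g, h, l, m, n, he, hg, hh, hl, hm, hn, e2⟩ :=
    exists_normalForm2 hU (hRs.add (isSkew_normalForm2 (p := p) (q := q) (g := 0) (h := 0)
      (l := 0) (m := 0) (n := 0) z).neg) (hRd.add (hasOpDegree_normalForm2 z).neg) fun i j k => by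
      have h4 := schouten_normalForm2 hp hq z z z z z z i j k
      rw [schouten_add_right, schouten_neg_right]
      exact eq_zero_of_mul_natCast 2 two_ne_zero (by push_cast; linear_combination h3 i j k - h4)
  refine ⟨p, q, e, g, h, l, m, n, hp, hq, he, hg, hh, hl, hm, hn,
    reducesTo_two hP.zero hξ hη e1 ?_⟩
  rw [← normalForm2_add, ← e2, hR]
  abel

end Reduction

/-! ### Residual transformations of the second normal form -/

section ResidualFreedom

variable {U : Opens (Fin 2 → ℝ)}

/-- A skew bivector is determined by its entries on and below the diagonal. -/
theorem IsSkew.ext {P Q : MatOp U} (hP : IsSkew P) (hQ : IsSkew Q) (h00 : P 0 0 = Q 0 0)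
    (h10 : P 1 0 = Q 1 0) (h11 : P 1 1 = Q 1 1) : P = Q := by
  refine matOp_ext h00 ?_ h10 h11
  rw [← neg_neg (P 0 1), ← hP 0 1, ← neg_neg (Q 0 1), ← hQ 0 1, h10]

/-- The vector field `f ∂/∂u^2`. -/
def field₂ (f : DiffPoly U) : VField U := ![0, f]

theorem hasDegree_field₂ {f : DiffPoly U} {d : ℕ} (hf : HasDegree f d) (i : Fin 2) :
    HasDegree (field₂ f i) d := by
  fin_cases i
  · exact hasDegree_zero d
  · exact hf

theorem lieD_field₂_P01_zero (f : DiffPoly U) : lieD (field₂ f) (P01 U) 0 0 = 0 := by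
  have h : field₂ f 0 = 0 := rfl
  rw [lieD_P01_zero, h, lin_zero, zero_mul, opAdj_zero, sub_zero]

theorem lieD_field₂_P01 {f : DiffPoly U} (hf : IndepU1 f) : lieD (field₂ f) (P01 U) = 0 := by
  have h : lin (field₂ f 1) 0 = 0 := Polynomial.ext fun s => by
    rw [coeff_lin]
    exact (hf s).trans (Polynomial.coeff_zero s).symm
  refine IsSkew.ext (isSkew_P01.lieD _) isSkew_zero (lieD_field₂_P01_zero f) ?_ ?_
  · rw [lieD_P01_one_zero, h, zero_mul, neg_zero]; rfl
  · rw [lieD_P01_one_one]; rfl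

theorem lin_func_mul_jet {φ : SmoothFn U} (hφ : FnOfU2 φ) :
    lin (func φ * jet U 1 1) 0 = 0 ∧
      lin (func φ * jet U 1 1) 1 = opFun (func φ) * dx + opFun (func (prime φ) * jet U 1 1) := by
  constructor
  · exact Polynomial.ext fun s => by
      rw [coeff_lin, (hφ.indepU1.mul (indepU1_jet 0)) s, Polynomial.coeff_zero]
  · refine Polynomial.ext fun s => ?_
    rw [coeff_lin]
    match s with
    | 0 => simp [func, jet, opFun, dx, prime]
    | 1 => simp [func, jet, opFun, dx]
    | s + 2 => simp [func, jet, opFun, dx]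

theorem evol_field₂_eta21 (p q : SmoothFn U) (f : DiffPoly U) :
    evol (field₂ f) (eta21 p q)
      = func p * totalD (totalD f) + 2 * func q * jet U 1 1 * totalD f
        + (func (prime p) * jet U 1 2 + func (prime q) * jet U 1 1 ^ 2) * f := by
  have ho : ∀ (P : DiffOp U) (f : DiffPoly U), opApply P f = seqMap (fun m => totalD^[m] f) P :=
    fun _ _ => rfl
  have hz : (fun m => totalD^[m] (field₂ f 0)) = 0 := by
    funext m
    induction m with
    | zero => rfl
    | succ m ih => rw [Function.iterate_succ_apply', ih]; simp
  have h0 : ∀ P : DiffOp U, opApply P (field₂ f 0) = 0 := fun P => by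
    rw [ho, hz, seqMap_apply]
    simp [Polynomial.sum]
  have h1 : field₂ f 1 = f := rfl
  have hm : ∀ (b : ℕ → DiffPoly U) (a : DiffPoly U) (m : ℕ),
      seqMap b (opFun a * dx ^ m) = a * b m := fun b a m => by
    rw [opFun, dx, Polynomial.C_mul_X_pow_eq_monomial, seqMap_monomial, smul_eq_mul]
  have m1 := fun b => hm b (2 * func q * jet U 1 1) 1
  have m0 := fun b => hm b (func (prime p) * jet U 1 2 + func (prime q) * jet U 1 1 ^ 2) 0
  simp only [pow_one] at m1
  simp only [pow_zero, mul_one] at m0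
  rw [evol, Fin.sum_univ_two, h0, zero_add, h1, lin_eta21_one, ho, map_add, map_add, hm, m1, m0]
  rfl

/-- The change of the entry `1 0` of the first normal form along `φ u^2_x ∂/∂u^2`, up to the
term that the second-order part of the transformation cancels. -/
theorem lieD_field₂_normalForm1_one_zero {p q φ : SmoothFn U} (hp : FnOfU2 p) (hq : FnOfU2 q)
    (hφ : FnOfU2 φ) (hφ' : FnOfU2 (prime φ)) :
    lieD (field₂ (func φ * jet U 1 1)) (normalForm1 p q 0) 1 0
      = opFun (func (p * prime (prime φ) + q * prime φ) * jet U 1 1 ^ 3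
          + func (2 * p * prime φ) * jet U 1 1 * jet U 1 2)
        - opFun (func φ * eta21 p q) * dx := by
  have hl := lin_func_mul_jet hφ
  have h0 : ∀ k, lin (field₂ (func φ * jet U 1 1) 0) k = 0 := lin_zero
  have hf1 : field₂ (func φ * jet U 1 1) 1 = func φ * jet U 1 1 := rfl
  have hev : ∀ (ξ : VField U) (a : DiffPoly U), evolOp ξ (opFun a) = opFun (evol ξ a) :=
    fun ξ a => evolOp_monomial ξ 0 a
  have key : evol (field₂ (func φ * jet U 1 1)) (eta21 p q) - func φ * totalD (eta21 p q)
      - func (prime φ) * jet U 1 1 * eta21 p q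
      = func (p * prime (prime φ) + q * prime φ) * jet U 1 1 ^ 3
          + func (2 * p * prime φ) * jet U 1 1 * jet U 1 2 := by
    have t1 : totalD (func φ * jet U 1 1)
        = func (prime φ) * jet U 1 1 * jet U 1 1 + func φ * jet U 1 2 := by
      simp [func, jet, prime, hφ.partialD]
    have t2 : totalD (totalD (func φ * jet U 1 1))
        = func (prime (prime φ)) * jet U 1 1 ^ 3 + 3 * func (prime φ) * jet U 1 1 * jet U 1 2
          + func φ * jet U 1 3 := by
      have hφ2 : partialD 0 (partialD 1 φ) = 0 := hφ'.partialD
      rw [t1]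
      simp [func, jet, prime, hφ.partialD, hφ2]
      ring
    rw [evol_field₂_eta21, t2, t1, totalD_eta21 hp hq, eta21]
    simp only [func, map_mul, map_add, map_ofNat]
    ring
  rw [lieD_apply, Fin.sum_univ_two, Fin.sum_univ_two, h0, h0, opAdj_zero, opComp_zero, opComp_zero,
    hf1, hl.1, hl.2, zero_opComp, normalForm1_one_zero, hev, opComp_add_left, opComp_opFun_mul,
    dx_opComp, dxComp_opFun, opComp_C, ← key]
  simp only [opFun, map_sub, map_mul]
  ring

theorem lieD_field₂_normalForm1 {p q φ : SmoothFn U} (hφ : FnOfU2 φ) :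
    lieD (field₂ (func φ * jet U 1 1)) (normalForm1 p q 0) 0 0 = 0 ∧
      lieD (field₂ (func φ * jet U 1 1)) (normalForm1 p q 0) 1 1 = 0 := by
  have hl := lin_func_mul_jet hφ
  have h0 : ∀ k, lin (field₂ (func φ * jet U 1 1) 0) k = 0 := lin_zero
  have hf1 : field₂ (func φ * jet U 1 1) 1 = func φ * jet U 1 1 := rfl
  constructor
  · rw [lieD_apply, Fin.sum_univ_two, Fin.sum_univ_two, h0, h0, opAdj_zero, normalForm1_zero_zero]
    simp only [opComp_zero, zero_opComp, evolOp_zero, sub_zero, add_zero]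
  · rw [lieD_apply, Fin.sum_univ_two, Fin.sum_univ_two, hf1, hl.1, opAdj_zero,
      normalForm1_one_one_zero]
    simp only [opComp_zero, zero_opComp, evolOp_zero, sub_zero, add_zero]

/-- The residual transformations. The term of order one that `φ u²_x ∂/∂u²` adds to the entry `1 0` is
cancelled by the Lie derivative of `P01` along the field of degree two. -/
theorem reducesTo_shift {p q e g h l m n φ : SmoothFn U} (hp : FnOfU2 p) (hq : FnOfU2 q)
    (he : FnOfU2 e) (hφ : FnOfU2 φ) (hφ' : FnOfU2 (prime φ)) :
    ReducesTo 2 (series (P01 U) (normalForm1 p q 0) (normalForm2 p q e g h l m n))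
      (series (P01 U) (normalForm1 p q 0)
        (normalForm2 p q e g h l (m + 2 * p * prime φ)
          (n + (p * prime (prime φ) + q * prime φ)))) := by
  set N₁ := normalForm1 p q 0
  set ξ : VField U := field₂ (func φ * jet U 1 1) with hξ
  set η : VField U := field₂ (-(func (coord U 0 * φ) * eta21 p q)) with hη
  have hA := hp.indepU1_eta21 hq
  have d1 : ∀ i, HasDegree (ξ i) 1 := hasDegree_field₂ ((hasDegree_jet 1 1).func_mul φ)
  have d2 : ∀ i, HasDegree (η i) 2 := hasDegree_field₂ ((hasDegree_eta21 p q).func_mul _).neg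
  have h1 : lieD ξ (P01 U) = 0 := lieD_field₂_P01 (hφ.indepU1.mul (indepU1_jet 0))
  have hl : lin (η 1) 0 = -opFun (func φ * eta21 p q) := by
    have hc0 : partialD 0 (coord U 0) = 1 := by rw [partialD_coord]; simp
    have hc : partialD 0 (coord U 0 * φ) = φ := by simp [hφ.partialD, hc0]
    change lin (-(func (coord U 0 * φ) * eta21 p q)) 0 = _
    refine Polynomial.ext fun s => ?_
    rw [coeff_lin, jetPartial_neg, jetPartial_mul, hA s]
    match s with
    | 0 => simp only [func, jetPartial_C_zero, hc]; simp [opFun]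
    | s + 1 => simp only [func, jetPartial_C_succ]; simp [opFun]
  refine reducesTo_two (ξ₁ := ξ) (ξ₂ := η) rfl d1 d2 ?_ ?_
  · rw [h1, add_zero]; rfl
  · rw [h1, lieD_zero_right, smul_zero, add_zero]
    change normalForm2 p q e g h l m n + (lieD ξ N₁ + lieD η (P01 U)) = _
    have hs := isSkew_normalForm1 p q 0
    refine IsSkew.ext ((isSkew_normalForm2 he).add ((hs.lieD ξ).add (isSkew_P01.lieD η)))
      (isSkew_normalForm2 he) ?_ ?_ ?_
    · rw [Matrix.add_apply, Matrix.add_apply, (lieD_field₂_normalForm1 hφ).1,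
        lieD_field₂_P01_zero, normalForm2_zero_zero, normalForm2_zero_zero, add_zero, add_zero]
    · rw [Matrix.add_apply, Matrix.add_apply, lieD_field₂_normalForm1_one_zero hp hq hφ hφ',
        lieD_P01_one_zero, hl, normalForm2_one_zero, normalForm2_one_zero, eta12, eta12]
      simp only [opFun, dx, func, map_add, map_sub, map_mul]
      ring
    · rw [Matrix.add_apply, Matrix.add_apply, (lieD_field₂_normalForm1 hφ).2, lieD_P01_one_one,
        add_zero, add_zero, normalForm2_one_one, normalForm2_one_one]

theorem reducesTo_m_zero (hU : IsBox U) {p q e g h l m n : SmoothFn U} (hp : FnOfU2 p)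
    (hq : FnOfU2 q) (he : FnOfU2 e) (hm : FnOfU2 m) (hn : FnOfU2 n) (h0 : ∀ x, p.1 x ≠ 0) :
    ∃ n' : SmoothFn U, FnOfU2 n' ∧
      ReducesTo 2 (series (P01 U) (normalForm1 p q 0) (normalForm2 p q e g h l m n))
        (series (P01 U) (normalForm1 p q 0) (normalForm2 p q e g h l 0 n')) := by
  obtain ⟨i, hi⟩ := exists_inverse p h0
  have hi2 : FnOfU2 i := hp.of_mul_eq_one hi
  -- the equation `m + 2 p φ' = 0`
  obtain ⟨φ, hφ, e1⟩ := hU.exists_fnOfU2_partialD_eq ((hm.mul hi2).smul (-(1 / 2 : ℝ)))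
  have e1' : prime φ = -(1 / 2 : ℝ) • (m * i) := e1
  have hφ' : FnOfU2 (prime φ) := hU.fnOfU2_partialD hφ
  have hs := reducesTo_shift (g := g) (h := h) (l := l) (m := m) (n := n) hp hq he hφ hφ'
  have hm0 : m + 2 * p * prime φ = 0 := by
    have t : 2 * p * prime φ = -(m * (p * i)) := by
      rw [e1', mul_smul_comm]
      have : 2 * p * (m * i) = (2 : ℝ) • (m * (p * i)) := by
        rw [two_smul]; ring
      rw [this, smul_smul]
      norm_num
    rw [t, hi]
    ring
  rw [hm0] at hs
  exact ⟨_, hn.add ((hp.mul (hU.fnOfU2_partialD hφ')).add (hq.mul hφ')), hs⟩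

theorem reducesTo_n_zero (hU : IsBox U) {p q e g h l m n : SmoothFn U} (hp : FnOfU2 p)
    (hq : FnOfU2 q) (he : FnOfU2 e) (hm : FnOfU2 m) (hn : FnOfU2 n) (h0 : ∀ x, p.1 x ≠ 0) :
    ∃ m' : SmoothFn U, FnOfU2 m' ∧
      ReducesTo 2 (series (P01 U) (normalForm1 p q 0) (normalForm2 p q e g h l m n))
        (series (P01 U) (normalForm1 p q 0) (normalForm2 p q e g h l m' 0)) := by
  obtain ⟨i, hi⟩ := exists_inverse p h0
  have hi2 : FnOfU2 i := hp.of_mul_eq_one hi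
  -- the linear equation `n + p w' + q w = 0` for `w = φ'`
  obtain ⟨w, hw, e0⟩ := hU.exists_linear_ode (hq.mul hi2) (hn.mul hi2).neg
  obtain ⟨φ, hφ, e1⟩ := hU.exists_fnOfU2_partialD_eq hw
  have e1' : prime φ = w := e1
  have hφ' : FnOfU2 (prime φ) := hU.fnOfU2_partialD hφ
  have hs := reducesTo_shift (g := g) (h := h) (l := l) (m := m) (n := n) hp hq he hφ hφ'
  have hn0 : n + (p * prime (prime φ) + q * prime φ) = 0 := by
    rw [e1', prime]
    linear_combination p * e0 + (-n - q * w) * hi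
  rw [hn0] at hs
  have h2 : 2 * p * prime φ = (p + p) * prime φ := by ring
  refine ⟨_, hm.add ?_, hs⟩
  rw [h2]
  exact (hp.add hp).mul hφ'

theorem reducesTo_n_zero_of_p_zero (hU : IsBox U) {q e g h l m n : SmoothFn U}
    (hq : FnOfU2 q) (he : FnOfU2 e) (hn : FnOfU2 n) (h0 : ∀ x, q.1 x ≠ 0) :
    ReducesTo 2 (series (P01 U) (normalForm1 0 q 0) (normalForm2 0 q e g h l m n))
      (series (P01 U) (normalForm1 0 q 0) (normalForm2 0 q e g h l m 0)) := by
  obtain ⟨i, hi⟩ := exists_inverse q h0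
  have hi2 : FnOfU2 i := hq.of_mul_eq_one hi
  -- the equation `n + q φ' = 0`
  obtain ⟨φ, hφ, e1⟩ := hU.exists_fnOfU2_partialD_eq (hn.mul hi2).neg
  have e1' : prime φ = -(n * i) := e1
  have hφ' : FnOfU2 (prime φ) := hU.fnOfU2_partialD hφ
  have hs := reducesTo_shift (g := g) (h := h) (l := l) (m := m) (n := n) FnOfU2.zero hq he hφ hφ'
  have hn0 : n + (0 * prime (prime φ) + q * prime φ) = 0 := by
    rw [e1']
    linear_combination -n * hi
  rwa [hn0, mul_zero, zero_mul, add_zero] at hs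

end ResidualFreedom

end HydroDeform

end

open HydroDeform in
theorem theorem4
    (I J : Set ℝ) (hI : I.OrdConnected) (hJ : J.OrdConnected)
    (U : TopologicalSpace.Opens (Fin 2 → ℝ)) (hU : ∀ u, u ∈ U ↔ u 0 ∈ I ∧ u 1 ∈ J) :
    -- first-order deformations reduce to the first normal form
    (∀ P : ℕ → MatOp U, IsDeformation 1 (P01 U) P →
      ∃ p q r : SmoothFn U, FnOfU2 p ∧ FnOfU2 q ∧ FnOfU2 r ∧
        ReducesTo 1 P (series (P01 U) (normalForm1 p q r) 0)) ∧
    -- the functions `p, q, r` are arbitrary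
    (∀ p q r : SmoothFn U, FnOfU2 p → FnOfU2 q → FnOfU2 r →
      IsDeformation 1 (P01 U) (series (P01 U) (normalForm1 p q r) 0)) ∧
    -- second-order deformations reduce to the second normal form
    (∀ P : ℕ → MatOp U, IsDeformation 2 (P01 U) P →
      ∃ p q e g h l m n : SmoothFn U,
        FnOfU2 p ∧ FnOfU2 q ∧ FnOfU2 e ∧ FnOfU2 g ∧ FnOfU2 h ∧ FnOfU2 l ∧ FnOfU2 m ∧ FnOfU2 n ∧
        ReducesTo 2 P
          (series (P01 U) (normalForm1 p q 0) (normalForm2 p q e g h l m n))) ∧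
    -- the functions `p, q, e, g, h, l, m, n` are arbitrary, and one of `m`, `n` can be removed
    (∀ p q e g h l m n : SmoothFn U,
      FnOfU2 p → FnOfU2 q → FnOfU2 e → FnOfU2 g → FnOfU2 h → FnOfU2 l → FnOfU2 m → FnOfU2 n →
      IsDeformation 2 (P01 U)
        (series (P01 U) (normalForm1 p q 0) (normalForm2 p q e g h l m n)) ∧
      ((∀ x : U, p.1 x ≠ 0) →
        (∃ n' : SmoothFn U, FnOfU2 n' ∧
          ReducesTo 2
            (series (P01 U) (normalForm1 p q 0) (normalForm2 p q e g h l m n))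
            (series (P01 U) (normalForm1 p q 0) (normalForm2 p q e g h l 0 n'))) ∧
        (∃ m' : SmoothFn U, FnOfU2 m' ∧
          ReducesTo 2
            (series (P01 U) (normalForm1 p q 0) (normalForm2 p q e g h l m n))
            (series (P01 U) (normalForm1 p q 0) (normalForm2 p q e g h l m' 0)))) ∧
      (p = 0 → (∀ x : U, q.1 x ≠ 0) →
        ReducesTo 2
          (series (P01 U) (normalForm1 p q 0) (normalForm2 p q e g h l m n))
          (series (P01 U) (normalForm1 p q 0) (normalForm2 p q e g h l m 0)))) := by
  have hbox : IsBox U := ⟨I, J, hI, hJ, hU⟩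
  refine ⟨fun P hP => ?_, fun p q r hp hq hr => ?_, fun P hP => hP.exists_second hbox,
    fun p q e g h l m n hp hq he hg hh hl hm hn => ⟨?_, fun h0 => ⟨?_, ?_⟩, fun h0 h1 => ?_⟩⟩
  · obtain ⟨ξ, hξ, p, q, r, hp, hq, hr, e⟩ := hP.exists_first hbox le_rfl
    exact ⟨p, q, r, hp, hq, hr, reducesTo_one hP.zero hξ e⟩
  · exact isDeformation_series one_le_two (isSkew_normalForm1 p q r) isSkew_zero
      (hasOpDegree_normalForm1 p q r) (hasOpDegree_zero 3) (schouten_P01_normalForm1 hp hq hr)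
      fun h2 => absurd h2 (by norm_num)
  · exact isDeformation_series le_rfl (isSkew_normalForm1 p q 0) (isSkew_normalForm2 he)
      (hasOpDegree_normalForm1 p q 0) (hasOpDegree_normalForm2 he)
      (schouten_P01_normalForm1 hp hq FnOfU2.zero)
      fun _ => schouten_normalForm2 hp hq he hg hh hl hm hn
  · exact reducesTo_m_zero hbox hp hq he hm hn h0
  · exact reducesTo_n_zero hbox hp hq he hm hn h0
  · subst h0
    exact reducesTo_n_zero_of_p_zero hbox hq he hn h1
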